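/- Let $h,w\in\mathbb C$. All expressions in $h$ and $w$ below are read as power series in the generators, so that $\frac{\sinh(hE)}{h}=\sum_{n\text{ odd}}\frac{h^{n-1}}{n!}E^n$ and $\frac{e^{cA^+}-1}{c}=\sum_{n\ge1}\frac{c^{n-1}}{n!}(A^+)^n$, also for $h=0$ or $c=0$. Let $U=U_{h,w}(H(4))$ be the unital associative $\mathbb C$-algebra topologically generated by $N,E,A^+,A$, with $E$ central and $$[A,A^+]=\frac{\sinh(hE)}{h}\,e^{wA^+},\qquad [N,A^+]=\frac{e^{wA^+}-1}{w},\qquad [N,A]=-A,$$ complete for the topology defined by the powers of the two-sided ideal $J$ generated by $E$ and $A^+$ (so $U=\varprojlim_k U/J^k$). Let $U\hat\otimes U=\varprojlim_k U/J^k\otimes U/J^k$, and similarly $U\hat\otimes U\hat\otimes U$. Let $\sigma$ be the flip of $U\hat\otimes U$. Then $U$ is a topological Hopf algebra with continuous structure maps $\Delta,\varepsilon,S$ such that $$\Delta(N)=N\otimes e^{wA^+}+1\otimes N,\quad \Delta(E)=E\otimes1+1\otimes E,\quad \Delta(A^+)=A^+\otimes1+1\otimes A^+,$$ $$\Delta(A)=A\otimes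 e^{hE}e^{wA^+}+e^{-hE}\otimes A+w\,e^{-hE}N\otimes\frac{\sinh(hE)}{h}e^{wA^+},$$ $$\varepsilon(N)=\varepsilon(E)=\varepsilon(A^+)=\varepsilon(A)=0,$$ $$S(N)=-Ne^{-wA^+},\quad S(E)=-E,\quad S(A^+)=-A^+,\quad S(A)=-Ae^{-wA^+}+wN\frac{\sinh(hE)}{h}e^{-wA^+},$$ and this Hopf algebra is quasitriangular: the series $$F=e^{wN\otimes A^+},\qquad R^h=e^{-2hE\otimes N}\exp\Bigl(2h\,e^{hE}A\otimes\frac{1-e^{-wA^+}}{w}\Bigr)$$ converge in $U\hat\otimes U$, $F$ is invertible, and $$R=R^{h,w}=(\sigma(F))^{-1}\,R^h\,F$$ is a universal $R$-matrix, that is, $R$ is invertible, $R\,\Delta(u)\,R^{-1}=\sigma(\Delta(u))$ for all $u\in U$, $(\Delta\otimes\mathrm{id})(R)=R_{13}R_{23}$ and $(\mathrm{id}\otimes\Delta)(R)=R_{13}R_{12}$. Moreover $R$ satisfies the quantum Yang–Baxter equation $R_{12}R_{13}R_{23}=R_{23}R_{13}R_{12}$. -/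

import Mathlib

open scoped TensorProduct

noncomputable section

/-! ### Complete (pro-discrete) algebras and their completed tensor products -/

/-- A tower `⋯ → B₂ → B₁ → B₀` of complex algebras with surjective transition maps. It stands for
the complete topological algebra `lim B_k`. -/
structure ProAlg where
  obj : ℕ → Type
  [ring : ∀ k, Ring (obj k)]
  [algebra : ∀ k, Algebra ℂ (obj k)]
  map : ∀ k, obj (k + 1) →ₐ[ℂ] obj k
  map_surjective : ∀ k, Function.Surjective (map k)

namespace ProAlg

attribute [instance] ProAlg.ring ProAlg.algebra

/-- The limit of the tower, inside the product of all levels. -/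
def limit (X : ProAlg) : Subalgebra ℂ (∀ k, X.obj k) where
  carrier := {x | ∀ k, X.map k (x (k + 1)) = x k}
  mul_mem' := fun ha hb k => by simp [ha k, hb k]
  add_mem' := fun ha hb k => by simp [ha k, hb k]
  algebraMap_mem' := fun r k => by simp

/-- The complete algebra `lim B_k`. -/
abbrev Lim (X : ProAlg) : Type := X.limit

/-- The limit topology, each level being discrete. -/
instance (X : ProAlg) : TopologicalSpace X.Lim :=
  ⨅ k, TopologicalSpace.induced (fun x : X.Lim => x.1 k) ⊥

/-- The tower `B_k ⊗ C_k`, whose limit is the completed tensor product of `lim B_k` and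
`lim C_k`. -/
def tensor (X Y : ProAlg) : ProAlg where
  obj := fun k => X.obj k ⊗[ℂ] Y.obj k
  map := fun k => Algebra.TensorProduct.map (X.map k) (Y.map k)
  map_surjective := fun k => TensorProduct.map_surjective (X.map_surjective k) (Y.map_surjective k)

/-- The pure tensor `x ⊗ y` in the completed tensor product. -/
def tmul {X Y : ProAlg} (x : X.Lim) (y : Y.Lim) : (X.tensor Y).Lim :=
  ⟨fun k => x.1 k ⊗ₜ[ℂ] y.1 k, fun k => by
    change Algebra.TensorProduct.map (X.map k) (Y.map k) (x.1 (k + 1) ⊗ₜ[ℂ] y.1 (k + 1)) = _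
    rw [Algebra.TensorProduct.map_tmul, x.2 k, y.2 k]⟩

/-- The map of limits induced by a map of towers. -/
def limMap {X Y : ProAlg} (f : ∀ k, X.obj k →ₐ[ℂ] Y.obj k)
    (hf : ∀ k, (Y.map k).comp (f (k + 1)) = (f k).comp (X.map k)) : X.Lim →ₐ[ℂ] Y.Lim where
  toFun := fun x => ⟨fun k => f k (x.1 k), fun k => by
    have h := DFunLike.congr_fun (hf k) (x.1 (k + 1))
    simp only [AlgHom.comp_apply] at h
    rw [h, x.2 k]⟩
  map_one' := Subtype.ext (funext fun k => map_one (f k))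
  map_mul' := fun x y => Subtype.ext (funext fun k => map_mul (f k) (x.1 k) (y.1 k))
  map_zero' := Subtype.ext (funext fun k => map_zero (f k))
  map_add' := fun x y => Subtype.ext (funext fun k => map_add (f k) (x.1 k) (y.1 k))
  commutes' := fun r => Subtype.ext (funext fun k => (f k).commutes r)

/-- The flip `a ⊗ b ↦ b ⊗ a`. -/
def flip {X Y : ProAlg} : (X.tensor Y).Lim →ₐ[ℂ] (Y.tensor X).Lim :=
  limMap (fun k => (Algebra.TensorProduct.comm ℂ (X.obj k) (Y.obj k)).toAlgHom)
    (fun _ => Algebra.TensorProduct.ext' fun _ _ => rfl)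

theorem assoc_natural {B B' C C' D D' : Type} [Ring B] [Ring B'] [Ring C] [Ring C'] [Ring D]
    [Ring D'] [Algebra ℂ B] [Algebra ℂ B'] [Algebra ℂ C] [Algebra ℂ C'] [Algebra ℂ D]
    [Algebra ℂ D'] (f : B →ₐ[ℂ] B') (g : C →ₐ[ℂ] C') (h : D →ₐ[ℂ] D') :
    (Algebra.TensorProduct.map f (Algebra.TensorProduct.map g h)).comp
        (Algebra.TensorProduct.assoc ℂ ℂ ℂ B C D).toAlgHom =
      (Algebra.TensorProduct.assoc ℂ ℂ ℂ B' C' D').toAlgHom.comp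
        (Algebra.TensorProduct.map (Algebra.TensorProduct.map f g) h) := by
  apply Algebra.TensorProduct.ext
  · exact Algebra.TensorProduct.ext' fun _ _ => by simp
  · ext; simp [Algebra.TensorProduct.one_def]

/-- The associator `(a ⊗ b) ⊗ c ↦ a ⊗ (b ⊗ c)`. -/
def assoc {X Y Z : ProAlg} : ((X.tensor Y).tensor Z).Lim →ₐ[ℂ] (X.tensor (Y.tensor Z)).Lim :=
  limMap (fun k =>
      (Algebra.TensorProduct.assoc ℂ ℂ ℂ (X.obj k) (Y.obj k) (Z.obj k)).toAlgHom)
    (fun k => assoc_natural (X.map k) (Y.map k) (Z.map k))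

/-- `a ⊗ b ↦ a ⊗ b ⊗ 1`. -/
def leg12 {X : ProAlg} : (X.tensor X).Lim →ₐ[ℂ] (X.tensor (X.tensor X)).Lim :=
  limMap (fun k => Algebra.TensorProduct.map (AlgHom.id ℂ (X.obj k))
      (Algebra.TensorProduct.includeLeft : X.obj k →ₐ[ℂ] X.obj k ⊗[ℂ] X.obj k))
    (fun k => Algebra.TensorProduct.ext' fun a b => by
      change X.map k a ⊗ₜ[ℂ] (X.map k b ⊗ₜ[ℂ] X.map k 1) = X.map k a ⊗ₜ[ℂ] (X.map k b ⊗ₜ[ℂ] 1)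
      rw [map_one])

/-- `a ⊗ b ↦ a ⊗ 1 ⊗ b`. -/
def leg13 {X : ProAlg} : (X.tensor X).Lim →ₐ[ℂ] (X.tensor (X.tensor X)).Lim :=
  limMap (fun k => Algebra.TensorProduct.map (AlgHom.id ℂ (X.obj k))
      (Algebra.TensorProduct.includeRight : X.obj k →ₐ[ℂ] X.obj k ⊗[ℂ] X.obj k))
    (fun k => Algebra.TensorProduct.ext' fun a b => by
      change X.map k a ⊗ₜ[ℂ] (X.map k 1 ⊗ₜ[ℂ] X.map k b) = X.map k a ⊗ₜ[ℂ] (1 ⊗ₜ[ℂ] X.map k b)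
      rw [map_one])

/-- `a ⊗ b ↦ 1 ⊗ a ⊗ b`. -/
def leg23 {X : ProAlg} : (X.tensor X).Lim →ₐ[ℂ] (X.tensor (X.tensor X)).Lim :=
  limMap (fun k => (Algebra.TensorProduct.includeRight :
      X.obj k ⊗[ℂ] X.obj k →ₐ[ℂ] X.obj k ⊗[ℂ] (X.obj k ⊗[ℂ] X.obj k)))
    (fun k => Algebra.TensorProduct.ext' fun a b => by
      change X.map k 1 ⊗ₜ[ℂ] (X.map k a ⊗ₜ[ℂ] X.map k b) = 1 ⊗ₜ[ℂ] (X.map k a ⊗ₜ[ℂ] X.map k b)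
      rw [map_one])

end ProAlg

infixl:72 " ⊠ " => ProAlg.tmul

/-! ### Topological Hopf algebras and universal R-matrices -/

/-- A Hopf algebra structure on the complete algebra `U = X.Lim`, with coproduct in the completed
tensor square. The maps `comulLeft = Δ ⊗ id`, `comulRight = id ⊗ Δ`, `counitLeft = ε ⊗ id`,
`counitRight = id ⊗ ε`, `antipodeLeft = m (S ⊗ id)` and `antipodeRight = m (id ⊗ S)` on the completed
tensor square are the continuous linear maps with the given values on pure tensors; as pure tensors
span a dense subspace, these values determine them. -/
structure TopHopf (X : ProAlg) where
  comul : X.Lim →A[ℂ] (X.tensor X).Lim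
  counit : X.Lim →A[ℂ] ℂ
  antipode : X.Lim →L[ℂ] X.Lim
  comulLeft : (X.tensor X).Lim →L[ℂ] (X.tensor (X.tensor X)).Lim
  comulLeft_tmul : ∀ x y, comulLeft (x ⊠ y) = ProAlg.assoc (comul x ⊠ y)
  comulRight : (X.tensor X).Lim →L[ℂ] (X.tensor (X.tensor X)).Lim
  comulRight_tmul : ∀ x y, comulRight (x ⊠ y) = x ⊠ comul y
  counitLeft : (X.tensor X).Lim →L[ℂ] X.Lim
  counitLeft_tmul : ∀ x y, counitLeft (x ⊠ y) = counit x • y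
  counitRight : (X.tensor X).Lim →L[ℂ] X.Lim
  counitRight_tmul : ∀ x y, counitRight (x ⊠ y) = counit y • x
  antipodeLeft : (X.tensor X).Lim →L[ℂ] X.Lim
  antipodeLeft_tmul : ∀ x y, antipodeLeft (x ⊠ y) = antipode x * y
  antipodeRight : (X.tensor X).Lim →L[ℂ] X.Lim
  antipodeRight_tmul : ∀ x y, antipodeRight (x ⊠ y) = x * antipode y
  coassoc : ∀ x, comulLeft (comul x) = comulRight (comul x)
  counitLeft_comul : ∀ x, counitLeft (comul x) = x
  counitRight_comul : ∀ x, counitRight (comul x) = x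
  antipodeLeft_comul : ∀ x, antipodeLeft (comul x) = algebraMap ℂ X.Lim (counit x)
  antipodeRight_comul : ∀ x, antipodeRight (comul x) = algebraMap ℂ X.Lim (counit x)

/-- `R` is a universal R-matrix: `R` is invertible, `R Δ(u) R⁻¹ = σ(Δ(u))`,
`(Δ ⊗ id)(R) = R₁₃ R₂₃` and `(id ⊗ Δ)(R) = R₁₃ R₁₂`. -/
structure TopHopf.IsUniversalRMatrix {X : ProAlg} (H : TopHopf X) (R : (X.tensor X).Lim) :
    Prop where
  isUnit : IsUnit R
  intertwine : ∀ u, R * H.comul u * Ring.inverse R = ProAlg.flip (H.comul u)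
  comulLeft : H.comulLeft R = ProAlg.leg13 R * ProAlg.leg23 R
  comulRight : H.comulRight R = ProAlg.leg13 R * ProAlg.leg12 R

/-- The quantum Yang–Baxter equation `R₁₂ R₁₃ R₂₃ = R₂₃ R₁₃ R₁₂`. -/
def SatisfiesQYBE {X : ProAlg} (R : (X.tensor X).Lim) : Prop :=
  ProAlg.leg12 R * ProAlg.leg13 R * ProAlg.leg23 R =
    ProAlg.leg23 R * ProAlg.leg13 R * ProAlg.leg12 R

/-! ### The power series that occur -/

namespace H4

/-- Coefficients of `exp x`. -/
def expCoeff (n : ℕ) : ℂ := (n.factorial : ℂ)⁻¹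

/-- Coefficients of `sinh (h x) / h` (that is, of `x` for `h = 0`). -/
def sinhCoeff (h : ℂ) (n : ℕ) : ℂ := if Odd n then h ^ (n - 1) / (n.factorial : ℂ) else 0

/-- Coefficients of `(exp (c x) - 1) / c` (that is, of `x` for `c = 0`). -/
def expm1Coeff (c : ℂ) (n : ℕ) : ℂ := if n = 0 then 0 else c ^ (n - 1) / (n.factorial : ℂ)

/-- The sum of the power series `∑ c n xⁿ` in a complete algebra. -/
def series {X : ProAlg} (c : ℕ → ℂ) (x : X.Lim) : X.Lim := ∑' n, c n • x ^ n

/-- Convergence of the power series `∑ c n xⁿ` in a complete algebra. -/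
def Converges {X : ProAlg} (c : ℕ → ℂ) (x : X.Lim) : Prop := Summable fun n => c n • x ^ n

/-- The exponential in a complete algebra. -/
def expo {X : ProAlg} (x : X.Lim) : X.Lim := series expCoeff x

/-! ### The algebra `U_{h,w}(H(4))` -/

/-- The generators `N`, `E`, `A⁺`, `A`. -/
inductive Gen
  | N | E | Ap | A
  deriving DecidableEq

open Gen

/-- Truncated power series `∑_{n < k} c n xⁿ` in an algebra. -/
def trunc {B : Type*} [Ring B] [Algebra ℂ B] (k : ℕ) (c : ℕ → ℂ) (x : B) : B :=
  ∑ n ∈ Finset.range k, c n • x ^ n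

/-- The number of letters of a word that are `E` or `A⁺`. -/
def weight (l : List Gen) : ℕ := l.count E + l.count Ap

/-- The relations at level `k`: the defining relations of `U_{h,w}(H(4))`, and the vanishing of all
words with at least `k` letters among `E` and `A⁺`. These words span `J ^ k`, where `J` is the
two-sided ideal generated by `E` and `A⁺`, so that the terms `n ≥ k` of the power series in `E` or
`A⁺` are zero at level `k`. -/
inductive Rel (h w : ℂ) (k : ℕ) : FreeAlgebra ℂ Gen → FreeAlgebra ℂ Gen → Prop
  | central (g : Gen) : Rel h w k (.ι ℂ E * .ι ℂ g) (.ι ℂ g * .ι ℂ E)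
  | A_Ap : Rel h w k (.ι ℂ A * .ι ℂ Ap - .ι ℂ Ap * .ι ℂ A)
      (trunc k (sinhCoeff h) (.ι ℂ E) * trunc k expCoeff (w • .ι ℂ Ap))
  | N_Ap : Rel h w k (.ι ℂ N * .ι ℂ Ap - .ι ℂ Ap * .ι ℂ N) (trunc k (expm1Coeff w) (.ι ℂ Ap))
  | N_A : Rel h w k (.ι ℂ N * .ι ℂ A - .ι ℂ A * .ι ℂ N) (-.ι ℂ A)
  | word (l : List Gen) (hl : k ≤ weight l) : Rel h w k (l.map (FreeAlgebra.ι ℂ)).prod 0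

/-- The quotient of `U_{h,w}(H(4))` by the `k`-th power of the ideal generated by `E` and `A⁺`. -/
abbrev Level (h w : ℂ) (k : ℕ) : Type := RingQuot (Rel h w k)

/-- The projection from the free algebra to level `k`. -/
def proj (h w : ℂ) (k : ℕ) : FreeAlgebra ℂ Gen →ₐ[ℂ] Level h w k :=
  RingQuot.mkAlgHom ℂ (Rel h w k)

theorem proj_word (h w : ℂ) (k : ℕ) (l : List Gen) (hl : k ≤ weight l) :
    proj h w k (l.map (FreeAlgebra.ι ℂ)).prod = 0 := by
  simpa [proj] using RingQuot.mkAlgHom_rel ℂ (Rel.word (h := h) (w := w) l hl)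

theorem proj_E_pow (h w : ℂ) (k : ℕ) : proj h w k (.ι ℂ E ^ k) = 0 := by
  simpa using proj_word h w k (List.replicate k E) (by simp [weight])

theorem proj_Ap_pow (h w : ℂ) (k : ℕ) : proj h w k (.ι ℂ Ap ^ k) = 0 := by
  simpa using proj_word h w k (List.replicate k Ap) (by simp [weight])

theorem proj_trunc_succ (h w : ℂ) (k : ℕ) (c : ℕ → ℂ) (x : FreeAlgebra ℂ Gen)
    (hx : proj h w k (x ^ k) = 0) :
    proj h w k (trunc (k + 1) c x) = proj h w k (trunc k c x) := by
  rw [trunc, Finset.sum_range_succ, map_add, map_smul, hx, smul_zero, add_zero, trunc]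

theorem proj_rel_succ (h w : ℂ) (k : ℕ) ⦃x y : FreeAlgebra ℂ Gen⦄ (hxy : Rel h w (k + 1) x y) :
    proj h w k x = proj h w k y := by
  cases hxy with
  | central g => exact RingQuot.mkAlgHom_rel ℂ (Rel.central g)
  | A_Ap =>
    rw [map_mul, proj_trunc_succ _ _ _ _ _ (proj_E_pow h w k),
      proj_trunc_succ _ _ _ _ _ (by rw [smul_pow, map_smul, proj_Ap_pow, smul_zero]), ← map_mul]
    exact RingQuot.mkAlgHom_rel ℂ Rel.A_Ap
  | N_Ap =>
    rw [proj_trunc_succ _ _ _ _ _ (proj_Ap_pow h w k)]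
    exact RingQuot.mkAlgHom_rel ℂ Rel.N_Ap
  | N_A => exact RingQuot.mkAlgHom_rel ℂ Rel.N_A
  | word l hl => rw [map_zero]; exact proj_word h w k l (by omega)

/-- The transition map from level `k + 1` to level `k`. -/
def transition (h w : ℂ) (k : ℕ) : Level h w (k + 1) →ₐ[ℂ] Level h w k :=
  RingQuot.liftAlgHom ℂ ⟨proj h w k, proj_rel_succ h w k⟩

theorem transition_proj (h w : ℂ) (k : ℕ) (x : FreeAlgebra ℂ Gen) :
    transition h w k (proj h w (k + 1) x) = proj h w k x :=
  RingQuot.liftAlgHom_mkAlgHom_apply ℂ _ _ _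

/-- The tower whose limit is the complete algebra `U_{h,w}(H(4))`: the algebra topologically
generated by `N`, `E`, `A⁺`, `A` with `E` central and `[A, A⁺] = (sinh (h E) / h) exp (w A⁺)`,
`[N, A⁺] = (exp (w A⁺) - 1) / w`, `[N, A] = -A`, complete for the topology defined by the powers of
the ideal generated by `E` and `A⁺`. -/
def tower (h w : ℂ) : ProAlg where
  obj := Level h w
  map := transition h w
  map_surjective := fun k y => by
    obtain ⟨x, rfl⟩ := RingQuot.mkAlgHom_surjective ℂ (Rel h w k) y
    exact ⟨proj h w (k + 1) x, transition_proj h w k x⟩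

/-- The complete algebra `U_{h,w}(H(4))`. -/
abbrev U (h w : ℂ) : Type := (tower h w).Lim

/-- The completed tensor square of `U_{h,w}(H(4))`. -/
abbrev U2 (h w : ℂ) : Type := ((tower h w).tensor (tower h w)).Lim

/-- A generator, as an element of `U_{h,w}(H(4))`. -/
def gen (h w : ℂ) (g : Gen) : U h w :=
  ⟨fun k => proj h w k (.ι ℂ g), fun k => transition_proj h w k _⟩

/-- `sinh (h E) / h`. -/
def sinhE (h w : ℂ) : U h w := series (sinhCoeff h) (gen h w E)

/-- `exp (c E)`. -/
def expE (h w c : ℂ) : U h w := expo (c • gen h w E)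

/-- `exp (c A⁺)`. -/
def expAp (h w c : ℂ) : U h w := expo (c • gen h w Ap)

/-- `(1 - exp (-w A⁺)) / w`. -/
def apTilde (h w : ℂ) : U h w := series (expm1Coeff (-w)) (gen h w Ap)

/-- `F = exp (w N ⊗ A⁺)`. -/
def twist (h w : ℂ) : U2 h w := expo (w • (gen h w N ⊠ gen h w Ap))

/-- `Rʰ = exp (-2h E ⊗ N) exp (2h exp (h E) A ⊗ (1 - exp (-w A⁺)) / w)`. -/
def Rh (h w : ℂ) : U2 h w :=
  expo ((-2 * h) • (gen h w E ⊠ gen h w N)) *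
    expo ((2 * h) • ((expE h w h * gen h w A) ⊠ apTilde h w))

/-- `R = (σ(F))⁻¹ Rʰ F`. -/
def Rhw (h w : ℂ) : U2 h w :=
  Ring.inverse (ProAlg.flip (twist h w)) * Rh h w * twist h w

/-- All the power series that enter the Hopf structure and the R-matrix converge. -/
structure SeriesConverge (h w : ℂ) : Prop where
  sinhE : Converges (sinhCoeff h) (gen h w E)
  expE : ∀ c : ℂ, Converges expCoeff (c • gen h w E)
  expAp : ∀ c : ℂ, Converges expCoeff (c • gen h w Ap)
  apTilde : Converges (expm1Coeff (-w)) (gen h w Ap)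
  twist : Converges expCoeff (w • (gen h w N ⊠ gen h w Ap))
  Rh_left : Converges expCoeff ((-2 * h) • (gen h w E ⊠ gen h w N))
  Rh_right : Converges expCoeff ((2 * h) • ((H4.expE h w h * gen h w A) ⊠ H4.apTilde h w))

/-- The Hopf structure of `U_{h,w}(H(4))`, given by its values on the generators. -/
structure IsHopfOfU (h w : ℂ) (H : TopHopf (tower h w)) : Prop where
  comul_N : H.comul (gen h w N) = gen h w N ⊠ expAp h w w + 1 ⊠ gen h w N
  comul_E : H.comul (gen h w E) = gen h w E ⊠ 1 + 1 ⊠ gen h w E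
  comul_Ap : H.comul (gen h w Ap) = gen h w Ap ⊠ 1 + 1 ⊠ gen h w Ap
  comul_A : H.comul (gen h w A) =
    gen h w A ⊠ (expE h w h * expAp h w w) + expE h w (-h) ⊠ gen h w A +
      w • ((expE h w (-h) * gen h w N) ⊠ (sinhE h w * expAp h w w))
  counit_gen : ∀ g, H.counit (gen h w g) = 0
  antipode_N : H.antipode (gen h w N) = -(gen h w N * expAp h w (-w))
  antipode_E : H.antipode (gen h w E) = -gen h w E
  antipode_Ap : H.antipode (gen h w Ap) = -gen h w Ap
  antipode_A : H.antipode (gen h w A) =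
    -(gen h w A * expAp h w (-w)) + w • (gen h w N * sinhE h w * expAp h w (-w))

end H4

end

/-!
Write `p = w A⁺`, `K = exp (h E)`, `S = sinh (h E) / h` and `B = (1 - exp (-w A⁺)) / w`. At each level of
the tower the elements `E` and `A⁺` are nilpotent, so every power series that occurs is there a finite
sum (`series_level`); identities between series reduce to additivity of the exponential and to the
formula `[y, f(x)] = f'(x) [y, x]` for `[y, x]` commuting with `x` (`commutator_series`). No normal form
of the elements of `U` is needed. The algebra is controlled by its universal property
(`IsRep.exists_lift`: relations, and vanishing of words of large weight at each level) and by density of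
the polynomials in the generators (`eq_of_subalgebra`); the coproduct and the antipode, the latter with
values in the opposite algebra, come from the former, and the Hopf axioms are checked on generators by
the latter. For the completed tensor products, density of the span of pure tensors
(`dense_span_tmul`) plays the same role, and `tensorMap` builds `f ⊗ g` for continuous linear `f`, `g`.

The R-matrix. The element `B` satisfies `[N, B] = B` and `[A, B] = S`, and conjugation by
`F = exp (w N ⊗ A⁺)` turns `Δ` into the coproduct `Δ₀` of `U_{h,0}`, for which `N`, `E`, `B` are primitive
and `Δ₀(A) = A ⊗ K + K⁻¹ ⊗ A` (`twist_mul_comul_N`, `twist_mul_comul_A`, `twist_mul_comul_apTilde`). The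
element `Rʰ` intertwines `Δ₀` and its flip on `N`, `E`, `A`, `B` (`Rh_commute_primitive_N`, `Rh_mul_A`,
`Rh_mul_primitive_apTilde`); hence `R = F₂₁⁻¹ Rʰ F` intertwines `Δ` and its flip on these elements. As
`A⁺` is a power series in `B`, it does so everywhere (`Rhw_mul_comul`).

The hexagon identities combine `F₁₂ (Δ ⊗ id)(F) = F₁₃ F₂₃ F₁₂`, `(Δ ⊗ id)(F₂₁) = F₃₁ F₃₂`,
`F₁₂ (Δ ⊗ id)(Rʰ) = Rʰ₁₃ Rʰ₂₃ F₁₂` and the analogous formulas for `id ⊗ Δ` with the facts that `R` commutes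
with `Δ(A⁺) = A⁺ ⊗ 1 + 1 ⊗ A⁺` and that `Rʰ` commutes with `N ⊗ 1 + 1 ⊗ N`, which allow `F` to be moved past
`R` and `Rʰ` in three tensor factors (`comulLeft_Rhw`, `comulRight_Rhw`). The Yang–Baxter equation is the
intertwining property applied to the first two factors of `(Δ ⊗ id)(R) = R₁₃ R₂₃`.
-/

noncomputable section

namespace ProAlg

open Filter Topology

variable {X Y X' Y' : ProAlg}

/-- A shortcut instance: with it, lemmas about `-x` unify with the negation of the limit algebra. -/
instance : HasDistribNeg X.Lim := NonUnitalNonAssocRing.toHasDistribNeg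

theorem lim_ext {x y : X.Lim} (h : ∀ k, x.1 k = y.1 k) : x = y := Subtype.ext (funext h)

@[simp] theorem level_add (x y : X.Lim) (k : ℕ) : (x + y).1 k = x.1 k + y.1 k := rfl
@[simp] theorem level_sub (x y : X.Lim) (k : ℕ) : (x - y).1 k = x.1 k - y.1 k := rfl
@[simp] theorem level_neg (x : X.Lim) (k : ℕ) : (-x).1 k = -x.1 k := rfl
@[simp] theorem level_mul (x y : X.Lim) (k : ℕ) : (x * y).1 k = x.1 k * y.1 k := rfl
@[simp] theorem level_smul (c : ℂ) (x : X.Lim) (k : ℕ) : (c • x).1 k = c • x.1 k := rfl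
@[simp] theorem level_zero (k : ℕ) : (0 : X.Lim).1 k = 0 := rfl
@[simp] theorem level_one (k : ℕ) : (1 : X.Lim).1 k = 1 := rfl
@[simp] theorem level_tmul (x : X.Lim) (y : Y.Lim) (k : ℕ) : (x ⊠ y).1 k = x.1 k ⊗ₜ[ℂ] y.1 k := rfl

/-- The projection to level `k`. -/
def level (X : ProAlg) (k : ℕ) : X.Lim →ₐ[ℂ] X.obj k :=
  (Pi.evalAlgHom ℂ X.obj k).comp X.limit.val

@[simp] theorem level_apply (x : X.Lim) (k : ℕ) : X.level k x = x.1 k := rfl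

@[simp] theorem level_pow (x : X.Lim) (n k : ℕ) : (x ^ n).1 k = x.1 k ^ n :=
  map_pow (X.level k) x n

@[simp] theorem level_sum {ι : Type*} (s : Finset ι) (f : ι → X.Lim) (k : ℕ) :
    (∑ i ∈ s, f i).1 k = ∑ i ∈ s, (f i).1 k :=
  map_sum (X.level k) f s

theorem level_eq_of_le {x y : X.Lim} {j m : ℕ} (hjm : j ≤ m) (h : x.1 m = y.1 m) :
    x.1 j = y.1 j := by
  induction m, hjm using Nat.le_induction with
  | base => exact h
  | succ m _ ih => exact ih (by rw [← x.2 m, ← y.2 m, h])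

/-! ### The limit topology -/

theorem tendsto_iff {ι : Type*} {l : Filter ι} {f : ι → X.Lim} {a : X.Lim} :
    Tendsto f l (𝓝 a) ↔ ∀ k, ∀ᶠ i in l, (f i).1 k = a.1 k := by
  rw [nhds_iInf, tendsto_iInf]
  refine forall_congr' fun k => ?_
  rw [@nhds_induced _ _ ⊥, tendsto_comap_iff, @nhds_discrete _ ⊥ (@DiscreteTopology.mk _ ⊥ rfl), tendsto_pure]
  rfl

theorem eventually_level (a : X.Lim) (k : ℕ) : ∀ᶠ x in 𝓝 a, x.1 k = a.1 k :=
  tendsto_iff.1 tendsto_id k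

theorem hasBasis_nhds (a : X.Lim) : (𝓝 a).HasBasis (fun _ : ℕ => True) fun k => {x | x.1 k = a.1 k} := by
  refine ⟨fun s => ⟨fun hs => ?_, fun ⟨k, _, hk⟩ => mem_of_superset (eventually_level a k) hk⟩⟩
  by_contra! hcon
  have h : ∀ k, ∃ x : X.Lim, x.1 k = a.1 k ∧ x ∉ s := fun k => by
    simpa [Set.not_subset] using hcon k trivial
  choose f hf hfs using h
  have : Tendsto f atTop (𝓝 a) := tendsto_iff.2 fun k => by
    filter_upwards [eventually_ge_atTop k] with n hn
    exact level_eq_of_le hn (hf n)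
  obtain ⟨n, hn⟩ := (this.eventually hs).exists
  exact hfs n hn

instance : T2Space X.Lim := by
  refine t2_iff_nhds.2 fun {x y} h => lim_ext fun k => ?_
  have h1 : ∀ᶠ z in 𝓝 x ⊓ 𝓝 y, z.1 k = x.1 k := Filter.Eventually.filter_mono inf_le_left (eventually_level x k)
  have h2 : ∀ᶠ z in 𝓝 x ⊓ 𝓝 y, z.1 k = y.1 k := Filter.Eventually.filter_mono inf_le_right (eventually_level y k)
  obtain ⟨z, hz1, hz2⟩ := (h1.and h2).exists
  rw [← hz1, hz2]

instance : IsTopologicalRing X.Lim where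
  continuous_add := continuous_iff_continuousAt.2 fun p => tendsto_iff.2 fun k => by
    rw [nhds_prod_eq]
    filter_upwards [(eventually_level p.1 k).prod_mk (eventually_level p.2 k)] with q hq
    rw [level_add, level_add, hq.1, hq.2]
  continuous_mul := continuous_iff_continuousAt.2 fun p => tendsto_iff.2 fun k => by
    rw [nhds_prod_eq]
    filter_upwards [(eventually_level p.1 k).prod_mk (eventually_level p.2 k)] with q hq
    rw [level_mul, level_mul, hq.1, hq.2]
  continuous_neg := continuous_iff_continuousAt.2 fun p => tendsto_iff.2 fun k => by
    filter_upwards [eventually_level p k] with q hq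
    rw [level_neg, level_neg, hq]

instance : ContinuousConstSMul ℂ X.Lim where
  continuous_const_smul c := continuous_iff_continuousAt.2 fun p => tendsto_iff.2 fun k => by
    filter_upwards [eventually_level p k] with q hq
    rw [level_smul, level_smul, hq]

/-- A map is continuous if at each level of the target it factors through some level of the source. -/
theorem continuous_of_level {f : X.Lim → Y.Lim}
    (hf : ∀ k, ∃ m, ∀ x y, x.1 m = y.1 m → (f x).1 k = (f y).1 k) : Continuous f :=
  continuous_iff_continuousAt.2 fun a => tendsto_iff.2 fun k => by
    obtain ⟨m, hm⟩ := hf k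
    filter_upwards [eventually_level a m] with x hx using hm _ _ hx

theorem exists_level_of_continuous {f : X.Lim → Y.Lim} (hf : Continuous f) (a : X.Lim) (k : ℕ) :
    ∃ m, ∀ x, x.1 m = a.1 m → (f x).1 k = (f a).1 k := by
  obtain ⟨m, -, hm⟩ := ((hasBasis_nhds a).tendsto_iff (hasBasis_nhds (f a))).1 (hf.tendsto a) k trivial
  exact ⟨m, hm⟩

/-- By linearity, the level through which a continuous linear map factors is uniform in the point. -/
theorem exists_level_map (f : X.Lim →L[ℂ] Y.Lim) (k : ℕ) :
    ∃ m, ∀ n, m ≤ n → ∀ x y : X.Lim, x.1 n = y.1 n → (f x).1 k = (f y).1 k := by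
  obtain ⟨m, hm⟩ := exists_level_of_continuous f.continuous 0 k
  refine ⟨m, fun n hn x y hxy => ?_⟩
  have h := hm (x - y) (by rw [level_sub, level_eq_of_le hn hxy, sub_self, level_zero])
  rw [map_sub, map_zero, level_sub, level_zero] at h
  exact sub_eq_zero.1 h

theorem continuous_limMap (f : ∀ k, X.obj k →ₐ[ℂ] Y.obj k)
    (hf : ∀ k, (Y.map k).comp (f (k + 1)) = (f k).comp (X.map k)) : Continuous (limMap f hf) :=
  continuous_of_level fun k => ⟨k, fun x y h => by
    change f k (x.1 k) = f k (y.1 k)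
    rw [h]⟩

/-- An element of level `k` determines compatible elements below level `k`; the values above `k` are
arbitrary. -/
theorem exists_compatible_below (k : ℕ) (y : X.obj k) :
    ∃ z : ∀ j, X.obj j, z k = y ∧ ∀ j < k, X.map j (z (j + 1)) = z j := by
  induction k with
  | zero => exact ⟨Function.update (fun _ => 0) 0 y, by simp, by simp⟩
  | succ k ih =>
    obtain ⟨z, hz, hz'⟩ := ih (X.map k y)
    refine ⟨Function.update z (k + 1) y, by simp, fun j hj => ?_⟩
    rcases Nat.lt_succ_iff_lt_or_eq.1 hj with hj | rfl
    · rw [Function.update_of_ne (by omega), Function.update_of_ne (by omega), hz' j hj]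
    · rw [Function.update_self, Function.update_of_ne (by omega), hz]

theorem level_surjective (X : ProAlg) (k : ℕ) : Function.Surjective (X.level k) := fun y => by
  obtain ⟨z, hz, hz'⟩ := exists_compatible_below k y
  let x : ∀ j, X.obj j := fun j => Nat.rec (z 0)
    (fun j xj => if j + 1 ≤ k then z (j + 1) else (X.map_surjective j xj).choose) j
  have hx : ∀ j ≤ k, x j = z j := fun j hj => by
    cases j with
    | zero => rfl
    | succ j => exact if_pos hj
  refine ⟨⟨x, fun j => ?_⟩, by rw [level_apply, ← hz]; exact hx k le_rfl⟩
  by_cases hj : j + 1 ≤ k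
  · rw [hx _ hj, hx _ (by omega), hz' j (by omega)]
  · change X.map j (if j + 1 ≤ k then _ else (X.map_surjective j (x j)).choose) = x j
    rw [if_neg hj]
    exact (X.map_surjective j (x j)).choose_spec

/-! ### Pure tensors and tensor products of continuous maps -/

theorem tmul_add (x : X.Lim) (y y' : Y.Lim) : x ⊠ (y + y') = x ⊠ y + x ⊠ y' :=
  lim_ext fun _ => TensorProduct.tmul_add _ _ _
theorem add_tmul (x x' : X.Lim) (y : Y.Lim) : (x + x') ⊠ y = x ⊠ y + x' ⊠ y :=
  lim_ext fun _ => TensorProduct.add_tmul _ _ _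
theorem smul_tmul (c : ℂ) (x : X.Lim) (y : Y.Lim) : (c • x) ⊠ y = c • (x ⊠ y) :=
  lim_ext fun _ => rfl
theorem tmul_smul (c : ℂ) (x : X.Lim) (y : Y.Lim) : x ⊠ (c • y) = c • (x ⊠ y) :=
  lim_ext fun k => TensorProduct.tmul_smul c (x.1 k) (y.1 k)
theorem tmul_mul_tmul (x x' : X.Lim) (y y' : Y.Lim) :
    (x ⊠ y) * (x' ⊠ y') = (x * x') ⊠ (y * y') :=
  lim_ext fun _ => Algebra.TensorProduct.tmul_mul_tmul _ _ _ _
theorem one_tmul_one : (1 : X.Lim) ⊠ (1 : Y.Lim) = 1 := lim_ext fun _ => rfl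
theorem tmul_neg (x : X.Lim) (y : Y.Lim) : x ⊠ (-y) = -(x ⊠ y) :=
  lim_ext fun _ => TensorProduct.tmul_neg _ _
theorem neg_tmul (x : X.Lim) (y : Y.Lim) : (-x) ⊠ y = -(x ⊠ y) :=
  lim_ext fun _ => TensorProduct.neg_tmul _ _
theorem tmul_sub (x : X.Lim) (y y' : Y.Lim) : x ⊠ (y - y') = x ⊠ y - x ⊠ y' := by
  rw [sub_eq_add_neg, tmul_add, tmul_neg, ← sub_eq_add_neg]
theorem sub_tmul (x x' : X.Lim) (y : Y.Lim) : (x - x') ⊠ y = x ⊠ y - x' ⊠ y := by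
  rw [sub_eq_add_neg, add_tmul, neg_tmul, ← sub_eq_add_neg]
theorem tmul_zero (x : X.Lim) : x ⊠ (0 : Y.Lim) = 0 :=
  lim_ext fun _ => TensorProduct.tmul_zero _ _
theorem zero_tmul (y : Y.Lim) : (0 : X.Lim) ⊠ y = 0 :=
  lim_ext fun _ => TensorProduct.zero_tmul _ _

/-- Every element of the completed tensor product agrees with a finite sum of pure tensors up to
any given level. -/
theorem exists_span_tmul (t : (X.tensor Y).Lim) (k : ℕ) :
    ∃ s ∈ Submodule.span ℂ (Set.range fun p : X.Lim × Y.Lim => p.1 ⊠ p.2), s.1 k = t.1 k := by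
  suffices h : ∀ u : X.obj k ⊗[ℂ] Y.obj k, ∃ s ∈ Submodule.span ℂ (Set.range
      fun p : X.Lim × Y.Lim => p.1 ⊠ p.2), s.1 k = u from h (t.1 k)
  intro u
  induction u using TensorProduct.induction_on with
  | zero => exact ⟨0, zero_mem _, rfl⟩
  | tmul x y =>
    obtain ⟨x, rfl⟩ := X.level_surjective k x
    obtain ⟨y, rfl⟩ := Y.level_surjective k y
    exact ⟨x ⊠ y, Submodule.subset_span ⟨(x, y), rfl⟩, rfl⟩
  | add u v hu hv =>
    obtain ⟨s, hs, rfl⟩ := hu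
    obtain ⟨s', hs', rfl⟩ := hv
    exact ⟨s + s', add_mem hs hs', rfl⟩

theorem dense_span_tmul :
    Dense (Submodule.span ℂ (Set.range fun p : X.Lim × Y.Lim => p.1 ⊠ p.2) :
      Set (X.tensor Y).Lim) := fun t => by
  refine (mem_closure_iff_nhds_basis (hasBasis_nhds t)).2 fun k _ => ?_
  obtain ⟨s, hs, h⟩ := exists_span_tmul t k
  exact ⟨s, hs, h⟩

/-- Continuous linear maps on the completed tensor product are determined by their values on
pure tensors. -/
theorem tensor_ext {W : Type*} [TopologicalSpace W] [T2Space W] [AddCommMonoid W] [Module ℂ W]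
    {f g : (X.tensor Y).Lim →ₗ[ℂ] W} (hf : Continuous f) (hg : Continuous g)
    (h : ∀ x y, f (x ⊠ y) = g (x ⊠ y)) (t : (X.tensor Y).Lim) : f t = g t := by
  refine congr_fun (Continuous.ext_on dense_span_tmul hf hg fun s hs => ?_) t
  induction hs using Submodule.span_induction with
  | mem s hs => obtain ⟨p, rfl⟩ := hs; exact h _ _
  | zero => rw [map_zero, map_zero]
  | add s s' _ _ hs hs' => rw [map_add, map_add, hs, hs']
  | smul c s _ hs => rw [map_smul, map_smul, hs]

/-- Both maps factor through a common level; the tensor product of the induced maps of levels does not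
depend on its choice, since pure tensors are dense. -/
theorem exists_tensorMap (f : X.Lim →L[ℂ] X'.Lim) (g : Y.Lim →L[ℂ] Y'.Lim) :
    ∃ T : (X.tensor Y).Lim →L[ℂ] (X'.tensor Y').Lim, ∀ x y, T (x ⊠ y) = f x ⊠ g y := by
  -- A linear section of the surjection onto level `m` turns `f` and `g` into maps of levels.
  have key : ∀ k, ∃ m, ∃ T : (X.tensor Y).obj m →ₗ[ℂ] (X'.tensor Y').obj k,
      ∀ x y, T ((x ⊠ y).1 m) = (f x ⊠ g y).1 k := fun k => by
    obtain ⟨m₁, h₁⟩ := exists_level_map f k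
    obtain ⟨m₂, h₂⟩ := exists_level_map g k
    set m := max m₁ m₂
    obtain ⟨s, hs⟩ := (X.level m).toLinearMap.exists_rightInverse_of_surjective
      (LinearMap.range_eq_top.2 (X.level_surjective m))
    obtain ⟨s', hs'⟩ := (Y.level m).toLinearMap.exists_rightInverse_of_surjective
      (LinearMap.range_eq_top.2 (Y.level_surjective m))
    refine ⟨m, TensorProduct.map ((X'.level k).toLinearMap ∘ₗ f.toLinearMap ∘ₗ s)
      ((Y'.level k).toLinearMap ∘ₗ g.toLinearMap ∘ₗ s'), fun x y => ?_⟩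
    have e₁ := h₁ m (le_max_left _ _) (s (x.1 m)) x (LinearMap.congr_fun hs (x.1 m))
    have e₂ := h₂ m (le_max_right _ _) (s' (y.1 m)) y (LinearMap.congr_fun hs' (y.1 m))
    rw [level_tmul, level_tmul, ← e₁, ← e₂]
    rfl
  choose m T hT using key
  have compat : ∀ (t : (X.tensor Y).Lim) (k : ℕ),
      (X'.tensor Y').map k (T (k + 1) (t.1 (m (k + 1)))) = T k (t.1 (m k)) := fun t k => by
    obtain ⟨s, hs, h⟩ := exists_span_tmul t (max (m k) (m (k + 1)))
    rw [← level_eq_of_le (le_max_left _ _) h, ← level_eq_of_le (le_max_right _ _) h]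
    clear h
    induction hs using Submodule.span_induction with
    | mem s hs =>
      obtain ⟨p, rfl⟩ := hs
      rw [hT, hT]
      exact (f p.1 ⊠ g p.2).2 k
    | zero => rw [level_zero, level_zero, map_zero, map_zero, map_zero]
    | add s s' _ _ hs hs' => rw [level_add, level_add, map_add, map_add, map_add, hs, hs']
    | smul c s _ hs => rw [level_smul, level_smul, map_smul, map_smul, map_smul, hs]
  refine ⟨⟨⟨⟨fun t => ⟨fun k => T k (t.1 (m k)), compat t⟩, fun t t' => ?_⟩, fun c t => ?_⟩, ?_⟩,
    fun x y => lim_ext fun k => hT k x y⟩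
  · exact lim_ext fun k => map_add (T k) _ _
  · exact lim_ext fun k => map_smul (T k) _ _
  · exact continuous_of_level fun k => ⟨m k, fun x y h => congrArg (T k) h⟩

/-- The completed tensor product `f ⊗ g` of two continuous linear maps. -/
def tensorMap (f : X.Lim →L[ℂ] X'.Lim) (g : Y.Lim →L[ℂ] Y'.Lim) :
    (X.tensor Y).Lim →L[ℂ] (X'.tensor Y').Lim := (exists_tensorMap f g).choose

@[simp] theorem tensorMap_tmul (f : X.Lim →L[ℂ] X'.Lim) (g : Y.Lim →L[ℂ] Y'.Lim) (x : X.Lim)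
    (y : Y.Lim) : tensorMap f g (x ⊠ y) = f x ⊠ g y := (exists_tensorMap f g).choose_spec x y

/-- A continuous linear map on the completed tensor product that is multiplicative on pure tensors is
multiplicative. -/
theorem map_mul_of_tmul {W : Type*} [TopologicalSpace W] [T2Space W] [Ring W] [IsTopologicalRing W]
    [Algebra ℂ W] (T : (X.tensor Y).Lim →L[ℂ] W)
    (h : ∀ x y x' y', T ((x ⊠ y) * (x' ⊠ y')) = T (x ⊠ y) * T (x' ⊠ y'))
    (t u : (X.tensor Y).Lim) : T (t * u) = T t * T u := by
  refine tensor_ext (f := T.toLinearMap ∘ₗ LinearMap.mulRight ℂ u)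
    (g := LinearMap.mulRight ℂ (T u) ∘ₗ T.toLinearMap)
    (T.continuous.comp (continuous_id.mul continuous_const))
    (T.continuous.mul continuous_const) (fun x y => ?_) t
  exact tensor_ext (f := T.toLinearMap ∘ₗ LinearMap.mulLeft ℂ (x ⊠ y))
    (g := LinearMap.mulLeft ℂ (T (x ⊠ y)) ∘ₗ T.toLinearMap)
    (T.continuous.comp (continuous_const.mul continuous_id))
    (continuous_const.mul T.continuous) (fun x' y' => h _ _ _ _) u

/-- A continuous linear map on the completed tensor product that is multiplicative on pure tensors, as
an algebra homomorphism. -/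
def algHomOfTmul {W : Type*} [TopologicalSpace W] [T2Space W] [Ring W] [IsTopologicalRing W]
    [Algebra ℂ W] (T : (X.tensor Y).Lim →L[ℂ] W) (h1 : T (1 ⊠ 1) = 1)
    (h : ∀ x y x' y', T ((x ⊠ y) * (x' ⊠ y')) = T (x ⊠ y) * T (x' ⊠ y')) :
    (X.tensor Y).Lim →A[ℂ] W where
  toAlgHom := AlgHom.ofLinearMap T.toLinearMap h1 (map_mul_of_tmul T h)
  cont := T.continuous

/-- The completed tensor product of two continuous algebra homomorphisms. -/
def tensorAlgMap (f : X.Lim →A[ℂ] X'.Lim) (g : Y.Lim →A[ℂ] Y'.Lim) :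
    (X.tensor Y).Lim →A[ℂ] (X'.tensor Y').Lim :=
  algHomOfTmul (tensorMap f.toContinuousLinearMap g.toContinuousLinearMap)
    (by rw [tensorMap_tmul]; simp [one_tmul_one])
    (fun x y x' y' => by simp [tmul_mul_tmul])

@[simp] theorem tensorAlgMap_tmul (f : X.Lim →A[ℂ] X'.Lim) (g : Y.Lim →A[ℂ] Y'.Lim) (x : X.Lim)
    (y : Y.Lim) : tensorAlgMap f g (x ⊠ y) = f x ⊠ g y := tensorMap_tmul _ _ x y

/-- The multiplication `a ⊗ b ↦ a b` at level `k`. -/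
def levelMul (X : ProAlg) (k : ℕ) : (X.tensor X).obj k →ₗ[ℂ] X.obj k := LinearMap.mul' ℂ (X.obj k)

theorem map_levelMul (X : ProAlg) (k : ℕ) (u : (X.tensor X).obj (k + 1)) :
    X.map k (X.levelMul (k + 1) u) = X.levelMul k ((X.tensor X).map k u) := by
  refine LinearMap.congr_fun (f := (X.map k).toLinearMap ∘ₗ X.levelMul (k + 1))
    (g := X.levelMul k ∘ₗ ((X.tensor X).map k).toLinearMap) (TensorProduct.ext' fun x y => ?_) u
  exact map_mul (X.map k) x y

/-- The multiplication `a ⊗ b ↦ a b`, as a continuous linear map on the completed tensor square. -/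
def mulMap (X : ProAlg) : (X.tensor X).Lim →L[ℂ] X.Lim where
  toFun t := ⟨fun k => X.levelMul k (t.1 k), fun k => by rw [map_levelMul, t.2 k]⟩
  map_add' _ _ := lim_ext fun k => map_add (X.levelMul k) _ _
  map_smul' _ _ := lim_ext fun k => map_smul (X.levelMul k) _ _
  cont := continuous_of_level fun k => ⟨k, fun _ _ h => congrArg (X.levelMul k) h⟩

@[simp] theorem mulMap_tmul (x y : X.Lim) : mulMap X (x ⊠ y) = x * y := lim_ext fun _ => rfl

end ProAlg

namespace H4

open Filter Topology ProAlg

variable {X Y : ProAlg}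

/-! ### Power series in topologically nilpotent elements -/

/-- Topologically nilpotent elements: those whose image at every level is nilpotent. -/
def TopNilp (x : X.Lim) : Prop := ∀ k, IsNilpotent (x.1 k)

theorem topNilp_iff {x : X.Lim} : TopNilp x ↔ Tendsto (fun n => x ^ n) atTop (𝓝 0) := by
  rw [tendsto_iff]
  refine forall_congr' fun k => ⟨fun ⟨m, hm⟩ => ?_, fun h => ?_⟩
  · filter_upwards [eventually_ge_atTop m] with n hn
    rw [level_pow, pow_eq_zero_of_le hn hm, level_zero]
  · obtain ⟨n, hn⟩ := h.exists
    exact ⟨n, by rwa [level_pow, level_zero] at hn⟩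

theorem TopNilp.map {x : X.Lim} (hx : TopNilp x) (f : X.Lim →A[ℂ] Y.Lim) : TopNilp (f x) := by
  rw [topNilp_iff] at hx ⊢
  simpa [Function.comp_def] using (f.cont.tendsto 0).comp hx

theorem TopNilp.smul {x : X.Lim} (hx : TopNilp x) (c : ℂ) : TopNilp (c • x) :=
  fun k => (hx k).smul c

theorem TopNilp.neg {x : X.Lim} (hx : TopNilp x) : TopNilp (-x) := fun k => (hx k).neg

theorem Commute.level {x y : X.Lim} (h : Commute x y) (k : ℕ) : Commute (x.1 k) (y.1 k) :=
  Commute.map h (X.level k)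

theorem TopNilp.add {x y : X.Lim} (hx : TopNilp x) (hy : TopNilp y) (h : Commute x y) :
    TopNilp (x + y) := fun k => Commute.isNilpotent_add (Commute.level h k) (hx k) (hy k)

theorem TopNilp.mul_right {x y : X.Lim} (hx : TopNilp x) (h : Commute x y) :
    TopNilp (x * y) := fun k => Commute.isNilpotent_mul_right (Commute.level h k) (hx k)

theorem TopNilp.mul_left {x y : X.Lim} (hy : TopNilp y) (h : Commute x y) :
    TopNilp (x * y) := fun k => Commute.isNilpotent_mul_left (Commute.level h k) (hy k)

theorem TopNilp.tmul_left {x : X.Lim} (hx : TopNilp x) (y : Y.Lim) : TopNilp (x ⊠ y) := fun k => by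
  obtain ⟨m, hm⟩ := hx k
  refine ⟨m, ?_⟩
  change (x.1 k ⊗ₜ[ℂ] y.1 k) ^ m = 0
  rw [Algebra.TensorProduct.tmul_pow, hm, TensorProduct.zero_tmul]

theorem TopNilp.tmul_right (x : X.Lim) {y : Y.Lim} (hy : TopNilp y) : TopNilp (x ⊠ y) := fun k => by
  obtain ⟨m, hm⟩ := hy k
  refine ⟨m, ?_⟩
  change (x.1 k ⊗ₜ[ℂ] y.1 k) ^ m = 0
  rw [Algebra.TensorProduct.tmul_pow, hm, TensorProduct.tmul_zero]

theorem TopNilp.of_semiconj {x x' y : X.Lim} (hx : TopNilp x) (hy : IsUnit y)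
    (h : SemiconjBy y x x') : TopNilp x' := fun k => by
  obtain ⟨m, hm⟩ := hx k
  refine ⟨m, ?_⟩
  have h1 : y.1 k * (x.1 k) ^ m = (x'.1 k) ^ m * y.1 k :=
    ((SemiconjBy.map h (X.level k)).pow_right m)
  rw [hm, mul_zero] at h1
  exact (hy.map (X.level k)).mul_left_eq_zero.1 h1.symm

theorem hasSum_of_level {f : ℕ → X.Lim} {s : X.Lim}
    (h : ∀ k, ∃ m, (∀ n, m ≤ n → (f n).1 k = 0) ∧ s.1 k = ∑ n ∈ Finset.range m, (f n).1 k) :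
    HasSum f s := by
  refine tendsto_iff.2 fun k => ?_
  obtain ⟨m, h0, hs⟩ := h k
  simp only [SummationFilter.unconditional_filter]
  filter_upwards [eventually_ge_atTop (Finset.range m)] with t ht
  rw [level_sum, hs]
  refine (Finset.sum_subset ht fun n _ hn => h0 n (by simpa using hn)).symm

/-- A power series in a topologically nilpotent element converges, to the element whose components are
the partial sums up to any vanishing power. -/
theorem exists_hasSum (c : ℕ → ℂ) {x : X.Lim} (hx : TopNilp x) :
    ∃ s : X.Lim, HasSum (fun n => c n • x ^ n) s ∧
      ∀ k m, (x.1 k) ^ m = 0 → s.1 k = ∑ n ∈ Finset.range m, c n • (x.1 k) ^ n := by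
  choose M hM using hx
  have ind : ∀ k m m', (x.1 k) ^ m = 0 → (x.1 k) ^ m' = 0 →
      ∑ n ∈ Finset.range m, c n • (x.1 k) ^ n = ∑ n ∈ Finset.range m', c n • (x.1 k) ^ n := by
    intro k m m' hm hm'
    wlog hle : m ≤ m' generalizing m m'
    · exact (this m' m hm' hm (by omega)).symm
    refine Finset.sum_subset (Finset.range_mono hle) fun n _ hn => ?_
    rw [pow_eq_zero_of_le (by simpa using hn) hm, smul_zero]
  have compat : ∀ k, X.map k (∑ n ∈ Finset.range (M (k + 1)), c n • (x.1 (k + 1)) ^ n) =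
      ∑ n ∈ Finset.range (M k), c n • (x.1 k) ^ n := fun k => by
    simp only [map_sum, map_smul, map_pow, x.2 k]
    refine ind k _ _ ?_ (hM k)
    rw [← x.2 k, ← map_pow, hM, map_zero]
  refine ⟨⟨fun k => ∑ n ∈ Finset.range (M k), c n • (x.1 k) ^ n, compat⟩,
    hasSum_of_level fun k => ⟨M k, fun n hn => ?_, ?_⟩, fun k m hm => ind k _ _ (hM k) hm⟩
  · rw [level_smul, level_pow, pow_eq_zero_of_le hn (hM k), smul_zero]
  · simp

theorem hasSum_series (c : ℕ → ℂ) {x : X.Lim} (hx : TopNilp x) :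
    HasSum (fun n => c n • x ^ n) (series c x) := by
  obtain ⟨s, hs, -⟩ := exists_hasSum c hx
  exact hs.summable.hasSum

theorem TopNilp.converges (c : ℕ → ℂ) {x : X.Lim} (hx : TopNilp x) : Converges c x :=
  (hasSum_series c hx).summable

theorem series_level (c : ℕ → ℂ) {x : X.Lim} (hx : TopNilp x) {k m : ℕ} (hm : (x.1 k) ^ m = 0) :
    (series c x).1 k = ∑ n ∈ Finset.range m, c n • (x.1 k) ^ n := by
  obtain ⟨s, hs, hs'⟩ := exists_hasSum c hx
  rw [series, hs.tsum_eq, hs' k m hm]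

theorem map_series (f : X.Lim →A[ℂ] Y.Lim) (c : ℕ → ℂ) {x : X.Lim} (hx : TopNilp x) :
    f (series c x) = series c (f x) := by
  refine (HasSum.unique (hasSum_series c (hx.map f)) ?_).symm
  simpa [Function.comp_def] using (hasSum_series c hx).map f f.cont

theorem map_expo (f : X.Lim →A[ℂ] Y.Lim) {x : X.Lim} (hx : TopNilp x) :
    f (expo x) = expo (f x) := map_series f _ hx

theorem series_congr_of_coeff {c d : ℕ → ℂ} {x y : X.Lim}
    (h : ∀ n, c n • x ^ n = d n • y ^ n) : series c x = series d y :=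
  tsum_congr h

theorem series_semiconj (c : ℕ → ℂ) {x x' y : X.Lim} (hx : TopNilp x) (hx' : TopNilp x')
    (h : SemiconjBy y x x') : SemiconjBy y (series c x) (series c x') := lim_ext fun k => by
  obtain ⟨m, hm⟩ := hx k
  obtain ⟨m', hm'⟩ := hx' k
  have e := pow_eq_zero_of_le (le_max_left m m') hm
  have e' := pow_eq_zero_of_le (le_max_right m m') hm'
  have hk : SemiconjBy (y.1 k) (x.1 k) (x'.1 k) := SemiconjBy.map h (X.level k)
  rw [level_mul, level_mul, series_level c hx e, series_level c hx' e', Finset.mul_sum,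
    Finset.sum_mul]
  refine Finset.sum_congr rfl fun n _ => ?_
  rw [mul_smul_comm, smul_mul_assoc, (hk.pow_right n).eq]

theorem series_commute (c : ℕ → ℂ) {x y : X.Lim} (hx : TopNilp x) (h : Commute y x) :
    Commute y (series c x) := series_semiconj c hx hx h

theorem expo_commute {x y : X.Lim} (hx : TopNilp x) (h : Commute y x) : Commute y (expo x) :=
  series_commute _ hx h

theorem expo_semiconj {x x' y : X.Lim} (hx : TopNilp x) (hx' : TopNilp x')
    (h : SemiconjBy y x x') : SemiconjBy y (expo x) (expo x') := series_semiconj _ hx hx' h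

theorem mul_pow_sub_pow_mul {B : Type*} [Ring B] {x y z : B} (hxz : Commute x z)
    (h : y * x - x * y = z) (n : ℕ) :
    y * x ^ (n + 1) - x ^ (n + 1) * y = (n + 1 : ℕ) • (x ^ n * z) := by
  induction n with
  | zero => simp [h]
  | succ n ih =>
    have h' : y * x = z + x * y := by rw [← h]; abel
    calc y * x ^ (n + 1 + 1) - x ^ (n + 1 + 1) * y
        = (y * x ^ (n + 1) - x ^ (n + 1) * y) * x + x ^ (n + 1) * (y * x - x * y) := by
          noncomm_ring
      _ = (n + 1 + 1 : ℕ) • (x ^ (n + 1) * z) := by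
          rw [ih, h, smul_mul_assoc, mul_assoc, ← hxz.eq, ← mul_assoc, ← pow_succ, ← succ_nsmul]

/-- If `[y, x] = z` commutes with `x`, then `[y, f(x)] = f'(x) z`. -/
theorem commutator_series (c : ℕ → ℂ) {x y z : X.Lim} (hx : TopNilp x) (hxz : Commute x z)
    (h : y * x - x * y = z) :
    y * series c x - series c x * y = series (fun n => (n + 1) * c (n + 1)) x * z :=
  lim_ext fun k => by
  obtain ⟨m, hm⟩ := hx k
  have e : (x.1 k) ^ (m + 1) = 0 := pow_eq_zero_of_le (Nat.le_succ m) hm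
  have hk : y.1 k * x.1 k - x.1 k * y.1 k = z.1 k := by rw [← h]; rfl
  rw [level_sub, level_mul, level_mul, level_mul, series_level c hx e, series_level _ hx hm,
    Finset.mul_sum, Finset.sum_mul, Finset.sum_mul, ← Finset.sum_sub_distrib,
    Finset.sum_range_succ']
  simp only [pow_zero, mul_smul_comm, smul_mul_assoc, mul_one, one_mul, sub_self, add_zero]
  refine Finset.sum_congr rfl fun n _ => ?_
  rw [← smul_sub, mul_pow_sub_pow_mul (Commute.level hxz k) hk, ← Nat.cast_smul_eq_nsmul ℂ,
    smul_smul, mul_comm]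
  push_cast
  rfl

/-! ### The exponential -/

theorem expo_zero : expo (0 : X.Lim) = 1 := by
  rw [expo, series, tsum_eq_single 0 fun n hn => by rw [zero_pow hn, smul_zero]]
  simp [expCoeff]

theorem expo_add {x y : X.Lim} (hx : TopNilp x) (hy : TopNilp y) (h : Commute x y) :
    expo (x + y) = expo x * expo y := lim_ext fun k => by
  let _ : Module ℚ (X.obj k) := Module.compHom (X.obj k) (algebraMap ℚ ℂ)
  have hexp : ∀ z : X.Lim, TopNilp z → (expo z).1 k = IsNilpotent.exp (z.1 k) := fun z hz => by
    obtain ⟨m, hm⟩ := hz k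
    rw [expo, series_level _ hz hm, IsNilpotent.exp_eq_sum hm]
    refine Finset.sum_congr rfl fun n _ => ?_
    change _ = (algebraMap ℚ ℂ (n.factorial : ℚ)⁻¹) • (z.1 k) ^ n
    simp [expCoeff]
  rw [level_mul, hexp _ (hx.add hy h), hexp x hx, hexp y hy, level_add,
    IsNilpotent.exp_add_of_commute (Commute.level h k) (hx k) (hy k)]

theorem expo_neg_mul {x : X.Lim} (hx : TopNilp x) : expo (-x) * expo x = 1 := by
  rw [← expo_add hx.neg hx (Commute.refl x).neg_left, neg_add_cancel, expo_zero]

theorem expo_mul_neg {x : X.Lim} (hx : TopNilp x) : expo x * expo (-x) = 1 := by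
  rw [← expo_add hx hx.neg (Commute.refl x).neg_right, add_neg_cancel, expo_zero]

theorem isUnit_expo {x : X.Lim} (hx : TopNilp x) : IsUnit (expo x) :=
  ⟨⟨_, _, expo_mul_neg hx, expo_neg_mul hx⟩, rfl⟩

theorem commutator_expo {x y z : X.Lim} (hx : TopNilp x) (hxz : Commute x z)
    (h : y * x - x * y = z) : y * expo x - expo x * y = expo x * z := by
  rw [expo, commutator_series _ hx hxz h]
  congr 2
  funext n
  rw [expCoeff, expCoeff, Nat.factorial_succ]
  push_cast
  field_simp

theorem commutator_expm1 (c : ℂ) {x y z : X.Lim} (hx : TopNilp x) (hxz : Commute x z)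
    (h : y * x - x * y = z) :
    y * series (expm1Coeff c) x - series (expm1Coeff c) x * y = expo (c • x) * z := by
  rw [commutator_series _ hx hxz h]
  congr 1
  refine series_congr_of_coeff fun n => ?_
  rw [expm1Coeff, expCoeff, Nat.factorial_succ, smul_pow, smul_smul, if_neg n.succ_ne_zero,
    Nat.add_sub_cancel]
  congr 1
  push_cast
  field_simp

/-- `exp x` conjugates `y` to `exp(c) y` when `[x, y] = c y` with `c` commuting with `x` and `y`. -/
theorem expo_mul_eq_of_eigen {x y c : X.Lim} (hx : TopNilp x) (hc : TopNilp c) (hxc : Commute x c)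
    (hyc : Commute y c) (h : x * y - y * x = c * y) :
    expo x * y = expo c * y * expo x := by
  have hs : SemiconjBy y (x + c) x := by
    rw [SemiconjBy, mul_add, hyc.eq, ← h]; abel
  have := (expo_semiconj (hx.add hc hxc) hx hs).eq
  rw [← this, add_comm, expo_add hc hx hxc.symm, ← mul_assoc, (expo_commute hc hyc).eq]

/-- `exp x` conjugates `y` to `y + z` when `[x, y] = z` commutes with `x`. -/
theorem expo_mul_eq_of_commutator {x y z : X.Lim} (hx : TopNilp x) (hxz : Commute x z)
    (h : x * y - y * x = z) : expo x * y = (y + z) * expo x := by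
  have h1 := commutator_expo (y := y) (z := -z) hx hxz.neg_right (by rw [← h]; abel)
  rw [add_mul, (expo_commute hx hxz.symm).eq]
  rw [mul_neg, sub_eq_iff_eq_add] at h1
  rw [h1]
  abel

/-! ### The series `(exp (c x) - 1) / c` and `sinh (h x) / h` -/

theorem TopNilp.series {c : ℕ → ℂ} (hc : c 0 = 0) {x : X.Lim} (hx : TopNilp x) :
    TopNilp (H4.series c x) := fun k => by
  obtain ⟨m, hm⟩ := hx k
  rw [series_level c hx hm]
  refine Commute.isNilpotent_sum (fun n _ => ?_) fun i j _ _ =>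
    (((Commute.refl (x.1 k)).pow_pow i j).smul_left _).smul_right _
  rcases Nat.eq_zero_or_pos n with rfl | hn
  · rw [hc, zero_smul]; exact IsNilpotent.zero
  · exact ((hx k).pow_of_pos hn.ne').smul _

theorem smul_series (a : ℂ) (c : ℕ → ℂ) {x : X.Lim} (hx : TopNilp x) :
    a • series c x = series (fun n => a * c n) x := by
  refine HasSum.unique ?_ (hasSum_series _ hx)
  simpa only [smul_smul] using (hasSum_series c hx).const_smul a

theorem series_sub (c d : ℕ → ℂ) {x : X.Lim} (hx : TopNilp x) :
    series c x - series d x = series (fun n => c n - d n) x := by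
  refine HasSum.unique ?_ (hasSum_series _ hx)
  simpa only [sub_smul] using (hasSum_series c hx).sub (hasSum_series d hx)

theorem expo_smul (a : ℂ) (x : X.Lim) : expo (a • x) = series (fun n => a ^ n * expCoeff n) x :=
  series_congr_of_coeff fun n => by rw [smul_pow, smul_smul, mul_comm]

theorem series_expm1_zero (x : X.Lim) : series (expm1Coeff 0) x = x := by
  rw [series, tsum_eq_single 1 fun n hn => ?_]
  · simp [expm1Coeff]
  · rcases Nat.eq_zero_or_pos n with rfl | h
    · simp [expm1Coeff]
    · simp [expm1Coeff, zero_pow (show n - 1 ≠ 0 by omega)]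

theorem series_sinh_zero (x : X.Lim) : series (sinhCoeff 0) x = x := by
  rw [series, tsum_eq_single 1 fun n hn => ?_]
  · simp [sinhCoeff]
  · rcases Nat.eq_zero_or_pos n with rfl | h
    · simp [sinhCoeff]
    · simp [sinhCoeff, zero_pow (show n - 1 ≠ 0 by omega)]

theorem smul_series_expm1 (c : ℂ) {x : X.Lim} (hx : TopNilp x) :
    c • series (expm1Coeff c) x = expo (c • x) - 1 := by
  have h1 : (1 : X.Lim) = series (fun n => if n = 0 then 1 else 0) x := by
    rw [series, tsum_eq_single 0 fun n hn => by simp [hn]]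
    simp
  rw [expo_smul, h1, series_sub _ _ hx, smul_series _ _ hx]
  congr 1
  funext n
  rcases Nat.eq_zero_or_pos n with rfl | h
  · simp [expm1Coeff, expCoeff]
  · obtain ⟨n, rfl⟩ := Nat.exists_eq_succ_of_ne_zero h.ne'
    simp [expm1Coeff, expCoeff, pow_succ]
    ring

theorem smul_series_sinh (h : ℂ) {x : X.Lim} (hx : TopNilp x) :
    (2 * h) • series (sinhCoeff h) x = expo (h • x) - expo (-h • x) := by
  rw [expo_smul, expo_smul, series_sub _ _ hx, smul_series _ _ hx]
  congr 1
  funext n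
  rcases Nat.even_or_odd n with hn | hn
  · simp [sinhCoeff, Nat.not_odd_iff_even.2 hn, hn.neg_pow]
  · obtain ⟨m, rfl⟩ := hn
    have : Odd (2 * m + 1) := ⟨m, rfl⟩
    simp [sinhCoeff, expCoeff, this, this.neg_pow, pow_succ]
    ring

theorem series_expm1_add (c : ℂ) {x y : X.Lim} (hx : TopNilp x) (hy : TopNilp y)
    (h : Commute x y) :
    series (expm1Coeff c) (x + y) =
      series (expm1Coeff c) x * expo (c • y) + series (expm1Coeff c) y := by
  rcases eq_or_ne c 0 with rfl | hc
  · simp [series_expm1_zero, expo_zero]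
  · refine smul_right_injective _ hc ?_
    change c • _ = c • _
    rw [smul_add, ← smul_mul_assoc, smul_series_expm1 c (hx.add hy h), smul_series_expm1 c hx,
      smul_series_expm1 c hy, smul_add, expo_add (hx.smul c) (hy.smul c)
      ((h.smul_left c).smul_right c), sub_mul, one_mul]
    abel

theorem series_sinh_add (h : ℂ) {x y : X.Lim} (hx : TopNilp x) (hy : TopNilp y)
    (hxy : Commute x y) :
    series (sinhCoeff h) (x + y) =
      series (sinhCoeff h) x * expo (h • y) + expo (-h • x) * series (sinhCoeff h) y := by
  rcases eq_or_ne h 0 with rfl | hh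
  · simp [series_sinh_zero, expo_zero]
  · have h2 : 2 * h ≠ 0 := mul_ne_zero two_ne_zero hh
    refine smul_right_injective _ h2 ?_
    change (2 * h) • _ = (2 * h) • _
    rw [smul_add, ← smul_mul_assoc, ← mul_smul_comm, smul_series_sinh h (hx.add hy hxy),
      smul_series_sinh h hx, smul_series_sinh h hy, smul_add, smul_add,
      expo_add (hx.smul _) (hy.smul _) ((hxy.smul_left _).smul_right _),
      expo_add (hx.smul _) (hy.smul _) ((hxy.smul_left _).smul_right _)]
    noncomm_ring

theorem series_sinh_neg (h : ℂ) {x : X.Lim} :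
    series (sinhCoeff h) (-x) = -series (sinhCoeff h) x := by
  rw [series, series, ← tsum_neg]
  refine tsum_congr fun n => ?_
  rw [sinhCoeff]
  split_ifs with hn
  · rw [hn.neg_pow, smul_neg]
  · simp

theorem series_expm1_neg (c : ℂ) {x : X.Lim} (hx : TopNilp x) :
    series (expm1Coeff c) (-x) = -(series (expm1Coeff c) x * expo (-c • x)) := by
  have := series_expm1_add c hx hx.neg (Commute.refl x).neg_right
  rw [add_neg_cancel, smul_neg, ← neg_smul] at this
  have h0 : series (expm1Coeff c) (0 : X.Lim) = 0 := by
    rw [series, tsum_eq_single 0 fun n hn => by rw [zero_pow hn, smul_zero]]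
    simp [expm1Coeff]
  rw [h0] at this
  exact eq_neg_of_add_eq_zero_right this.symm

end H4

namespace H4

open Filter Topology ProAlg Gen

variable {X Y : ProAlg}

/-! ### Presentation and universal property of `U_{h,w}(H(4))` -/

/-- The canonical map from the free algebra on the generators, with dense image. -/
def ofFree (h w : ℂ) : FreeAlgebra ℂ Gen →ₐ[ℂ] U h w := FreeAlgebra.lift ℂ (gen h w)

theorem ofFree_level (h w : ℂ) (x : FreeAlgebra ℂ Gen) (k : ℕ) :
    (ofFree h w x).1 k = proj h w k x := by
  have : ((tower h w).level k).comp (ofFree h w) = proj h w k := by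
    refine FreeAlgebra.hom_ext (funext fun g => ?_)
    simp only [Function.comp_apply, AlgHom.comp_apply, ofFree, FreeAlgebra.lift_ι_apply]
    rfl
  exact DFunLike.congr_fun this x

theorem exists_ofFree (h w : ℂ) (x : U h w) (k : ℕ) : ∃ z, (ofFree h w z).1 k = x.1 k := by
  obtain ⟨z, hz⟩ := RingQuot.mkAlgHom_surjective ℂ (Rel h w k) (x.1 k)
  exact ⟨z, by rw [ofFree_level]; exact hz⟩

theorem denseRange_ofFree (h w : ℂ) : DenseRange (ofFree h w) := fun x => by
  refine (mem_closure_iff_nhds_basis (hasBasis_nhds x)).2 fun k _ => ?_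
  obtain ⟨z, hz⟩ := exists_ofFree h w x k
  exact ⟨_, ⟨z, rfl⟩, hz⟩

/-- Continuous maps that agree on a subalgebra containing the generators are equal. -/
theorem eq_of_subalgebra {h w : ℂ} {W : Type*} [TopologicalSpace W] [T2Space W]
    {f g : U h w → W} (hf : Continuous f) (hg : Continuous g) (S : Subalgebra ℂ (U h w))
    (hS : ∀ a, gen h w a ∈ S) (hfg : ∀ x ∈ S, f x = g x) (x : U h w) : f x = g x := by
  refine congr_fun ((denseRange_ofFree h w).equalizer hf hg (funext fun z => hfg _ ?_)) x
  induction z using FreeAlgebra.induction with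
  | grade0 r => rw [AlgHom.commutes]; exact S.algebraMap_mem r
  | grade1 a => rw [ofFree, FreeAlgebra.lift_ι_apply]; exact hS a
  | mul a b ha hb => rw [map_mul]; exact S.mul_mem ha hb
  | add a b ha hb => rw [map_add]; exact S.add_mem ha hb

/-- Continuous algebra homomorphisms out of `U_{h,w}(H(4))` are determined by the generators. -/
theorem algHom_eq {h w : ℂ} {W : Type*} [TopologicalSpace W] [T2Space W] [Ring W] [Algebra ℂ W]
    (f g : U h w →A[ℂ] W) (hfg : ∀ a, f (gen h w a) = g (gen h w a)) (x : U h w) : f x = g x :=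
  eq_of_subalgebra f.cont g.cont (AlgHom.equalizer f.toAlgHom g.toAlgHom) hfg (fun _ hx => hx) x

theorem trunc_map {B C : Type*} [Ring B] [Algebra ℂ B] [Ring C] [Algebra ℂ C] (f : B →ₐ[ℂ] C)
    (k : ℕ) (c : ℕ → ℂ) (x : B) : f (trunc k c x) = trunc k c (f x) := by
  simp [trunc, map_sum, map_smul, map_pow]

theorem trunc_level (c : ℕ → ℂ) {x : X.Lim} (hx : TopNilp x) {k m : ℕ} (hm : (x.1 k) ^ m = 0) :
    trunc m c (x.1 k) = (series c x).1 k := (series_level c hx hm).symm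

/-- Elements of a complete algebra that satisfy the defining relations of `U_{h,w}(H(4))`, such that at
each level the words with sufficiently many letters `E` and `A⁺` vanish. -/
structure IsRep (h w : ℂ) (v : Gen → Y.Lim) : Prop where
  central : ∀ g, Commute (v E) (v g)
  A_Ap : v A * v Ap - v Ap * v A = series (sinhCoeff h) (v E) * expo (w • v Ap)
  N_Ap : v N * v Ap - v Ap * v N = series (expm1Coeff w) (v Ap)
  N_A : v N * v A - v A * v N = -v A
  word : ∀ k, ∃ m, ∀ l : List Gen, m ≤ weight l → ((l.map v).prod).1 k = 0

theorem IsRep.topNilp_E {h w : ℂ} {v : Gen → Y.Lim} (hv : IsRep h w v) : TopNilp (v E) :=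
  fun k => by
  obtain ⟨m, hm⟩ := hv.word k
  exact ⟨m, by simpa using hm (List.replicate m E) (by simp [weight])⟩

theorem IsRep.topNilp_Ap {h w : ℂ} {v : Gen → Y.Lim} (hv : IsRep h w v) : TopNilp (v Ap) :=
  fun k => by
  obtain ⟨m, hm⟩ := hv.word k
  exact ⟨m, by simpa using hm (List.replicate m Ap) (by simp [weight])⟩

theorem topNilp_E (h w : ℂ) : TopNilp (gen h w E) := fun k =>
  ⟨k, (map_pow (proj h w k) _ _).symm.trans (proj_E_pow h w k)⟩

theorem topNilp_Ap (h w : ℂ) : TopNilp (gen h w Ap) := fun k =>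
  ⟨k, (map_pow (proj h w k) _ _).symm.trans (proj_Ap_pow h w k)⟩

/-- The generators of `U_{h,w}(H(4))` satisfy the defining relations, with complete power series. -/
theorem isRep_gen (h w : ℂ) : IsRep h w (gen h w) where
  central g := lim_ext fun k => by
    have := RingQuot.mkAlgHom_rel ℂ (Rel.central (h := h) (w := w) (k := k) g)
    rw [map_mul, map_mul] at this
    exact this
  A_Ap := lim_ext fun k => by
    have := RingQuot.mkAlgHom_rel ℂ (Rel.A_Ap (h := h) (w := w) (k := k))
    rw [map_sub, map_mul, map_mul, map_mul, trunc_map, trunc_map, map_smul] at this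
    refine this.trans ?_
    have e1 : ((gen h w E).1 k) ^ k = 0 := (map_pow (proj h w k) _ _).symm.trans (proj_E_pow h w k)
    have e2 : ((gen h w Ap).1 k) ^ k = 0 := (map_pow (proj h w k) _ _).symm.trans (proj_Ap_pow h w k)
    rw [level_mul, expo, ← trunc_level _ (topNilp_E h w) e1,
      ← trunc_level _ ((topNilp_Ap h w).smul w) (m := k)
        (by rw [level_smul, smul_pow, e2, smul_zero])]
    rfl
  N_Ap := lim_ext fun k => by
    have := RingQuot.mkAlgHom_rel ℂ (Rel.N_Ap (h := h) (w := w) (k := k))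
    rw [map_sub, map_mul, map_mul, trunc_map] at this
    refine this.trans ?_
    have e2 : ((gen h w Ap).1 k) ^ k = 0 := (map_pow (proj h w k) _ _).symm.trans (proj_Ap_pow h w k)
    rw [← trunc_level _ (topNilp_Ap h w) e2]
    rfl
  N_A := lim_ext fun k => by
    have := RingQuot.mkAlgHom_rel ℂ (Rel.N_A (h := h) (w := w) (k := k))
    rw [map_sub, map_mul, map_mul, map_neg] at this
    exact this
  word k := ⟨k, fun l hl => by
    have e : (l.map (gen h w)).prod = ofFree h w (l.map (FreeAlgebra.ι ℂ)).prod := by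
      rw [map_list_prod, List.map_map]
      congr 2
      funext g
      rw [Function.comp_apply, ofFree, FreeAlgebra.lift_ι_apply]
    rw [e, ofFree_level, proj_word h w k l hl]; rfl⟩

theorem IsRep.exists_levelHom {h w : ℂ} {v : Gen → Y.Lim} (hv : IsRep h w v) (k : ℕ) :
    ∃ m, ∃ f : Level h w m →ₐ[ℂ] Y.obj k, ∀ z,
      f (proj h w m z) = (FreeAlgebra.lift ℂ v z).1 k := by
  obtain ⟨m, hm⟩ := hv.word k
  let F : FreeAlgebra ℂ Gen →ₐ[ℂ] Y.obj k := (Y.level k).comp (FreeAlgebra.lift ℂ v)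
  have hF : ∀ g, F (.ι ℂ g) = (v g).1 k := fun g => by
    simp only [F, AlgHom.comp_apply, FreeAlgebra.lift_ι_apply, level_apply]
  have hE : ((v E).1 k) ^ m = 0 := by
    simpa using hm (List.replicate m E) (by simp [weight])
  have hAp : ((v Ap).1 k) ^ m = 0 := by
    simpa using hm (List.replicate m Ap) (by simp [weight])
  have hrel : ∀ ⦃x y⦄, Rel h w m x y → F x = F y := fun x y hxy => by
    cases hxy with
    | central g =>
      rw [map_mul, map_mul, hF, hF]
      exact (Commute.level (hv.central g) k).eq
    | A_Ap =>
      rw [map_sub, map_mul, map_mul, map_mul, trunc_map, trunc_map, map_smul, hF, hF, hF,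
        trunc_level _ hv.topNilp_E hE, ← level_smul, trunc_level _ (hv.topNilp_Ap.smul w)
        (by rw [level_smul, smul_pow, hAp, smul_zero])]
      exact congrArg (Y.level k) hv.A_Ap
    | N_Ap =>
      rw [map_sub, map_mul, map_mul, trunc_map, hF, hF, trunc_level _ hv.topNilp_Ap hAp]
      exact congrArg (Y.level k) hv.N_Ap
    | N_A =>
      rw [map_sub, map_mul, map_mul, map_neg, hF, hF]
      exact congrArg (Y.level k) hv.N_A
    | word l hl =>
      rw [map_list_prod, List.map_map, map_zero, ← hm l hl]
      refine Eq.trans ?_ (map_list_prod (Y.level k) _).symm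
      rw [List.map_map]
      congr 2
      funext g
      exact hF g
  exact ⟨m, RingQuot.liftAlgHom ℂ ⟨F, hrel⟩, fun z => RingQuot.liftAlgHom_mkAlgHom_apply ℂ _ _ _⟩

/-- Universal property of `U_{h,w}(H(4))`. -/
theorem IsRep.exists_lift {h w : ℂ} {v : Gen → Y.Lim} (hv : IsRep h w v) :
    ∃ f : U h w →A[ℂ] Y.Lim, ∀ g, f (gen h w g) = v g := by
  choose m f hf using hv.exists_levelHom
  have hf' : ∀ k z, f k ((ofFree h w z).1 (m k)) = (FreeAlgebra.lift ℂ v z).1 k := fun k z => by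
    rw [ofFree_level, hf]
  have compat : ∀ (x : U h w) k, Y.map k (f (k + 1) (x.1 (m (k + 1)))) = f k (x.1 (m k)) := by
    intro x k
    obtain ⟨z, hz⟩ := exists_ofFree h w x (max (m k) (m (k + 1)))
    rw [← level_eq_of_le (le_max_left _ _) hz, ← level_eq_of_le (le_max_right _ _) hz, hf', hf']
    exact (FreeAlgebra.lift ℂ v z).2 k
  refine ⟨⟨⟨⟨⟨⟨fun x => ⟨fun k => f k (x.1 (m k)), compat x⟩, ?_⟩, fun x y => ?_⟩, ?_,
    fun x y => ?_⟩, fun r => ?_⟩, ?_⟩, fun g => lim_ext fun k => ?_⟩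
  · exact lim_ext fun k => map_one (f k)
  · exact lim_ext fun k => map_mul (f k) _ _
  · exact lim_ext fun k => map_zero (f k)
  · exact lim_ext fun k => map_add (f k) _ _
  · exact lim_ext fun k => (f k).commutes r
  · exact continuous_of_level fun k => ⟨m k, fun x y h => congrArg (f k) h⟩
  · refine (hf k (.ι ℂ g)).trans ?_
    rw [FreeAlgebra.lift_ι_apply]

/-- The algebra homomorphism out of `U_{h,w}(H(4))` with given values on the generators. -/
def IsRep.lift {h w : ℂ} {v : Gen → Y.Lim} (hv : IsRep h w v) : U h w →A[ℂ] Y.Lim :=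
  hv.exists_lift.choose

theorem IsRep.lift_gen {h w : ℂ} {v : Gen → Y.Lim} (hv : IsRep h w v) (g : Gen) :
    hv.lift (gen h w g) = v g := hv.exists_lift.choose_spec g

end H4

namespace ProAlg

variable {X Y : ProAlg}

/-- `a ↦ a ⊗ 1`. -/
def inl (X Y : ProAlg) : X.Lim →A[ℂ] (X.tensor Y).Lim where
  toAlgHom := AlgHom.ofLinearMap
    { toFun := fun x => x ⊠ 1
      map_add' := fun x y => add_tmul x y 1
      map_smul' := fun c x => smul_tmul c x 1 }
    one_tmul_one (fun x y => by
      change (x * y) ⊠ 1 = (x ⊠ 1) * (y ⊠ 1)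
      rw [tmul_mul_tmul, one_mul])
  cont := continuous_of_level fun k => ⟨k, fun x y h => congrArg (· ⊗ₜ[ℂ] (1 : Y.obj k)) h⟩

/-- `b ↦ 1 ⊗ b`. -/
def inr (X Y : ProAlg) : Y.Lim →A[ℂ] (X.tensor Y).Lim where
  toAlgHom := AlgHom.ofLinearMap
    { toFun := fun y => 1 ⊠ y
      map_add' := fun x y => tmul_add 1 x y
      map_smul' := fun c y => tmul_smul c 1 y }
    one_tmul_one (fun x y => by
      change 1 ⊠ (x * y) = (1 ⊠ x) * (1 ⊠ y)
      rw [tmul_mul_tmul, one_mul])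
  cont := continuous_of_level fun k => ⟨k, fun x y h => congrArg ((1 : X.obj k) ⊗ₜ[ℂ] ·) h⟩

theorem inl_apply (x : X.Lim) : inl X Y x = x ⊠ 1 := rfl
theorem inr_apply (y : Y.Lim) : inr X Y y = 1 ⊠ y := rfl

theorem commute_inl_inr (x : X.Lim) (y : Y.Lim) : Commute (inl X Y x) (inr X Y y) := by
  rw [Commute, SemiconjBy, inl_apply, inr_apply, tmul_mul_tmul, tmul_mul_tmul]
  simp

end ProAlg

namespace H4

open Filter Topology ProAlg Gen

variable {X Y : ProAlg} (h w : ℂ)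

/-! ### Commutation relations in `U_{h,w}(H(4))` -/

/-- `(exp (w A⁺) - 1) / w`. -/
def apHat : U h w := series (expm1Coeff w) (gen h w Ap)

theorem commute_E (x : U h w) : Commute (gen h w E) x :=
  eq_of_subalgebra (f := fun x => gen h w E * x) (g := fun x => x * gen h w E)
    (continuous_const.mul continuous_id) (continuous_id.mul continuous_const)
    (Subalgebra.centralizer ℂ {gen h w E})
    (fun a => by
      rw [Subalgebra.mem_centralizer_iff]
      rintro _ rfl
      exact (isRep_gen h w).central a)
    (fun y hy => Subalgebra.mem_centralizer_iff ℂ |>.1 hy _ rfl) x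

theorem commute_expE (c : ℂ) (x : U h w) : Commute (expE h w c) x :=
  (expo_commute ((topNilp_E h w).smul c) ((commute_E h w x).symm.smul_right c)).symm

theorem commute_sinhE (x : U h w) : Commute (sinhE h w) x :=
  (series_commute _ (topNilp_E h w) (commute_E h w x).symm).symm

theorem expE_mul (c d : ℂ) : expE h w c * expE h w d = expE h w (c + d) := by
  rw [expE, expE, expE, add_smul, expo_add ((topNilp_E h w).smul c) ((topNilp_E h w).smul d)
    (((commute_E h w _).smul_left c))]

theorem expE_zero : expE h w 0 = 1 := by rw [expE, zero_smul, expo_zero]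

theorem expAp_mul (c d : ℂ) : expAp h w c * expAp h w d = expAp h w (c + d) := by
  rw [expAp, expAp, expAp, add_smul, expo_add ((topNilp_Ap h w).smul c) ((topNilp_Ap h w).smul d)
    (((Commute.refl _).smul_left c).smul_right d)]

theorem expAp_zero : expAp h w 0 = 1 := by rw [expAp, zero_smul, expo_zero]

theorem expAp_mul_neg (c : ℂ) : expAp h w c * expAp h w (-c) = 1 := by
  rw [expAp_mul, add_neg_cancel, expAp_zero]

theorem expAp_neg_mul (c : ℂ) : expAp h w (-c) * expAp h w c = 1 := by
  rw [expAp_mul, neg_add_cancel, expAp_zero]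

theorem expE_mul_neg (c : ℂ) : expE h w c * expE h w (-c) = 1 := by
  rw [expE_mul, add_neg_cancel, expE_zero]

theorem expE_neg_mul (c : ℂ) : expE h w (-c) * expE h w c = 1 := by
  rw [expE_mul, neg_add_cancel, expE_zero]

theorem commute_Ap_expAp (c : ℂ) : Commute (gen h w Ap) (expAp h w c) :=
  expo_commute ((topNilp_Ap h w).smul c) ((Commute.refl _).smul_right c)

theorem commute_Ap_apHat : Commute (gen h w Ap) (apHat h w) :=
  series_commute _ (topNilp_Ap h w) (Commute.refl _)

theorem commute_apHat_expAp (c : ℂ) : Commute (apHat h w) (expAp h w c) :=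
  expo_commute ((topNilp_Ap h w).smul c) ((commute_Ap_apHat h w).symm.smul_right c)

theorem smul_apHat : w • apHat h w = expAp h w w - 1 := smul_series_expm1 w (topNilp_Ap h w)

theorem smul_apTilde : w • apTilde h w = 1 - expAp h w (-w) := by
  have := smul_series_expm1 (-w) (topNilp_Ap h w)
  rw [neg_smul, neg_eq_iff_eq_neg, neg_sub] at this
  exact this

theorem smul_sinhE : (2 * h) • sinhE h w = expE h w h - expE h w (-h) :=
  smul_series_sinh h (topNilp_E h w)

theorem apTilde_eq : apTilde h w = apHat h w * expAp h w (-w) := by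
  have h1 : series (expm1Coeff w) (-gen h w Ap) = -apTilde h w := by
    rw [apTilde, series, series, ← tsum_neg]
    refine tsum_congr fun n => ?_
    rcases Nat.eq_zero_or_pos n with rfl | hn
    · simp [expm1Coeff]
    · obtain ⟨n, rfl⟩ := Nat.exists_eq_succ_of_ne_zero hn.ne'
      rw [expm1Coeff, expm1Coeff, if_neg n.succ_ne_zero, if_neg n.succ_ne_zero, neg_pow, neg_pow w,
        ← neg_smul, ← neg_one_smul ℂ (1 : U h w), smul_pow, smul_mul_assoc, one_pow, one_mul,
        smul_smul]
      congr 1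
      rw [Nat.succ_sub_one, pow_succ]
      ring
  rw [series_expm1_neg w (topNilp_Ap h w)] at h1
  exact neg_injective h1.symm

theorem commute_Ap_apTilde : Commute (gen h w Ap) (apTilde h w) :=
  series_commute _ (topNilp_Ap h w) (Commute.refl _)

theorem topNilp_apTilde : TopNilp (apTilde h w) := (topNilp_Ap h w).series (by simp [expm1Coeff])

theorem A_mul_Ap : gen h w A * gen h w Ap - gen h w Ap * gen h w A = sinhE h w * expAp h w w :=
  (isRep_gen h w).A_Ap

theorem N_mul_Ap : gen h w N * gen h w Ap - gen h w Ap * gen h w N = apHat h w :=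
  (isRep_gen h w).N_Ap

theorem N_mul_A : gen h w N * gen h w A = gen h w A * gen h w N - gen h w A := by
  rw [sub_eq_add_neg, ← sub_eq_iff_eq_add']
  exact (isRep_gen h w).N_A

theorem N_mul_expAp (c : ℂ) : gen h w N * expAp h w c - expAp h w c * gen h w N =
    expAp h w c * (c • apHat h w) := by
  refine commutator_expo ((topNilp_Ap h w).smul c)
    (((commute_Ap_apHat h w).smul_left c).smul_right c) ?_
  rw [mul_smul_comm, smul_mul_assoc, ← smul_sub, N_mul_Ap]

theorem A_mul_expAp (c : ℂ) : gen h w A * expAp h w c - expAp h w c * gen h w A =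
    expAp h w c * (c • (sinhE h w * expAp h w w)) := by
  refine commutator_expo ((topNilp_Ap h w).smul c) (((Commute.mul_right
    (commute_sinhE h w _).symm (commute_Ap_expAp h w w)).smul_left c).smul_right c) ?_
  rw [mul_smul_comm, smul_mul_assoc, ← smul_sub, A_mul_Ap]

theorem N_mul_expAp_w : gen h w N * expAp h w w =
    expAp h w w * gen h w N + expAp h w w * (expAp h w w - 1) := by
  rw [← sub_eq_iff_eq_add', N_mul_expAp, smul_apHat]

theorem N_mul_expAp_neg : gen h w N * expAp h w (-w) =
    expAp h w (-w) * gen h w N + (expAp h w (-w) - 1) := by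
  rw [← sub_eq_iff_eq_add', N_mul_expAp, neg_smul, smul_apHat, neg_sub, mul_sub, mul_one,
    expAp_neg_mul]

theorem A_mul_expAp_w : gen h w A * expAp h w w =
    expAp h w w * gen h w A + w • (sinhE h w * (expAp h w w * expAp h w w)) := by
  rw [← sub_eq_iff_eq_add', A_mul_expAp, mul_smul_comm, ← mul_assoc, ← (commute_sinhE h w _).eq,
    mul_assoc]

theorem A_mul_expAp_neg : gen h w A * expAp h w (-w) =
    expAp h w (-w) * gen h w A - w • sinhE h w := by
  rw [sub_eq_add_neg, ← sub_eq_iff_eq_add', A_mul_expAp, mul_smul_comm, ← mul_assoc,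
    ← (commute_sinhE h w _).eq, mul_assoc, expAp_neg_mul, mul_one, neg_smul]

theorem N_mul_apTilde : gen h w N * apTilde h w - apTilde h w * gen h w N = apTilde h w := by
  rw [apTilde, commutator_expm1 (-w) (topNilp_Ap h w) (commute_Ap_apHat h w) (N_mul_Ap h w)]
  change expAp h w (-w) * apHat h w = apTilde h w
  rw [apTilde_eq, (commute_apHat_expAp h w _).eq]

theorem A_mul_apTilde : gen h w A * apTilde h w - apTilde h w * gen h w A = sinhE h w := by
  rw [apTilde, commutator_expm1 (-w) (topNilp_Ap h w) (Commute.mul_right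
    (commute_sinhE h w _).symm (commute_Ap_expAp h w w)) (A_mul_Ap h w)]
  change expAp h w (-w) * (sinhE h w * expAp h w w) = sinhE h w
  rw [← mul_assoc, ← (commute_sinhE h w _).eq, mul_assoc, expAp_neg_mul, mul_one]

/-! ### The filtration by the number of letters `E` and `A⁺` -/

/-- The image at level `k` of the `j`-th power of the ideal generated by `E` and `A⁺`, as the span of
the words with at least `j` letters `E` or `A⁺`. -/
def wordSpan (k j : ℕ) : Submodule ℂ (Level h w k) :=
  Submodule.span ℂ {x | ∃ l : List Gen, j ≤ weight l ∧ x = proj h w k (l.map (FreeAlgebra.ι ℂ)).prod}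

theorem weight_append (l l' : List Gen) : weight (l ++ l') = weight l + weight l' := by
  simp only [weight, List.count_append]; omega

variable {h w}

theorem wordSpan_mul {k i j : ℕ} {a b : Level h w k} (ha : a ∈ wordSpan h w k i)
    (hb : b ∈ wordSpan h w k j) : a * b ∈ wordSpan h w k (i + j) := by
  have := Submodule.mul_mem_mul ha hb
  rw [wordSpan, wordSpan, Submodule.span_mul_span] at this
  refine Submodule.span_mono ?_ this
  rintro _ ⟨_, ⟨l, hl, rfl⟩, _, ⟨l', hl', rfl⟩, rfl⟩
  exact ⟨l ++ l', by rw [weight_append]; omega, by simp⟩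

theorem mem_wordSpan_zero {k : ℕ} (a : Level h w k) : a ∈ wordSpan h w k 0 := by
  obtain ⟨z, rfl⟩ := RingQuot.mkAlgHom_surjective ℂ (Rel h w k) a
  change proj h w k z ∈ _
  induction z using FreeAlgebra.induction with
  | grade0 r =>
    rw [Algebra.algebraMap_eq_smul_one, map_smul]
    exact Submodule.smul_mem _ _ (Submodule.subset_span ⟨[], Nat.zero_le _, rfl⟩)
  | grade1 g => exact Submodule.subset_span ⟨[g], Nat.zero_le _, by
      rw [List.map_singleton, List.prod_singleton]⟩
  | mul a b ha hb => rw [map_mul, ← zero_add 0]; exact wordSpan_mul ha hb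
  | add a b ha hb => rw [map_add]; exact add_mem ha hb

theorem wordSpan_eq_zero {k j : ℕ} (hkj : k ≤ j) {a : Level h w k} (ha : a ∈ wordSpan h w k j) :
    a = 0 := by
  suffices wordSpan h w k j ≤ ⊥ from (Submodule.mem_bot ℂ).1 (this ha)
  refine Submodule.span_le.2 ?_
  rintro _ ⟨l, hl, rfl⟩
  exact proj_word h w k l (hkj.trans hl)

theorem gen_mem_wordSpan (k : ℕ) (g : Gen) : (gen h w g).1 k ∈ wordSpan h w k (weight [g]) :=
  Submodule.subset_span ⟨[g], le_rfl, by simp; rfl⟩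

/-- The sum of the `W i ⊗ W j` with `i + j ≥ n`, for the filtration `W` of a level by words. -/
def tensorWordSpan (h w : ℂ) (k n : ℕ) : Submodule ℂ (Level h w k ⊗[ℂ] Level h w k) :=
  Submodule.span ℂ {x | ∃ i j a b, n ≤ i + j ∧ a ∈ wordSpan h w k i ∧ b ∈ wordSpan h w k j ∧
    x = a ⊗ₜ[ℂ] b}

theorem tensorWordSpan_mul {k m n : ℕ} {a b : Level h w k ⊗[ℂ] Level h w k}
    (ha : a ∈ tensorWordSpan h w k m) (hb : b ∈ tensorWordSpan h w k n) :
    a * b ∈ tensorWordSpan h w k (m + n) := by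
  have := Submodule.mul_mem_mul ha hb
  rw [tensorWordSpan, tensorWordSpan, Submodule.span_mul_span] at this
  refine Submodule.span_mono ?_ this
  rintro _ ⟨_, ⟨i, j, a, b, hij, ha, hb, rfl⟩, _, ⟨i', j', a', b', hij', ha', hb', rfl⟩, rfl⟩
  exact ⟨i + i', j + j', _, _, by omega, wordSpan_mul ha ha', wordSpan_mul hb hb',
    Algebra.TensorProduct.tmul_mul_tmul _ _ _ _⟩

theorem tmul_mem_tensorWordSpan {k n i j : ℕ} (hn : n ≤ i + j) {a b : Level h w k}
    (ha : a ∈ wordSpan h w k i) (hb : b ∈ wordSpan h w k j) :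
    a ⊗ₜ[ℂ] b ∈ tensorWordSpan h w k n := Submodule.subset_span ⟨i, j, a, b, hn, ha, hb, rfl⟩

theorem mem_tensorWordSpan_zero {k : ℕ} (a : Level h w k ⊗[ℂ] Level h w k) :
    a ∈ tensorWordSpan h w k 0 := by
  induction a using TensorProduct.induction_on with
  | zero => exact zero_mem _
  | tmul x y =>
    exact tmul_mem_tensorWordSpan (Nat.zero_le (0 + 0)) (mem_wordSpan_zero x) (mem_wordSpan_zero y)
  | add x y hx hy => exact add_mem hx hy

theorem tensorWordSpan_eq_zero {k n : ℕ} (hkn : 2 * k ≤ n) {a : Level h w k ⊗[ℂ] Level h w k}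
    (ha : a ∈ tensorWordSpan h w k n) : a = 0 := by
  suffices tensorWordSpan h w k n ≤ ⊥ from (Submodule.mem_bot ℂ).1 (this ha)
  refine Submodule.span_le.2 ?_
  rintro _ ⟨i, j, a, b, hij, ha, hb, rfl⟩
  rcases le_or_gt k i with hi | hi
  · simp [wordSpan_eq_zero hi ha]
  · simp [wordSpan_eq_zero (show k ≤ j by omega) hb]

theorem prod_mem_of_filtration {B : Type*} [Ring B] [Algebra ℂ B] (G : ℕ → Submodule ℂ B)
    (h1 : 1 ∈ G 0) (hmul : ∀ i j a b, a ∈ G i → b ∈ G j → a * b ∈ G (i + j)) (u : Gen → B)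
    (hu : ∀ g, u g ∈ G (weight [g])) (l : List Gen) : (l.map u).prod ∈ G (weight l) := by
  induction l with
  | nil => simpa [weight] using h1
  | cons g l ih =>
    have : weight (g :: l) = weight [g] + weight l := weight_append [g] l
    rw [this, List.map_cons, List.prod_cons]
    exact hmul _ _ _ _ (hu g) ih

end H4

namespace H4

open Filter Topology ProAlg Gen

variable {X Y : ProAlg}

/-! ### The coproduct -/

theorem commutator_tmul (a c : X.Lim) (b d : Y.Lim) :
    (a ⊠ b) * (c ⊠ d) - (c ⊠ d) * (a ⊠ b) =
      (a * c - c * a) ⊠ (b * d) + (c * a) ⊠ (b * d - d * b) := by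
  rw [tmul_mul_tmul, tmul_mul_tmul, sub_tmul, tmul_sub]; abel

theorem comul_relation_N_A {n a x k k' s : X.Lim} {w : ℂ} (hna : n * a = a * n - a)
    (hnx : n * x = x * n + x * (x - 1)) (hax : a * x = x * a + w • (s * (x * x)))
    (hk : ∀ y, Commute k y) (hk' : ∀ y, Commute k' y) (hs : ∀ y, Commute s y) :
    (n ⊠ x + 1 ⊠ n) * (a ⊠ (k * x) + k' ⊠ a + w • ((k' * n) ⊠ (s * x))) -
      (a ⊠ (k * x) + k' ⊠ a + w • ((k' * n) ⊠ (s * x))) * (n ⊠ x + 1 ⊠ n) =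
      -(a ⊠ (k * x) + k' ⊠ a + w • ((k' * n) ⊠ (s * x))) := by
  have hnx' : n * x - x * n = x * x - x := by rw [hnx]; noncomm_ring
  have e1 := commutator_tmul n a x (k * x)
  rw [hna, sub_sub_cancel_left, ← mul_assoc, ← (hk x).eq, sub_self, tmul_zero, add_zero,
    neg_tmul, mul_assoc] at e1
  have e2 := commutator_tmul n k' x a
  rw [← (hk' n).eq, sub_self, zero_tmul, zero_add, hax, sub_add_cancel_left, tmul_neg, tmul_smul]
    at e2
  have e3 := commutator_tmul n (k' * n) x (s * x)
  rw [← mul_assoc, ← (hk' n).eq, mul_assoc, sub_self, zero_tmul, zero_add, ← mul_assoc x,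
    ← (hs x).eq, sub_self, tmul_zero] at e3
  have e4 := commutator_tmul 1 a n (k * x)
  rw [one_mul, mul_one, sub_self, zero_tmul, zero_add, ← mul_assoc, ← (hk n).eq, mul_assoc,
    mul_assoc, ← mul_sub, hnx', mul_sub, tmul_sub] at e4
  have e5 := commutator_tmul 1 k' n a
  rw [one_mul, mul_one, sub_self, zero_tmul, zero_add, hna, sub_sub_cancel_left, tmul_neg] at e5
  have e6 := commutator_tmul 1 (k' * n) n (s * x)
  rw [one_mul, mul_one, sub_self, zero_tmul, zero_add, ← mul_assoc, ← (hs n).eq, mul_assoc,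
    mul_assoc, ← mul_sub, hnx', mul_sub, tmul_sub] at e6
  have key : ∀ u₁ u₂ v₁ v₂ v₃ : (X.tensor X).Lim,
      (u₁ + u₂) * (v₁ + v₂ + w • v₃) - (v₁ + v₂ + w • v₃) * (u₁ + u₂) =
      (u₁ * v₁ - v₁ * u₁) + (u₁ * v₂ - v₂ * u₁) + w • (u₁ * v₃ - v₃ * u₁) +
      ((u₂ * v₁ - v₁ * u₂) + (u₂ * v₂ - v₂ * u₂) + w • (u₂ * v₃ - v₃ * u₂)) := by
    intro u₁ u₂ v₁ v₂ v₃
    simp only [mul_add, add_mul, mul_smul_comm, smul_mul_assoc, smul_sub, smul_add]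
    abel
  rw [key, e1, e2, e3, e4, e5, e6, smul_zero, smul_sub]
  abel

theorem comul_relation_A_Ap {n a p m x k k' s : X.Lim} {w : ℂ} (hap : a * p - p * a = s * x)
    (hnp : n * p - p * n = m) (hm : w • m = x - 1) (hpx : Commute p x)
    (hk : ∀ y, Commute k y) (hk' : ∀ y, Commute k' y) (hs : ∀ y, Commute s y) :
    (a ⊠ (k * x) + k' ⊠ a + w • ((k' * n) ⊠ (s * x))) * (p ⊠ 1 + 1 ⊠ p) -
      (p ⊠ 1 + 1 ⊠ p) * (a ⊠ (k * x) + k' ⊠ a + w • ((k' * n) ⊠ (s * x))) =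
      (s ⊠ k + k' ⊠ s) * (x ⊠ x) := by
  have e1 := commutator_tmul a p (k * x) 1
  rw [mul_one, one_mul, sub_self, tmul_zero, add_zero, hap] at e1
  have e2 := commutator_tmul a 1 (k * x) p
  rw [mul_one, one_mul, sub_self, zero_tmul, zero_add, (((hk p).symm.mul_right hpx)).eq, sub_self,
    tmul_zero] at e2
  have e3 := commutator_tmul k' p a 1
  rw [mul_one, one_mul, sub_self, tmul_zero, add_zero, (hk' p).eq, sub_self, zero_tmul] at e3
  have e4 := commutator_tmul k' 1 a p
  rw [mul_one, one_mul, sub_self, zero_tmul, zero_add, hap] at e4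
  have e5 := commutator_tmul (k' * n) p (s * x) 1
  rw [mul_one, one_mul, sub_self, tmul_zero, add_zero, ← mul_assoc p, ← (hk' p).eq, mul_assoc,
    mul_assoc, ← mul_sub, hnp] at e5
  have e6 := commutator_tmul (k' * n) 1 (s * x) p
  rw [mul_one, one_mul, sub_self, zero_tmul, zero_add, (((hs p).symm.mul_right hpx)).eq, sub_self,
    tmul_zero] at e6
  have key : ∀ u₁ u₂ v₁ v₂ v₃ : (X.tensor X).Lim,
      (v₁ + v₂ + w • v₃) * (u₁ + u₂) - (u₁ + u₂) * (v₁ + v₂ + w • v₃) =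
      (v₁ * u₁ - u₁ * v₁) + (v₂ * u₁ - u₁ * v₂) + w • (v₃ * u₁ - u₁ * v₃) +
      ((v₁ * u₂ - u₂ * v₁) + (v₂ * u₂ - u₂ * v₂) + w • (v₃ * u₂ - u₂ * v₃)) := by
    intro u₁ u₂ v₁ v₂ v₃
    simp only [mul_add, add_mul, mul_smul_comm, smul_mul_assoc, smul_sub, smul_add]
    abel
  rw [key, e1, e2, e3, e4, e5, e6, smul_zero, ← smul_tmul, ← mul_smul_comm, hm, mul_sub, mul_one,
    sub_tmul, add_mul, tmul_mul_tmul, tmul_mul_tmul]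
  abel

variable (h w : ℂ)

/-- The values of the coproduct on the generators. -/
def comulGen : Gen → U2 h w
  | N => gen h w N ⊠ expAp h w w + 1 ⊠ gen h w N
  | E => gen h w E ⊠ 1 + 1 ⊠ gen h w E
  | Ap => gen h w Ap ⊠ 1 + 1 ⊠ gen h w Ap
  | A => gen h w A ⊠ (expE h w h * expAp h w w) + expE h w (-h) ⊠ gen h w A +
      w • ((expE h w (-h) * gen h w N) ⊠ (sinhE h w * expAp h w w))

theorem commute_tmul_one_one_tmul (x : X.Lim) (y : Y.Lim) :
    Commute (x ⊠ (1 : Y.Lim)) ((1 : X.Lim) ⊠ y) := commute_inl_inr x y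

theorem series_tmul_one (c : ℕ → ℂ) {x : X.Lim} (hx : TopNilp x) :
    series c (x ⊠ (1 : Y.Lim)) = series c x ⊠ 1 := (map_series (inl X Y) c hx).symm

theorem series_one_tmul (c : ℕ → ℂ) {y : Y.Lim} (hy : TopNilp y) :
    series c ((1 : X.Lim) ⊠ y) = 1 ⊠ series c y := (map_series (inr X Y) c hy).symm

theorem expo_tmul_one {x : X.Lim} (hx : TopNilp x) :
    expo (x ⊠ (1 : Y.Lim)) = expo x ⊠ 1 := series_tmul_one _ hx

theorem expo_one_tmul {y : Y.Lim} (hy : TopNilp y) :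
    expo ((1 : X.Lim) ⊠ y) = 1 ⊠ expo y := series_one_tmul _ hy

/-- Exponentials of primitive elements are group-like. -/
theorem expo_smul_primitive (c : ℂ) {x : X.Lim} {y : Y.Lim} (hx : TopNilp x) (hy : TopNilp y) :
    expo (c • (x ⊠ 1 + 1 ⊠ y)) = expo (c • x) ⊠ expo (c • y) := by
  rw [smul_add, ← smul_tmul, ← tmul_smul, expo_add ((hx.smul c).tmul_left _)
    ((hy.smul c).tmul_right _) (commute_tmul_one_one_tmul _ _), expo_tmul_one (hx.smul c),
    expo_one_tmul (hy.smul c), tmul_mul_tmul, one_mul, mul_one]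

theorem comulGen_mem (k : ℕ) (g : Gen) :
    (comulGen h w g).1 k ∈ tensorWordSpan h w k (weight [g]) := by
  have h1 : (1 : Level h w k) ∈ wordSpan h w k 0 := mem_wordSpan_zero 1
  cases g with
  | N => exact mem_tensorWordSpan_zero _
  | A => exact mem_tensorWordSpan_zero _
  | E =>
    refine Submodule.add_mem _ (tmul_mem_tensorWordSpan ?_ (gen_mem_wordSpan k E) h1)
      (tmul_mem_tensorWordSpan ?_ h1 (gen_mem_wordSpan k E))
    · exact le_of_eq (add_zero _).symm
    · exact le_of_eq (zero_add _).symm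
  | Ap =>
    refine Submodule.add_mem _ (tmul_mem_tensorWordSpan ?_ (gen_mem_wordSpan k Ap) h1)
      (tmul_mem_tensorWordSpan ?_ h1 (gen_mem_wordSpan k Ap))
    · exact le_of_eq (add_zero _).symm
    · exact le_of_eq (zero_add _).symm

theorem isRep_comulGen : IsRep h w (comulGen h w) where
  central g := by
    have hl : ∀ x y : U h w, Commute (gen h w E ⊠ (1 : U h w)) (x ⊠ y) := fun x y => by
      rw [Commute, SemiconjBy, tmul_mul_tmul, tmul_mul_tmul, one_mul, mul_one,
        (commute_E h w x).eq]
    have hr : ∀ x y : U h w, Commute ((1 : U h w) ⊠ gen h w E) (x ⊠ y) := fun x y => by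
      rw [Commute, SemiconjBy, tmul_mul_tmul, tmul_mul_tmul, one_mul, mul_one,
        (commute_E h w y).eq]
    have hlr : ∀ x y : U h w, Commute (comulGen h w E) (x ⊠ y) := fun x y =>
      (hl x y).add_left (hr x y)
    cases g with
    | N => exact (hlr _ _).add_right (hlr _ _)
    | E => exact (hlr _ _).add_right (hlr _ _)
    | Ap => exact (hlr _ _).add_right (hlr _ _)
    | A => exact ((hlr _ _).add_right (hlr _ _)).add_right ((hlr _ _).smul_right w)
  A_Ap := by
    have hE := topNilp_E h w
    refine (comul_relation_A_Ap (A_mul_Ap h w) (N_mul_Ap h w) (smul_apHat h w)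
      (commute_Ap_expAp h w w) (commute_expE h w h) (commute_expE h w (-h))
      (commute_sinhE h w)).trans ?_
    rw [comulGen, comulGen, expo_smul_primitive w (topNilp_Ap h w) (topNilp_Ap h w),
      series_sinh_add h (hE.tmul_left 1) (TopNilp.tmul_right 1 hE) (commute_tmul_one_one_tmul _ _),
      series_tmul_one _ hE, series_one_tmul _ hE, ← tmul_smul, ← smul_tmul,
      expo_one_tmul (hE.smul h), expo_tmul_one (hE.smul (-h)), tmul_mul_tmul, tmul_mul_tmul,
      one_mul, mul_one, one_mul, mul_one]
    rfl
  N_Ap := by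
    have hP := topNilp_Ap h w
    have e1 := commutator_tmul (gen h w N) (gen h w Ap) (expAp h w w) 1
    rw [mul_one, one_mul, sub_self, tmul_zero, add_zero, N_mul_Ap] at e1
    have e2 := commutator_tmul (gen h w N) (1 : U h w) (expAp h w w) (gen h w Ap)
    rw [mul_one, one_mul, sub_self, zero_tmul, zero_add, (commute_Ap_expAp h w w).eq, sub_self,
      tmul_zero] at e2
    have e3 := commutator_tmul (1 : U h w) (gen h w Ap) (gen h w N) 1
    rw [mul_one, one_mul, mul_one, one_mul, sub_self, sub_self, zero_tmul, tmul_zero,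
      add_zero] at e3
    have e4 := commutator_tmul (1 : U h w) (1 : U h w) (gen h w N) (gen h w Ap)
    rw [mul_one, sub_self, zero_tmul, zero_add, N_mul_Ap] at e4
    have key : ∀ u₁ u₂ v₁ v₂ : U2 h w, (u₁ + u₂) * (v₁ + v₂) - (v₁ + v₂) * (u₁ + u₂) =
        (u₁ * v₁ - v₁ * u₁) + (u₁ * v₂ - v₂ * u₁) + ((u₂ * v₁ - v₁ * u₂) + (u₂ * v₂ - v₂ * u₂)) := by
      intro u₁ u₂ v₁ v₂
      simp only [mul_add, add_mul]
      abel
    rw [comulGen, comulGen, key, e1, e2, e3, e4, series_expm1_add w (hP.tmul_left 1)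
      (TopNilp.tmul_right 1 hP) (commute_tmul_one_one_tmul _ _), series_tmul_one _ hP,
      series_one_tmul _ hP, ← tmul_smul, expo_one_tmul (hP.smul w), tmul_mul_tmul, one_mul, mul_one,
      add_zero, zero_add]
    rfl
  N_A := comul_relation_N_A (N_mul_A h w) (N_mul_expAp_w h w) (A_mul_expAp_w h w)
    (commute_expE h w h) (commute_expE h w (-h)) (commute_sinhE h w)
  word k := ⟨2 * k, fun l hl => by
    refine tensorWordSpan_eq_zero hl ?_
    have e : ((l.map (comulGen h w)).prod).1 k = (l.map fun g => (comulGen h w g).1 k).prod := by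
      refine (map_list_prod (((tower h w).tensor (tower h w)).level k) _).trans ?_
      rw [List.map_map]
      rfl
    rw [e]
    exact prod_mem_of_filtration (tensorWordSpan h w k) (mem_tensorWordSpan_zero 1)
      (fun i j a b => tensorWordSpan_mul) (fun g => (comulGen h w g).1 k) (comulGen_mem h w k) l⟩

/-- The coproduct of `U_{h,w}(H(4))`. -/
def comulHom : U h w →A[ℂ] U2 h w := (isRep_comulGen h w).lift

theorem comulHom_gen (g : Gen) : comulHom h w (gen h w g) = comulGen h w g :=
  (isRep_comulGen h w).lift_gen g

theorem comulHom_N : comulHom h w (gen h w N) = gen h w N ⊠ expAp h w w + 1 ⊠ gen h w N :=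
  comulHom_gen h w N

theorem comulHom_E : comulHom h w (gen h w E) = gen h w E ⊠ 1 + 1 ⊠ gen h w E :=
  comulHom_gen h w E

theorem comulHom_Ap : comulHom h w (gen h w Ap) = gen h w Ap ⊠ 1 + 1 ⊠ gen h w Ap :=
  comulHom_gen h w Ap

theorem comulHom_A : comulHom h w (gen h w A) =
    gen h w A ⊠ (expE h w h * expAp h w w) + expE h w (-h) ⊠ gen h w A +
      w • ((expE h w (-h) * gen h w N) ⊠ (sinhE h w * expAp h w w)) := comulHom_gen h w A

theorem comulHom_expE (c : ℂ) : comulHom h w (expE h w c) = expE h w c ⊠ expE h w c := by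
  rw [expE, map_expo _ ((topNilp_E h w).smul c), map_smul, comulHom_E,
    expo_smul_primitive c (topNilp_E h w) (topNilp_E h w)]

theorem comulHom_expAp (c : ℂ) : comulHom h w (expAp h w c) = expAp h w c ⊠ expAp h w c := by
  rw [expAp, map_expo _ ((topNilp_Ap h w).smul c), map_smul, comulHom_Ap,
    expo_smul_primitive c (topNilp_Ap h w) (topNilp_Ap h w)]

theorem comulHom_sinhE : comulHom h w (sinhE h w) =
    sinhE h w ⊠ expE h w h + expE h w (-h) ⊠ sinhE h w := by
  have hE := topNilp_E h w
  rw [sinhE, map_series _ _ hE, comulHom_E,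
    series_sinh_add h (hE.tmul_left 1) (TopNilp.tmul_right 1 hE) (commute_tmul_one_one_tmul _ _),
    series_tmul_one _ hE, series_one_tmul _ hE, ← tmul_smul, ← smul_tmul,
    expo_one_tmul (hE.smul h), expo_tmul_one (hE.smul (-h)), tmul_mul_tmul, tmul_mul_tmul,
    one_mul, mul_one, one_mul, mul_one]
  rfl

/-- `B = (1 - exp (-w A⁺)) / w` is skew-primitive. -/
theorem comulHom_apTilde : comulHom h w (apTilde h w) =
    apTilde h w ⊠ 1 + expAp h w (-w) ⊠ apTilde h w := by
  have hP := topNilp_Ap h w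
  rw [apTilde, map_series _ _ hP, comulHom_Ap, add_comm,
    series_expm1_add (-w) (TopNilp.tmul_right 1 hP) (hP.tmul_left 1)
      (commute_tmul_one_one_tmul _ _).symm,
    series_tmul_one _ hP, series_one_tmul _ hP, ← smul_tmul, expo_tmul_one (hP.smul (-w)),
    tmul_mul_tmul, one_mul, mul_one, add_comm]
  rfl

end H4

namespace ProAlg

/-- The tower of opposite algebras. -/
def op (X : ProAlg) : ProAlg where
  obj k := (X.obj k)ᵐᵒᵖ
  map k := AlgHom.op (X.map k)
  map_surjective k y := by
    obtain ⟨x, hx⟩ := X.map_surjective k y.unop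
    exact ⟨MulOpposite.op x, MulOpposite.unop_injective hx⟩

/-- The identity, as a map to the limit of the opposite algebras. -/
def toOp (X : ProAlg) : X.Lim →L[ℂ] X.op.Lim where
  toFun x := ⟨fun k => MulOpposite.op (x.1 k), fun k => congrArg MulOpposite.op (x.2 k)⟩
  map_add' _ _ := rfl
  map_smul' _ _ := rfl
  cont := continuous_of_level fun k => ⟨k, fun _ _ h => congrArg MulOpposite.op h⟩

/-- The identity, as a map from the limit of the opposite algebras. -/
def ofOp (X : ProAlg) : X.op.Lim →L[ℂ] X.Lim where
  toFun x := ⟨fun k => MulOpposite.unop (x.1 k), fun k => congrArg MulOpposite.unop (x.2 k)⟩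
  map_add' _ _ := rfl
  map_smul' _ _ := rfl
  cont := continuous_of_level fun k => ⟨k, fun _ _ h => congrArg MulOpposite.unop h⟩

variable {X : ProAlg}

theorem ofOp_toOp (x : X.Lim) : ofOp X (toOp X x) = x := rfl
theorem toOp_mul (x y : X.Lim) : toOp X (x * y) = toOp X y * toOp X x := rfl
theorem ofOp_mul (x y : X.op.Lim) : ofOp X (x * y) = ofOp X y * ofOp X x := rfl
theorem toOp_one : toOp X 1 = 1 := rfl
theorem ofOp_one : ofOp X 1 = 1 := rfl

theorem toOp_pow (x : X.Lim) (n : ℕ) : toOp X (x ^ n) = toOp X x ^ n := by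
  induction n with
  | zero => rw [pow_zero, pow_zero, toOp_one]
  | succ n ih => rw [pow_succ, toOp_mul, ih, pow_succ']

end ProAlg

namespace H4

open Filter Topology ProAlg Gen

variable {X Y : ProAlg}

theorem toOp_series (c : ℕ → ℂ) {x : X.Lim} (hx : TopNilp x) :
    toOp X (series c x) = series c (toOp X x) := by
  have hx' : TopNilp (toOp X x) := fun k => by
    obtain ⟨m, hm⟩ := hx k
    refine ⟨m, ?_⟩
    rw [← level_pow, ← toOp_pow]
    exact congrArg MulOpposite.op ((level_pow x m k).trans hm)
  refine HasSum.unique ?_ (hasSum_series c hx')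
  simpa [Function.comp_def, toOp_pow] using (hasSum_series c hx).map (toOp X) (toOp X).continuous

variable (h w : ℂ)

/-! ### The antipode -/

/-- The values of the antipode on the generators. -/
def antipodeGen : Gen → U h w
  | N => -(gen h w N * expAp h w (-w))
  | E => -gen h w E
  | Ap => -gen h w Ap
  | A => -(gen h w A * expAp h w (-w)) + w • (gen h w N * sinhE h w * expAp h w (-w))

theorem antipodeGen_mem (k : ℕ) (g : Gen) :
    (antipodeGen h w g).1 k ∈ wordSpan h w k (weight [g]) := by
  cases g with
  | N => exact mem_wordSpan_zero _
  | A => exact mem_wordSpan_zero _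
  | E => exact Submodule.neg_mem _ (gen_mem_wordSpan k E)
  | Ap => exact Submodule.neg_mem _ (gen_mem_wordSpan k Ap)

theorem antipode_relation_N_A {n a y s : X.Lim} {w : ℂ} (hna : n * a = a * n - a)
    (hny : n * y = y * n + (y - 1)) (hay : a * y = y * a - w • s) (hs : ∀ z, Commute s z) :
    (-(a * y) + w • (n * s * y)) * -(n * y) - -(n * y) * (-(a * y) + w • (n * s * y)) =
      a * y - w • (n * s * y) := by
  have hyn : y * n = n * y - y + 1 := by rw [hny]; abel
  have hya : y * a = a * y + w • s := by rw [hay]; abel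
  have e1 : n * s * y = s * (n * y) := by rw [← (hs n).eq, mul_assoc]
  have e2 : (n * y) * (s * (n * y)) = s * (n * y) * (n * y) := by
    rw [← mul_assoc, ← (hs _).eq]
  have e3 : (a * y) * (n * y) - (n * y) * (a * y) = a * y - w • (s * (n * y)) := by
    have h1 : (a * y) * (n * y) = a * (n * y * y) - a * (y * y) + a * y := by
      rw [mul_assoc, ← mul_assoc y, hyn]; noncomm_ring
    have h2 : (n * y) * (a * y) = (n * a) * (y * y) + w • (s * (n * y)) := by
      rw [mul_assoc, ← mul_assoc y, hya, add_mul, mul_add, smul_mul_assoc, mul_smul_comm,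
        ← mul_assoc n s, e1]
      noncomm_ring
    rw [h1, h2, hna]
    noncomm_ring
  rw [e1, ← e3]
  simp only [add_mul, mul_add, neg_mul, mul_neg, neg_neg, smul_neg, smul_mul_assoc,
    mul_smul_comm, e2]
  abel

theorem isRep_antipodeGen : IsRep h w fun g => toOp (tower h w) (antipodeGen h w g) where
  central g := by
    have : Commute (antipodeGen h w E) (antipodeGen h w g) := (commute_E h w _).neg_left
    exact (congrArg (toOp (tower h w)) this.eq).symm
  A_Ap := by
    have hE := topNilp_E h w
    have hP := topNilp_Ap h w
    have key : antipodeGen h w Ap * antipodeGen h w A - antipodeGen h w A * antipodeGen h w Ap =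
        expo (w • antipodeGen h w Ap) * series (sinhCoeff h) (antipodeGen h w E) := by
      have e1 : antipodeGen h w Ap * antipodeGen h w A - antipodeGen h w A * antipodeGen h w Ap =
          -((gen h w A * gen h w Ap - gen h w Ap * gen h w A) * expAp h w (-w)) +
          (w • (gen h w N * gen h w Ap - gen h w Ap * gen h w N)) *
            (sinhE h w * expAp h w (-w)) := by
        have c1 : gen h w A * expAp h w (-w) * gen h w Ap =
            gen h w A * gen h w Ap * expAp h w (-w) := by
          rw [mul_assoc, ← (commute_Ap_expAp h w _).eq, mul_assoc]
        have c2 : gen h w N * sinhE h w * expAp h w (-w) * gen h w Ap =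
            gen h w N * gen h w Ap * (sinhE h w * expAp h w (-w)) := by
          rw [mul_assoc, ← (commute_Ap_expAp h w _).eq, mul_assoc, ← mul_assoc (sinhE h w),
            (commute_sinhE h w _).eq, ← mul_assoc, ← mul_assoc, ← mul_assoc]
        simp only [antipodeGen, add_mul, mul_add, neg_mul, mul_neg, neg_neg, smul_neg,
          smul_mul_assoc, mul_smul_comm, c1, c2, sub_mul, smul_sub]
        simp only [mul_assoc]
        abel
      rw [e1, A_mul_Ap, N_mul_Ap, smul_apHat, mul_assoc, expAp_mul_neg, mul_one, sub_mul, one_mul,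
        ← mul_assoc, ← (commute_sinhE h w (expAp h w w)).eq, mul_assoc, expAp_mul_neg, mul_one]
      change _ = expo (w • -gen h w Ap) * series (sinhCoeff h) (-gen h w E)
      rw [series_sinh_neg, smul_neg, ← neg_smul, mul_neg]
      change _ = -(expAp h w (-w) * sinhE h w)
      rw [← (commute_sinhE h w _).eq]
      abel
    have hE' : TopNilp (antipodeGen h w E) := hE.neg
    have hP' : TopNilp (antipodeGen h w Ap) := hP.neg
    rw [expo, ← map_smul, ← toOp_series _ (hP'.smul w), ← toOp_series _ hE', ← toOp_mul]
    exact congrArg (toOp (tower h w)) key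
  N_Ap := by
    have hP := topNilp_Ap h w
    have key : antipodeGen h w Ap * antipodeGen h w N - antipodeGen h w N * antipodeGen h w Ap =
        series (expm1Coeff w) (antipodeGen h w Ap) := by
      change -gen h w Ap * -(gen h w N * expAp h w (-w)) -
        -(gen h w N * expAp h w (-w)) * -gen h w Ap = series (expm1Coeff w) (-gen h w Ap)
      rw [series_expm1_neg w hP]
      change _ = -(apHat h w * expAp h w (-w))
      rw [← N_mul_Ap, neg_mul_neg, neg_mul_neg, mul_assoc (gen h w N),
        ← (commute_Ap_expAp h w _).eq]
      noncomm_ring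
    have hP' : TopNilp (antipodeGen h w Ap) := hP.neg
    rw [← toOp_series _ hP']
    exact congrArg (toOp (tower h w)) key
  N_A := by
    have key : antipodeGen h w A * antipodeGen h w N - antipodeGen h w N * antipodeGen h w A =
        -antipodeGen h w A := by
      refine (antipode_relation_N_A (N_mul_A h w) (N_mul_expAp_neg h w) (A_mul_expAp_neg h w)
        (commute_sinhE h w)).trans ?_
      rw [antipodeGen]
      abel
    exact congrArg (toOp (tower h w)) key
  word k := ⟨k, fun l hl => by
    have e : ((l.map fun g => toOp (tower h w) (antipodeGen h w g)).prod).1 k =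
        (l.map fun g => MulOpposite.op ((antipodeGen h w g).1 k)).prod := by
      refine (map_list_prod ((tower h w).op.level k) _).trans ?_
      rw [List.map_map]
      rfl
    rw [e]
    have := prod_mem_of_filtration (B := (Level h w k)ᵐᵒᵖ)
      (fun j => (wordSpan h w k j).comap (MulOpposite.opLinearEquiv ℂ).symm.toLinearMap)
      (mem_wordSpan_zero 1)
      (fun i j a b ha hb => by
        rw [add_comm]
        exact wordSpan_mul (a := b.unop) (b := a.unop) hb ha)
      (fun g => MulOpposite.op ((antipodeGen h w g).1 k)) (antipodeGen_mem h w k) l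
    exact MulOpposite.unop_injective (wordSpan_eq_zero hl this)⟩

/-- The antipode of `U_{h,w}(H(4))`. -/
def antipodeMap : U h w →L[ℂ] U h w :=
  (ofOp (tower h w)).comp (isRep_antipodeGen h w).lift.toContinuousLinearMap

theorem antipodeMap_gen (g : Gen) : antipodeMap h w (gen h w g) = antipodeGen h w g := by
  change ofOp (tower h w) ((isRep_antipodeGen h w).lift (gen h w g)) = _
  rw [IsRep.lift_gen, ofOp_toOp]

theorem antipodeMap_one : antipodeMap h w 1 = 1 := by
  change ofOp (tower h w) ((isRep_antipodeGen h w).lift 1) = _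
  rw [map_one, ofOp_one]

theorem antipodeMap_mul (x y : U h w) :
    antipodeMap h w (x * y) = antipodeMap h w y * antipodeMap h w x := by
  change ofOp (tower h w) ((isRep_antipodeGen h w).lift (x * y)) = _
  rw [map_mul, ofOp_mul]
  rfl

theorem antipodeMap_series (c : ℕ → ℂ) {x : U h w} (hx : TopNilp x) :
    antipodeMap h w (series c x) = series c (antipodeMap h w x) := by
  have hpow : ∀ n, antipodeMap h w (x ^ n) = antipodeMap h w x ^ n := fun n => by
    induction n with
    | zero => rw [pow_zero, pow_zero, antipodeMap_one]
    | succ n ih => rw [pow_succ, antipodeMap_mul, ih, pow_succ']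
  have hx' : TopNilp (antipodeMap h w x) := by
    rw [topNilp_iff] at hx ⊢
    simpa [Function.comp_def, hpow] using ((antipodeMap h w).continuous.tendsto 0).comp hx
  refine HasSum.unique ?_ (hasSum_series c hx')
  simpa [Function.comp_def, hpow] using
    (hasSum_series c hx).map (antipodeMap h w) (antipodeMap h w).continuous

theorem antipodeMap_expE (c : ℂ) : antipodeMap h w (expE h w c) = expE h w (-c) := by
  rw [expE, expo, antipodeMap_series h w _ ((topNilp_E h w).smul c), map_smul, antipodeMap_gen]
  change expo (c • -gen h w E) = _
  rw [smul_neg, ← neg_smul]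
  rfl

theorem antipodeMap_expAp (c : ℂ) : antipodeMap h w (expAp h w c) = expAp h w (-c) := by
  rw [expAp, expo, antipodeMap_series h w _ ((topNilp_Ap h w).smul c), map_smul, antipodeMap_gen]
  change expo (c • -gen h w Ap) = _
  rw [smul_neg, ← neg_smul]
  rfl

theorem antipodeMap_sinhE : antipodeMap h w (sinhE h w) = -sinhE h w := by
  rw [sinhE, antipodeMap_series h w _ (topNilp_E h w), antipodeMap_gen]
  exact series_sinh_neg h

/-! ### The counit -/

theorem exists_counit : ∃ f : Level h w 1 →ₐ[ℂ] ℂ, ∀ z,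
    f (proj h w 1 z) = FreeAlgebra.lift ℂ (fun _ => (0 : ℂ)) z := by
  set F : FreeAlgebra ℂ Gen →ₐ[ℂ] ℂ := FreeAlgebra.lift ℂ (fun _ => (0 : ℂ)) with hFdef
  have hF : ∀ g, F (.ι ℂ g) = 0 := fun g => by rw [hFdef, FreeAlgebra.lift_ι_apply]
  have hrel : ∀ ⦃x y⦄, Rel h w 1 x y → F x = F y := fun x y hxy => by
    cases hxy with
    | central g => rw [map_mul, map_mul, hF, hF]
    | A_Ap => simp [hF, trunc, sinhCoeff]
    | N_Ap => simp [hF, trunc, expm1Coeff]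
    | N_A => simp [hF]
    | word l hl =>
      rw [map_list_prod, List.map_map, map_zero, List.prod_eq_zero_iff]
      obtain ⟨g, l', rfl⟩ := List.exists_cons_of_ne_nil (show l ≠ [] by rintro rfl; simp [weight] at hl)
      exact List.mem_map.2 ⟨g, by simp, hF g⟩
  exact ⟨RingQuot.liftAlgHom ℂ ⟨F, hrel⟩, fun z => RingQuot.liftAlgHom_mkAlgHom_apply ℂ _ _ _⟩

/-- The counit of `U_{h,w}(H(4))`, factored through level `1`. -/
def counitLevel : Level h w 1 →ₐ[ℂ] ℂ := (exists_counit h w).choose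

/-- The counit of `U_{h,w}(H(4))`. -/
def counitHom : U h w →A[ℂ] ℂ where
  toAlgHom := (counitLevel h w).comp ((tower h w).level 1)
  cont := continuous_iff_continuousAt.2 fun a => by
    refine tendsto_const_nhds.congr' ?_
    filter_upwards [eventually_level a 1] with x hx
    exact (congrArg (counitLevel h w) hx).symm

theorem counitHom_gen (g : Gen) : counitHom h w (gen h w g) = 0 := by
  refine ((exists_counit h w).choose_spec (.ι ℂ g)).trans ?_
  rw [FreeAlgebra.lift_ι_apply]

/-- `x ↦ ε(x) 1`. Its continuity uses that `ε` is locally constant. -/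
def counitUnit : U h w →A[ℂ] U h w where
  toAlgHom := (Algebra.ofId ℂ (U h w)).comp (counitHom h w).toAlgHom
  cont := continuous_of_level fun k => ⟨1, fun x y hxy => by
    have : counitHom h w x = counitHom h w y := congrArg (counitLevel h w) hxy
    exact congrArg (fun r => (algebraMap ℂ (U h w) r).1 k) this⟩

theorem counitUnit_apply (x : U h w) :
    counitUnit h w x = algebraMap ℂ (U h w) (counitHom h w x) := rfl

theorem counitUnit_series (c : ℕ → ℂ) {g : Gen} (hg : TopNilp (gen h w g)) (a : ℂ) :
    counitUnit h w (series c (a • gen h w g)) = c 0 • 1 := by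
  rw [map_series _ _ (hg.smul a), map_smul, counitUnit_apply, counitHom_gen, map_zero, smul_zero,
    series, tsum_eq_single 0 fun n hn => by rw [zero_pow hn, smul_zero]]
  simp

theorem counitUnit_expE (c : ℂ) : counitUnit h w (expE h w c) = 1 := by
  rw [expE, expo, counitUnit_series h w _ (topNilp_E h w)]; simp [expCoeff]

theorem counitUnit_expAp (c : ℂ) : counitUnit h w (expAp h w c) = 1 := by
  rw [expAp, expo, counitUnit_series h w _ (topNilp_Ap h w)]; simp [expCoeff]

theorem counitUnit_sinhE : counitUnit h w (sinhE h w) = 0 := by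
  have := counitUnit_series h w (sinhCoeff h) (topNilp_E h w) 1
  rw [one_smul] at this
  rw [sinhE, this]; simp [sinhCoeff]

theorem counitUnit_gen (g : Gen) : counitUnit h w (gen h w g) = 0 := by
  rw [counitUnit_apply, counitHom_gen, map_zero]

end H4

namespace H4

open Filter Topology ProAlg Gen

variable (h w : ℂ)

/-! ### The Hopf algebra `U_{h,w}(H(4))` -/

/-- The completed tensor cube of `U_{h,w}(H(4))`. -/
abbrev U3 : Type := ((tower h w).tensor ((tower h w).tensor (tower h w))).Lim

/-- `Δ ⊗ id`, as an algebra homomorphism. -/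
def comulLeftHom : U2 h w →A[ℂ] U3 h w :=
  ContinuousAlgHom.comp ⟨ProAlg.assoc, continuous_limMap _ _⟩
    (tensorAlgMap (comulHom h w) (ContinuousAlgHom.id ℂ (U h w)))

theorem comulLeftHom_tmul (x y : U h w) :
    comulLeftHom h w (x ⊠ y) = ProAlg.assoc (comulHom h w x ⊠ y) :=
  congrArg ProAlg.assoc (tensorAlgMap_tmul _ _ x y)

/-- `id ⊗ Δ`, as an algebra homomorphism. -/
def comulRightHom : U2 h w →A[ℂ] U3 h w :=
  tensorAlgMap (ContinuousAlgHom.id ℂ (U h w)) (comulHom h w)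

theorem comulRightHom_tmul (x y : U h w) : comulRightHom h w (x ⊠ y) = x ⊠ comulHom h w y :=
  tensorAlgMap_tmul _ _ x y

theorem assoc_tmul {X Y Z : ProAlg} (x : X.Lim) (y : Y.Lim) (z : Z.Lim) :
    ProAlg.assoc ((x ⊠ y) ⊠ z) = x ⊠ (y ⊠ z) := rfl

theorem comul_coassoc (x : U h w) :
    comulLeftHom h w (comulHom h w x) = comulRightHom h w (comulHom h w x) := by
  refine algHom_eq ((comulLeftHom h w).comp (comulHom h w))
    ((comulRightHom h w).comp (comulHom h w)) (fun g => ?_) x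
  change comulLeftHom h w (comulHom h w (gen h w g)) = comulRightHom h w (comulHom h w (gen h w g))
  cases g with
  | N =>
    simp only [comulHom_N, map_add, comulLeftHom_tmul, comulRightHom_tmul, comulHom_expAp, map_one,
      add_tmul, tmul_add, assoc_tmul, ← one_tmul_one (X := tower h w) (Y := tower h w), add_assoc]
  | E =>
    simp only [comulHom_E, map_add, comulLeftHom_tmul, comulRightHom_tmul, map_one,
      add_tmul, tmul_add, assoc_tmul, ← one_tmul_one (X := tower h w) (Y := tower h w), add_assoc]
  | Ap =>
    simp only [comulHom_Ap, map_add, comulLeftHom_tmul, comulRightHom_tmul, map_one,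
      add_tmul, tmul_add, assoc_tmul, ← one_tmul_one (X := tower h w) (Y := tower h w), add_assoc]
  | A =>
    simp only [comulHom_A, map_add, map_smul, comulLeftHom_tmul, comulRightHom_tmul, map_mul,
      comulHom_expE, comulHom_expAp, comulHom_N, comulHom_sinhE, mul_add, add_mul, tmul_mul_tmul,
      add_tmul, tmul_add, smul_tmul, tmul_smul, assoc_tmul, mul_one, smul_add]
    abel

theorem flip_tmul {X Y : ProAlg} (x : X.Lim) (y : Y.Lim) : ProAlg.flip (x ⊠ y) = y ⊠ x := rfl

theorem mulMap_tensorMap_tmul {X : ProAlg} (f g : X.Lim →L[ℂ] X.Lim) (x y : X.Lim) :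
    (mulMap X).comp (tensorMap f g) (x ⊠ y) = f x * g y :=
  (congrArg (mulMap X) (tensorMap_tmul f g x y)).trans (mulMap_tmul _ _)

theorem counitUnit_mul (x y : U h w) : counitUnit h w x * y = counitHom h w x • y :=
  (Algebra.smul_def (counitHom h w x) y).symm

/-- `ε ⊗ id`, as an algebra homomorphism. -/
def counitLeftHom : U2 h w →A[ℂ] U h w :=
  algHomOfTmul ((mulMap (tower h w)).comp (tensorMap (counitUnit h w).toContinuousLinearMap
    (ContinuousLinearMap.id ℂ (U h w))))
    (by
      rw [mulMap_tensorMap_tmul]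
      exact (mul_one _).trans (map_one (counitUnit h w)))
    (fun x y x' y' => by
      have e : ∀ x y : U h w, (mulMap (tower h w)).comp (tensorMap
          (counitUnit h w).toContinuousLinearMap (ContinuousLinearMap.id ℂ (U h w))) (x ⊠ y) =
          counitHom h w x • y := fun x y =>
        (mulMap_tensorMap_tmul _ _ x y).trans (counitUnit_mul h w x y)
      rw [tmul_mul_tmul, e, e, e, map_mul, smul_mul_smul_comm])

theorem counitLeftHom_tmul (x y : U h w) :
    counitLeftHom h w (x ⊠ y) = counitUnit h w x * y := mulMap_tensorMap_tmul _ _ x y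

/-- `id ⊗ ε`, as an algebra homomorphism. -/
def counitRightHom : U2 h w →A[ℂ] U h w :=
  (counitLeftHom h w).comp ⟨ProAlg.flip, continuous_limMap _ _⟩

theorem counitRightHom_tmul (x y : U h w) :
    counitRightHom h w (x ⊠ y) = counitUnit h w y * x := counitLeftHom_tmul h w y x

theorem counitLeftHom_comul (x : U h w) : counitLeftHom h w (comulHom h w x) = x := by
  refine algHom_eq ((counitLeftHom h w).comp (comulHom h w)) (ContinuousAlgHom.id ℂ (U h w))
    (fun g => ?_) x
  change counitLeftHom h w (comulHom h w (gen h w g)) = gen h w g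
  cases g <;>
  simp only [comulHom_N, comulHom_E, comulHom_Ap, comulHom_A, map_add, map_smul,
    counitLeftHom_tmul, map_mul, map_one, counitUnit_gen, counitUnit_expE, zero_mul, mul_zero,
    one_mul, mul_one, zero_add, add_zero, smul_zero]

theorem counitRightHom_comul (x : U h w) : counitRightHom h w (comulHom h w x) = x := by
  refine algHom_eq ((counitRightHom h w).comp (comulHom h w)) (ContinuousAlgHom.id ℂ (U h w))
    (fun g => ?_) x
  change counitRightHom h w (comulHom h w (gen h w g)) = gen h w g
  cases g <;>
  simp only [comulHom_N, comulHom_E, comulHom_Ap, comulHom_A, map_add, map_smul,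
    counitRightHom_tmul, map_mul, map_one, counitUnit_gen, counitUnit_expE, counitUnit_expAp,
    counitUnit_sinhE, zero_mul, one_mul, mul_one, add_zero, smul_zero]

/-- `m ∘ (S ⊗ id)`. -/
def antipodeLeftMap : U2 h w →L[ℂ] U h w :=
  (mulMap (tower h w)).comp (tensorMap (antipodeMap h w) (ContinuousLinearMap.id ℂ (U h w)))

/-- `m ∘ (id ⊗ S)`. -/
def antipodeRightMap : U2 h w →L[ℂ] U h w :=
  (mulMap (tower h w)).comp (tensorMap (ContinuousLinearMap.id ℂ (U h w)) (antipodeMap h w))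

theorem antipodeLeftMap_tmul (x y : U h w) :
    antipodeLeftMap h w (x ⊠ y) = antipodeMap h w x * y := mulMap_tensorMap_tmul _ _ x y

theorem antipodeRightMap_tmul (x y : U h w) :
    antipodeRightMap h w (x ⊠ y) = x * antipodeMap h w y := mulMap_tensorMap_tmul _ _ x y

/-- `m ∘ (S ⊗ id)` maps `t (c ⊗ d)` to `S(c) m((S ⊗ id)(t)) d`, as `S` reverses products. -/
theorem antipodeLeftMap_mul_tmul (t : U2 h w) (c d : U h w) :
    antipodeLeftMap h w (t * (c ⊠ d)) = antipodeMap h w c * antipodeLeftMap h w t * d := by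
  refine tensor_ext (f := (antipodeLeftMap h w).toLinearMap ∘ₗ LinearMap.mulRight ℂ (c ⊠ d))
    (g := LinearMap.mulRight ℂ d ∘ₗ LinearMap.mulLeft ℂ (antipodeMap h w c) ∘ₗ
      (antipodeLeftMap h w).toLinearMap)
    ((antipodeLeftMap h w).continuous.comp (continuous_id.mul continuous_const))
    ((continuous_const.mul (antipodeLeftMap h w).continuous).mul continuous_const)
    (fun a b => ?_) t
  change antipodeLeftMap h w ((a ⊠ b) * (c ⊠ d)) =
    antipodeMap h w c * antipodeLeftMap h w (a ⊠ b) * d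
  rw [tmul_mul_tmul, antipodeLeftMap_tmul, antipodeLeftMap_tmul, antipodeMap_mul]
  simp only [mul_assoc]

theorem antipodeRightMap_tmul_mul (t : U2 h w) (a b : U h w) :
    antipodeRightMap h w ((a ⊠ b) * t) = a * antipodeRightMap h w t * antipodeMap h w b := by
  refine tensor_ext (f := (antipodeRightMap h w).toLinearMap ∘ₗ LinearMap.mulLeft ℂ (a ⊠ b))
    (g := LinearMap.mulRight ℂ (antipodeMap h w b) ∘ₗ LinearMap.mulLeft ℂ a ∘ₗ
      (antipodeRightMap h w).toLinearMap)
    ((antipodeRightMap h w).continuous.comp (continuous_const.mul continuous_id))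
    ((continuous_const.mul (antipodeRightMap h w).continuous).mul continuous_const)
    (fun c d => ?_) t
  change antipodeRightMap h w ((a ⊠ b) * (c ⊠ d)) =
    a * antipodeRightMap h w (c ⊠ d) * antipodeMap h w b
  rw [tmul_mul_tmul, antipodeRightMap_tmul, antipodeRightMap_tmul, antipodeMap_mul]
  simp only [mul_assoc]

theorem antipodeLeftMap_mul {t : U2 h w} {r : ℂ}
    (ht : antipodeLeftMap h w t = algebraMap ℂ (U h w) r) (u : U2 h w) :
    antipodeLeftMap h w (t * u) = algebraMap ℂ (U h w) r * antipodeLeftMap h w u := by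
  refine tensor_ext (f := (antipodeLeftMap h w).toLinearMap ∘ₗ LinearMap.mulLeft ℂ t)
    (g := LinearMap.mulLeft ℂ (algebraMap ℂ (U h w) r) ∘ₗ (antipodeLeftMap h w).toLinearMap)
    ((antipodeLeftMap h w).continuous.comp (continuous_const.mul continuous_id))
    (continuous_const.mul (antipodeLeftMap h w).continuous) (fun c d => ?_) u
  change antipodeLeftMap h w (t * (c ⊠ d)) = algebraMap ℂ (U h w) r * antipodeLeftMap h w (c ⊠ d)
  rw [antipodeLeftMap_mul_tmul, ht, antipodeLeftMap_tmul, ← Algebra.commutes, mul_assoc]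

theorem antipodeRightMap_mul {u : U2 h w} {r : ℂ}
    (hu : antipodeRightMap h w u = algebraMap ℂ (U h w) r) (t : U2 h w) :
    antipodeRightMap h w (t * u) = antipodeRightMap h w t * algebraMap ℂ (U h w) r := by
  refine tensor_ext (f := (antipodeRightMap h w).toLinearMap ∘ₗ LinearMap.mulRight ℂ u)
    (g := LinearMap.mulRight ℂ (algebraMap ℂ (U h w) r) ∘ₗ (antipodeRightMap h w).toLinearMap)
    ((antipodeRightMap h w).continuous.comp (continuous_id.mul continuous_const))
    ((antipodeRightMap h w).continuous.mul continuous_const) (fun a b => ?_) t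
  change antipodeRightMap h w ((a ⊠ b) * u) =
    antipodeRightMap h w (a ⊠ b) * algebraMap ℂ (U h w) r
  rw [antipodeRightMap_tmul_mul, hu, antipodeRightMap_tmul, mul_assoc, Algebra.commutes, mul_assoc]

/-- The subalgebra of the elements `x` with `L(Δ(x)) = ε(x) 1`, for a map `L` that is multiplicative on
their coproducts. Applied to `m ∘ (S ⊗ id)` and `m ∘ (id ⊗ S)`, which are not multiplicative. -/
def antipodeSubalgebra (L : U2 h w →L[ℂ] U h w) (h1 : L (1 ⊠ 1) = 1)
    (hmul : ∀ x y, L (comulHom h w x) = algebraMap ℂ (U h w) (counitHom h w x) →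
      L (comulHom h w y) = algebraMap ℂ (U h w) (counitHom h w y) →
      L (comulHom h w x * comulHom h w y) = L (comulHom h w x) * L (comulHom h w y)) :
    Subalgebra ℂ (U h w) where
  carrier := {x | L (comulHom h w x) = counitUnit h w x}
  mul_mem' {x y} hx hy := by
    change L (comulHom h w (x * y)) = counitUnit h w (x * y)
    rw [map_mul, hmul x y hx hy, hx, hy, map_mul]
  add_mem' {x y} hx hy := by
    change L (comulHom h w (x + y)) = counitUnit h w (x + y)
    rw [map_add, map_add, map_add, hx, hy]
  algebraMap_mem' r := by
    change L (comulHom h w (algebraMap ℂ (U h w) r)) = counitUnit h w (algebraMap ℂ (U h w) r)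
    rw [Algebra.algebraMap_eq_smul_one, map_smul, map_smul, map_smul,
      map_one (comulHom h w), map_one (counitUnit h w), ← one_tmul_one, h1]

theorem antipodeLeftMap_comul (x : U h w) :
    antipodeLeftMap h w (comulHom h w x) = algebraMap ℂ (U h w) (counitHom h w x) := by
  refine eq_of_subalgebra (f := fun x => antipodeLeftMap h w (comulHom h w x))
    (g := counitUnit h w)
    ((antipodeLeftMap h w).continuous.comp (comulHom h w).cont) (counitUnit h w).cont
    (antipodeSubalgebra h w (antipodeLeftMap h w)
      (by rw [antipodeLeftMap_tmul, antipodeMap_one, mul_one])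
      fun x y hx _ => by rw [antipodeLeftMap_mul h w hx, hx]) (fun g => ?_) (fun _ hx => hx) x
  change antipodeLeftMap h w (comulHom h w (gen h w g)) = counitUnit h w (gen h w g)
  rw [counitUnit_gen]
  cases g with
  | N =>
    rw [comulHom_N, map_add, antipodeLeftMap_tmul, antipodeLeftMap_tmul, antipodeMap_one,
      antipodeMap_gen, antipodeGen, neg_mul, mul_assoc, expAp_neg_mul]
    noncomm_ring
  | E =>
    rw [comulHom_E, map_add, antipodeLeftMap_tmul, antipodeLeftMap_tmul, antipodeMap_one,
      antipodeMap_gen, antipodeGen]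
    noncomm_ring
  | Ap =>
    rw [comulHom_Ap, map_add, antipodeLeftMap_tmul, antipodeLeftMap_tmul, antipodeMap_one,
      antipodeMap_gen, antipodeGen]
    noncomm_ring
  | A =>
    have c := commute_expE h w h
    have e1 : ∀ z, z * expAp h w (-w) * (expE h w h * expAp h w w) = expE h w h * z := fun z => by
      rw [← mul_assoc, ← (c _).eq, mul_assoc, mul_assoc, expAp_neg_mul, mul_one]
    have e2 : gen h w N * expAp h w (-w) * expE h w h * (sinhE h w * expAp h w w) =
        expE h w h * (gen h w N * sinhE h w) := by
      rw [← (c _).eq, mul_assoc, mul_assoc (gen h w N), ← mul_assoc (expAp h w (-w)),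
        ← (commute_sinhE h w _).eq, mul_assoc, expAp_neg_mul, mul_one]
    rw [comulHom_A, map_add, map_add, map_smul, antipodeLeftMap_tmul, antipodeLeftMap_tmul,
      antipodeLeftMap_tmul, antipodeMap_mul, antipodeMap_expE, neg_neg, antipodeMap_gen,
      antipodeMap_gen, antipodeGen, antipodeGen, add_mul, neg_mul, smul_mul_assoc, e1, e1, neg_mul,
      neg_mul, e2, smul_neg]
    abel

theorem antipodeRightMap_comul (x : U h w) :
    antipodeRightMap h w (comulHom h w x) = algebraMap ℂ (U h w) (counitHom h w x) := by
  refine eq_of_subalgebra (f := fun x => antipodeRightMap h w (comulHom h w x))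
    (g := counitUnit h w)
    ((antipodeRightMap h w).continuous.comp (comulHom h w).cont) (counitUnit h w).cont
    (antipodeSubalgebra h w (antipodeRightMap h w)
      (by rw [antipodeRightMap_tmul, antipodeMap_one, mul_one])
      fun x y _ hy => by rw [antipodeRightMap_mul h w hy, hy]) (fun g => ?_) (fun _ hx => hx) x
  change antipodeRightMap h w (comulHom h w (gen h w g)) = counitUnit h w (gen h w g)
  rw [counitUnit_gen]
  cases g with
  | N =>
    rw [comulHom_N, map_add, antipodeRightMap_tmul, antipodeRightMap_tmul, antipodeMap_expAp,
      antipodeMap_gen, antipodeGen]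
    noncomm_ring
  | E =>
    rw [comulHom_E, map_add, antipodeRightMap_tmul, antipodeRightMap_tmul, antipodeMap_one,
      antipodeMap_gen, antipodeGen]
    noncomm_ring
  | Ap =>
    rw [comulHom_Ap, map_add, antipodeRightMap_tmul, antipodeRightMap_tmul, antipodeMap_one,
      antipodeMap_gen, antipodeGen]
    noncomm_ring
  | A =>
    have c := commute_expE h w (-h)
    have e1 : gen h w A * (expAp h w (-w) * expE h w (-h)) =
        expE h w (-h) * (gen h w A * expAp h w (-w)) := by
      rw [(c _).eq, mul_assoc]
    have e2 : expE h w (-h) * gen h w N * (expAp h w (-w) * -sinhE h w) =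
        -(expE h w (-h) * (gen h w N * sinhE h w * expAp h w (-w))) := by
      rw [mul_neg, mul_neg, ← (commute_sinhE h w _).eq]
      simp only [mul_assoc]
    rw [comulHom_A, map_add, map_add, map_smul, antipodeRightMap_tmul, antipodeRightMap_tmul,
      antipodeRightMap_tmul, antipodeMap_mul, antipodeMap_mul, antipodeMap_expE, antipodeMap_expAp,
      antipodeMap_sinhE, antipodeMap_gen, antipodeGen, e1, e2, mul_add, mul_neg, mul_smul_comm,
      smul_neg]
    abel

/-- The topological Hopf algebra `U_{h,w}(H(4))`. -/
def hopf : TopHopf (tower h w) where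
  comul := comulHom h w
  counit := counitHom h w
  antipode := antipodeMap h w
  comulLeft := (comulLeftHom h w).toContinuousLinearMap
  comulLeft_tmul := comulLeftHom_tmul h w
  comulRight := (comulRightHom h w).toContinuousLinearMap
  comulRight_tmul := comulRightHom_tmul h w
  counitLeft := (counitLeftHom h w).toContinuousLinearMap
  counitLeft_tmul x y := (counitLeftHom_tmul h w x y).trans (counitUnit_mul h w x y)
  counitRight := (counitRightHom h w).toContinuousLinearMap
  counitRight_tmul x y := (counitRightHom_tmul h w x y).trans (counitUnit_mul h w y x)
  antipodeLeft := antipodeLeftMap h w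
  antipodeLeft_tmul := antipodeLeftMap_tmul h w
  antipodeRight := antipodeRightMap h w
  antipodeRight_tmul := antipodeRightMap_tmul h w
  coassoc := comul_coassoc h w
  counitLeft_comul := counitLeftHom_comul h w
  counitRight_comul := counitRightHom_comul h w
  antipodeLeft_comul := antipodeLeftMap_comul h w
  antipodeRight_comul := antipodeRightMap_comul h w

theorem isHopfOfU_hopf : IsHopfOfU h w (hopf h w) where
  comul_N := comulHom_N h w
  comul_E := comulHom_E h w
  comul_Ap := comulHom_Ap h w
  comul_A := comulHom_A h w
  counit_gen := counitHom_gen h w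
  antipode_N := antipodeMap_gen h w N
  antipode_E := antipodeMap_gen h w E
  antipode_Ap := antipodeMap_gen h w Ap
  antipode_A := antipodeMap_gen h w A

end H4

namespace H4

open Filter Topology ProAlg Gen

variable {X Y : ProAlg}

/-! ### The twist `F` and the intertwining property of `R` -/

theorem commute_tmul {a a' : X.Lim} {b b' : Y.Lim} (ha : Commute a a') (hb : Commute b b') :
    Commute (a ⊠ b) (a' ⊠ b') := by
  rw [Commute, SemiconjBy, tmul_mul_tmul, tmul_mul_tmul, ha.eq, hb.eq]

theorem commute_of_tmul {d : (X.tensor Y).Lim} (hd : ∀ x y, Commute d (x ⊠ y))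
    (t : (X.tensor Y).Lim) : Commute d t :=
  tensor_ext (f := LinearMap.mulLeft ℂ d) (g := LinearMap.mulRight ℂ d)
    (continuous_const.mul continuous_id) (continuous_id.mul continuous_const)
    (fun x y => (hd x y).eq) t

variable (h w : ℂ)

theorem topNilp_N_Ap : TopNilp (w • (gen h w N ⊠ gen h w Ap)) :=
  (TopNilp.tmul_right _ (topNilp_Ap h w)).smul w

theorem topNilp_Ap_N : TopNilp (w • (gen h w Ap ⊠ gen h w N)) :=
  ((topNilp_Ap h w).tmul_left _).smul w

theorem topNilp_E_N : TopNilp ((-2 * h) • (gen h w E ⊠ gen h w N)) :=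
  ((topNilp_E h w).tmul_left _).smul _

theorem topNilp_A_apTilde : TopNilp ((2 * h) • ((expE h w h * gen h w A) ⊠ apTilde h w)) :=
  (TopNilp.tmul_right _ (topNilp_apTilde h w)).smul _

theorem isUnit_twist : IsUnit (twist h w) := isUnit_expo (topNilp_N_Ap h w)

/-- The flip as a continuous homomorphism. -/
def flipHom (X Y : ProAlg) : (X.tensor Y).Lim →A[ℂ] (Y.tensor X).Lim :=
  ⟨ProAlg.flip, continuous_limMap _ _⟩

theorem flip_twist : ProAlg.flip (twist h w) = expo (w • (gen h w Ap ⊠ gen h w N)) := by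
  change flipHom _ _ (expo _) = _
  rw [map_expo _ (topNilp_N_Ap h w), map_smul]
  rfl

theorem isUnit_flip_twist : IsUnit (ProAlg.flip (twist h w)) := by
  rw [flip_twist]; exact isUnit_expo (topNilp_Ap_N h w)

theorem flip_twist_mul_Rhw : ProAlg.flip (twist h w) * Rhw h w = Rh h w * twist h w := by
  rw [Rhw, mul_assoc, ← mul_assoc, Ring.mul_inverse_cancel _ (isUnit_flip_twist h w), one_mul]

theorem isUnit_Rh : IsUnit (Rh h w) :=
  (isUnit_expo (topNilp_E_N h w)).mul (isUnit_expo (topNilp_A_apTilde h w))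

theorem isUnit_Rhw : IsUnit (Rhw h w) :=
  ((isUnit_flip_twist h w).ringInverse.mul (isUnit_Rh h w)).mul (isUnit_twist h w)

/-- The twist makes the coproduct of `N` primitive. -/
theorem twist_mul_comul_N : twist h w * comulHom h w (gen h w N) =
    (gen h w N ⊠ 1 + 1 ⊠ gen h w N) * twist h w := by
  have hx := topNilp_N_Ap h w
  have hc : Commute (w • (gen h w N ⊠ gen h w Ap)) (gen h w N ⊠ expAp h w w) :=
    (commute_tmul (Commute.refl _) (commute_Ap_expAp h w w)).smul_left w
  have hc1 : Commute (w • (gen h w N ⊠ gen h w Ap)) (gen h w N ⊠ 1) :=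
    (commute_tmul (Commute.refl _) (Commute.one_right _)).smul_left w
  have e : (w • (gen h w N ⊠ gen h w Ap)) * (1 ⊠ gen h w N) -
      (1 ⊠ gen h w N) * (w • (gen h w N ⊠ gen h w Ap)) =
      gen h w N ⊠ 1 - gen h w N ⊠ expAp h w w := by
    rw [smul_mul_assoc, mul_smul_comm, ← smul_sub, tmul_mul_tmul, tmul_mul_tmul, mul_one, one_mul,
      ← tmul_sub, ← neg_sub (gen h w N * gen h w Ap), N_mul_Ap, tmul_neg, smul_neg, ← tmul_smul,
      smul_apHat, tmul_sub]
    abel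
  rw [comulHom_N, mul_add, twist, expo_mul_eq_of_commutator hx (hc1.sub_right hc) e,
    ← (expo_commute hx hc.symm).eq, ← add_mul]
  refine congrArg (· * expo (w • (gen h w N ⊠ gen h w Ap))) ?_
  abel

theorem commute_primitive_E (t : U2 h w) : Commute (gen h w E ⊠ 1 + 1 ⊠ gen h w E) t :=
  commute_of_tmul (fun x y => (commute_tmul (commute_E h w x) (Commute.one_left y)).add_left
    (commute_tmul (Commute.one_left x) (commute_E h w y))) t

/-- The twist turns the coproduct of `A` into the one of `U_{h,0}`. -/
theorem twist_mul_comul_A : twist h w * comulHom h w (gen h w A) =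
    (gen h w A ⊠ expE h w h + expE h w (-h) ⊠ gen h w A) * twist h w := by
  have hx := topNilp_N_Ap h w
  have hP := topNilp_Ap h w
  have hc : Commute (w • (gen h w N ⊠ gen h w Ap))
      ((expE h w (-h) * gen h w N) ⊠ (sinhE h w * expAp h w w)) :=
    (commute_tmul ((commute_expE h w (-h) _).symm.mul_right (Commute.refl _))
      ((commute_sinhE h w _).symm.mul_right (commute_Ap_expAp h w w))).smul_left w
  have e2 : (w • (gen h w N ⊠ gen h w Ap)) * (expE h w (-h) ⊠ gen h w A) -
      (expE h w (-h) ⊠ gen h w A) * (w • (gen h w N ⊠ gen h w Ap)) =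
      -(w • ((expE h w (-h) * gen h w N) ⊠ (sinhE h w * expAp h w w))) := by
    rw [smul_mul_assoc, mul_smul_comm, ← smul_sub, tmul_mul_tmul, tmul_mul_tmul,
      ← (commute_expE h w (-h) (gen h w N)).eq, ← tmul_sub, ← neg_sub (gen h w A * gen h w Ap),
      A_mul_Ap, tmul_neg, smul_neg]
  have hPc : Commute (gen h w Ap) (expE h w h * expAp h w w) :=
    (commute_expE h w h _).symm.mul_right (commute_Ap_expAp h w w)
  have e1 : (w • (gen h w N ⊠ gen h w Ap)) * (gen h w A ⊠ (expE h w h * expAp h w w)) -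
      (gen h w A ⊠ (expE h w h * expAp h w w)) * (w • (gen h w N ⊠ gen h w Ap)) =
      (1 ⊠ (-w • gen h w Ap)) * (gen h w A ⊠ (expE h w h * expAp h w w)) := by
    rw [smul_mul_assoc, mul_smul_comm, ← smul_sub, tmul_mul_tmul, tmul_mul_tmul, tmul_mul_tmul,
      ← hPc.eq, ← sub_tmul, N_mul_A, sub_sub_cancel_left, neg_tmul, one_mul, smul_mul_assoc,
      tmul_smul, neg_smul, smul_neg]
  have hexp := expo_mul_eq_of_eigen hx (TopNilp.tmul_right (X := tower h w) 1 (hP.smul (-w)))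
    ((commute_tmul (Commute.one_right _) ((Commute.refl _).smul_right _)).smul_left w)
    (commute_tmul (Commute.one_right _) (hPc.symm.smul_right _)) e1
  rw [expo_one_tmul (hP.smul (-w)), tmul_mul_tmul, one_mul, (commute_expE h w h _).eq, ← mul_assoc]
    at hexp
  change _ = (gen h w A ⊠ (expAp h w (-w) * expAp h w w * expE h w h)) * _ at hexp
  rw [expAp_neg_mul, one_mul] at hexp
  rw [comulHom_A, (commute_expE h w h _).eq, mul_add, mul_add, twist, hexp,
    expo_mul_eq_of_commutator hx (hc.smul_right w).neg_right e2,
    ← (expo_commute hx (hc.smul_right w).symm).eq, ← add_mul, ← add_mul]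
  congr 1
  abel

/-- The twist makes the coproduct of `B = (1 - exp (-w A⁺)) / w` primitive. -/
theorem twist_mul_comul_apTilde : twist h w * comulHom h w (apTilde h w) =
    (apTilde h w ⊠ 1 + 1 ⊠ apTilde h w) * twist h w := by
  have hx := topNilp_N_Ap h w
  have hP := topNilp_Ap h w
  have hc : Commute (w • (gen h w N ⊠ gen h w Ap)) (1 ⊠ apTilde h w) :=
    (commute_tmul (Commute.one_right _) (commute_Ap_apTilde h w)).smul_left w
  have hc' := expo_commute hx hc.symm
  have e1 : (w • (gen h w N ⊠ gen h w Ap)) * (apTilde h w ⊠ 1) -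
      (apTilde h w ⊠ 1) * (w • (gen h w N ⊠ gen h w Ap)) =
      (1 ⊠ (w • gen h w Ap)) * (apTilde h w ⊠ 1) := by
    rw [smul_mul_assoc, mul_smul_comm, ← smul_sub, tmul_mul_tmul, tmul_mul_tmul, tmul_mul_tmul,
      mul_one, one_mul, ← sub_tmul, N_mul_apTilde, one_mul, mul_one, tmul_smul]
  have hexp := expo_mul_eq_of_eigen hx (TopNilp.tmul_right (X := tower h w) 1 (hP.smul w))
    ((commute_tmul (Commute.one_right _) ((Commute.refl _).smul_right _)).smul_left w)
    (commute_tmul (Commute.one_right _) (Commute.one_left _)) e1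
  rw [expo_one_tmul (hP.smul w), tmul_mul_tmul, one_mul, mul_one] at hexp
  change _ = (apTilde h w ⊠ expAp h w w) * _ at hexp
  have eB : expAp h w (-w) = 1 - w • apTilde h w := by rw [smul_apTilde, sub_sub_cancel]
  have eΔ : comulHom h w (apTilde h w) =
      apTilde h w ⊠ 1 + 1 ⊠ apTilde h w - w • ((apTilde h w ⊠ 1) * (1 ⊠ apTilde h w)) := by
    rw [comulHom_apTilde, eB, sub_tmul, smul_tmul, tmul_mul_tmul, one_mul, mul_one]
    abel
  have e2 : w • ((apTilde h w ⊠ expAp h w w) * ((1 : U h w) ⊠ apTilde h w)) =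
      apTilde h w ⊠ expAp h w w - apTilde h w ⊠ 1 := by
    rw [tmul_mul_tmul, mul_one, ← tmul_smul, ← mul_smul_comm, smul_apTilde, mul_sub, mul_one,
      expAp_mul_neg, tmul_sub]
  rw [eΔ, twist, mul_sub, mul_add, mul_smul_comm, ← mul_assoc, hexp, mul_assoc, ← hc'.eq,
    ← mul_assoc, ← smul_mul_assoc, e2, ← add_mul, ← sub_mul]
  congr 1
  abel

theorem Rh_commute_primitive_N : Commute (gen h w N ⊠ 1 + 1 ⊠ gen h w N) (Rh h w) := by
  refine (expo_commute (topNilp_E_N h w) (Commute.smul_right ?_ _)).mul_right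
    (expo_commute (topNilp_A_apTilde h w) (Commute.smul_right ?_ _))
  · exact (commute_tmul (commute_E h w _).symm (Commute.one_left _)).add_left
      (commute_tmul (Commute.one_left _) (Commute.refl _))
  · have e : gen h w N * (expE h w h * gen h w A) =
        expE h w h * gen h w A * gen h w N - expE h w h * gen h w A := by
      rw [← mul_assoc, ← (commute_expE h w h _).eq, mul_assoc, N_mul_A, mul_sub, mul_assoc]
    have e' : gen h w N * apTilde h w = apTilde h w * gen h w N + apTilde h w := by
      rw [← sub_eq_iff_eq_add', N_mul_apTilde]
    rw [Commute, SemiconjBy, add_mul, mul_add, tmul_mul_tmul, tmul_mul_tmul, tmul_mul_tmul,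
      tmul_mul_tmul, e, e', one_mul, one_mul, mul_one, mul_one, sub_tmul, tmul_add]
    abel

/-- Conjugation by `exp (-2h E ⊗ N)` multiplies `k ⊗ y` by `exp (-2h a E) ⊗ 1` when `k` is central and
`[N, y] = a y`. -/
theorem expo_E_N_mul_tmul {k y : U h w} {a : ℂ} (hk : ∀ z, Commute k z)
    (hy : gen h w N * y - y * gen h w N = a • y) :
    expo ((-2 * h) • (gen h w E ⊠ gen h w N)) * (k ⊠ y) =
      ((expE h w (-2 * h * a) * k) ⊠ y) * expo ((-2 * h) • (gen h w E ⊠ gen h w N)) := by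
  have hE := topNilp_E h w
  have e : ((-2 * h) • (gen h w E ⊠ gen h w N)) * (k ⊠ y) -
      (k ⊠ y) * ((-2 * h) • (gen h w E ⊠ gen h w N)) =
      (((-2 * h * a) • gen h w E) ⊠ 1) * (k ⊠ y) := by
    rw [smul_mul_assoc, mul_smul_comm, ← smul_sub, tmul_mul_tmul, tmul_mul_tmul, tmul_mul_tmul,
      (hk _).eq, ← tmul_sub, hy, one_mul, smul_mul_assoc, smul_tmul, tmul_smul, smul_smul]
  rw [expo_mul_eq_of_eigen (topNilp_E_N h w) ((hE.smul (-2 * h * a)).tmul_left 1)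
    ((commute_tmul ((commute_E h w _).smul_right _) (Commute.one_right _)).smul_left _)
    (commute_tmul (hk _) (Commute.one_right _)) e, expo_tmul_one (hE.smul _), tmul_mul_tmul,
    one_mul]
  rfl

theorem Rh_mul_primitive_apTilde : Rh h w * (apTilde h w ⊠ 1 + 1 ⊠ apTilde h w) =
    (apTilde h w ⊠ 1 + 1 ⊠ apTilde h w) * Rh h w := by
  have hx := topNilp_A_apTilde h w
  have hy := topNilp_E_N h w
  have c1 : Commute ((2 * h) • ((expE h w h * gen h w A) ⊠ apTilde h w))
      ((expE h w (2 * h) - 1) ⊠ apTilde h w) :=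
    (commute_tmul ((commute_expE h w (2 * h) _).symm.sub_right (Commute.one_right _))
      (Commute.refl _)).smul_left _
  have c2 : Commute ((2 * h) • ((expE h w h * gen h w A) ⊠ apTilde h w)) (1 ⊠ apTilde h w) :=
    (commute_tmul (Commute.one_right _) (Commute.refl _)).smul_left _
  have e1 : ((2 * h) • ((expE h w h * gen h w A) ⊠ apTilde h w)) * (apTilde h w ⊠ 1) -
      (apTilde h w ⊠ 1) * ((2 * h) • ((expE h w h * gen h w A) ⊠ apTilde h w)) =
      (expE h w (2 * h) - 1) ⊠ apTilde h w := by
    rw [smul_mul_assoc, mul_smul_comm, ← smul_sub, tmul_mul_tmul, tmul_mul_tmul, mul_one, one_mul,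
      ← sub_tmul, ← mul_assoc, ← (commute_expE h w h (apTilde h w)).eq, mul_assoc, mul_assoc,
      ← mul_sub, A_mul_apTilde, ← smul_tmul, ← mul_smul_comm, smul_sinhE, mul_sub, expE_mul,
      expE_mul_neg, two_mul]
  have e2 := expo_E_N_mul_tmul h w (k := expE h w (2 * h)) (y := apTilde h w) (a := 1)
    (commute_expE h w _) (by rw [N_mul_apTilde, one_smul])
  rw [expE_mul, mul_one, show -2 * h + 2 * h = 0 by ring, expE_zero] at e2
  have c3 : Commute ((-2 * h) • (gen h w E ⊠ gen h w N)) (apTilde h w ⊠ 1) :=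
    (commute_tmul (commute_E h w _) (Commute.one_right _)).smul_left _
  rw [Rh, mul_assoc, mul_add, expo_mul_eq_of_commutator hx c1 e1, ← (expo_commute hx c2.symm).eq,
    ← add_mul, sub_tmul, show apTilde h w ⊠ 1 + (expE h w (2 * h) ⊠ apTilde h w -
      (1 : U h w) ⊠ apTilde h w) + (1 : U h w) ⊠ apTilde h w =
      apTilde h w ⊠ (1 : U h w) + expE h w (2 * h) ⊠ apTilde h w by abel, ← mul_assoc, mul_add, e2,
    ← (expo_commute hy c3.symm).eq, ← add_mul, mul_assoc]

/-- `Rʰ Δ₀(A) = σ(Δ₀(A)) Rʰ` for `Δ₀(A) = A ⊗ exp (h E) + exp (-h E) ⊗ A`. -/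
theorem Rh_mul_A : Rh h w * (gen h w A ⊠ expE h w h + expE h w (-h) ⊠ gen h w A) =
    (expE h w h ⊠ gen h w A + gen h w A ⊠ expE h w (-h)) * Rh h w := by
  have hx := topNilp_A_apTilde h w
  have hy := topNilp_E_N h w
  have cA : Commute (expE h w h * gen h w A) (gen h w A) :=
    (commute_expE h w h _).mul_left (Commute.refl _)
  have c1 : ∀ c, Commute ((2 * h) • ((expE h w h * gen h w A) ⊠ apTilde h w))
      (gen h w A ⊠ expE h w c) := fun c =>
    (commute_tmul cA (commute_expE h w c _).symm).smul_left _
  have e1 : ((2 * h) • ((expE h w h * gen h w A) ⊠ apTilde h w)) * (expE h w (-h) ⊠ gen h w A) -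
      (expE h w (-h) ⊠ gen h w A) * ((2 * h) • ((expE h w h * gen h w A) ⊠ apTilde h w)) =
      gen h w A ⊠ expE h w (-h) - gen h w A ⊠ expE h w h := by
    rw [smul_mul_assoc, mul_smul_comm, ← smul_sub, tmul_mul_tmul, tmul_mul_tmul,
      ← (commute_expE h w (-h) (expE h w h * gen h w A)).eq, ← mul_assoc, expE_neg_mul, one_mul,
      ← tmul_sub, ← neg_sub (gen h w A * apTilde h w), A_mul_apTilde, tmul_neg, smul_neg,
      ← tmul_smul, smul_sinhE, ← tmul_neg, neg_sub, tmul_sub]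
  have e2 := expo_E_N_mul_tmul h w (k := expE h w (-h)) (y := gen h w A) (a := -1)
    (commute_expE h w _) (by rw [N_mul_A, sub_sub_cancel_left, neg_one_smul])
  rw [expE_mul, show -2 * h * -1 + -h = h by ring] at e2
  have c3 : Commute ((-2 * h) • (gen h w E ⊠ gen h w N)) (gen h w A ⊠ expE h w (-h)) :=
    (commute_tmul (commute_E h w _) (commute_expE h w _ _).symm).smul_left _
  rw [Rh, mul_assoc, mul_add, expo_mul_eq_of_commutator hx ((c1 _).sub_right (c1 _)) e1,
    ← (expo_commute hx (c1 h).symm).eq,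
    ← add_mul, show gen h w A ⊠ expE h w h + (expE h w (-h) ⊠ gen h w A +
      (gen h w A ⊠ expE h w (-h) - gen h w A ⊠ expE h w h)) =
      expE h w (-h) ⊠ gen h w A + gen h w A ⊠ expE h w (-h) by abel, ← mul_assoc, mul_add, e2,
    ← (expo_commute hy c3.symm).eq, ← add_mul, mul_assoc]

/-- If `F` carries `Δ(u)` to `d` and `Rʰ` intertwines `d` with its flip, then `R` intertwines `Δ(u)`
with its flip. -/
theorem Rhw_intertwine_of {u : U h w} {d : U2 h w}
    (h1 : twist h w * comulHom h w u = d * twist h w)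
    (h2 : Rh h w * d = ProAlg.flip d * Rh h w) :
    Rhw h w * comulHom h w u = ProAlg.flip (comulHom h w u) * Rhw h w := by
  refine (isUnit_flip_twist h w).mul_left_cancel ?_
  rw [← mul_assoc, flip_twist_mul_Rhw, mul_assoc, h1, ← mul_assoc, h2, mul_assoc,
    ← flip_twist_mul_Rhw, ← mul_assoc, ← mul_assoc, ← map_mul, ← map_mul, h1]

/-- The elements `u` with `R Δ(u) = σ(Δ(u)) R`. -/
def intertwineSubalgebra : Subalgebra ℂ (U h w) where
  carrier := {u | Rhw h w * comulHom h w u = ProAlg.flip (comulHom h w u) * Rhw h w}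
  mul_mem' {x y} hx hy := by
    change Rhw h w * comulHom h w (x * y) = ProAlg.flip (comulHom h w (x * y)) * Rhw h w
    rw [map_mul, map_mul, ← mul_assoc, hx, mul_assoc, hy, mul_assoc]
  add_mem' {x y} hx hy := by
    change Rhw h w * comulHom h w (x + y) = ProAlg.flip (comulHom h w (x + y)) * Rhw h w
    rw [map_add, map_add, mul_add, add_mul, hx, hy]
  algebraMap_mem' r := by
    change Rhw h w * comulHom h w (algebraMap ℂ (U h w) r) =
      ProAlg.flip (comulHom h w (algebraMap ℂ (U h w) r)) * Rhw h w
    rw [AlgHomClass.commutes, AlgHom.commutes, Algebra.commutes]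

theorem isClosed_intertwineSubalgebra : IsClosed (intertwineSubalgebra h w : Set (U h w)) :=
  isClosed_eq (continuous_const.mul (comulHom h w).cont)
    (((flipHom _ _).cont.comp (comulHom h w).cont).mul continuous_const)

open Polynomial in
/-- A topologically nilpotent element `x` is a power series in `f(x)`, for every power series `f` with
leading term `x`: it lies in every closed subalgebra that contains `f(x)`. -/
theorem mem_of_series_mem {c : ℕ → ℂ} (h0 : c 0 = 0) (h1 : c 1 = 1) {x : X.Lim} (hx : TopNilp x)
    (S : Subalgebra ℂ X.Lim) (hS : IsClosed (S : Set X.Lim)) (hc : series c x ∈ S) : x ∈ S := by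
  refine hS.closure_subset ((mem_closure_iff_nhds_basis (hasBasis_nhds x)).2 fun k _ => ?_)
  obtain ⟨m, hm⟩ := hx k
  let b := series c x
  obtain ⟨q, hq⟩ : ∃ q : ℂ[X], b.1 k = x.1 k + x.1 k ^ 2 * aeval (x.1 k) q := by
    refine ⟨∑ n ∈ Finset.range m, C (c (n + 2)) * Polynomial.X ^ n, ?_⟩
    have e : (x.1 k) ^ (m + 2) = 0 := pow_eq_zero_of_le (by omega) hm
    rw [show b.1 k = _ from series_level c hx e, Finset.sum_range_succ', Finset.sum_range_succ', h0, h1]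
    simp only [zero_smul, add_zero, map_sum, map_mul, aeval_C, map_pow, aeval_X, Finset.mul_sum,
      one_smul, zero_add, pow_one]
    rw [add_comm]
    congr 1
    refine Finset.sum_congr rfl fun n _ => ?_
    rw [← Algebra.smul_def, mul_smul_comm, ← pow_add, add_comm 2 n]
  have key : ∀ j ≤ m, ∀ p : ℂ[X], ∃ s ∈ S, s.1 k = x.1 k ^ (m - j) * aeval (x.1 k) p := by
    intro j
    induction j with
    | zero => exact fun _ p => ⟨0, S.zero_mem, by rw [Nat.sub_zero, hm, zero_mul, level_zero]⟩
    | succ j ih =>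
      intro hj p
      set i := m - (j + 1)
      have hi : m - j = i + 1 := by omega
      rw [hi] at ih
      -- `p = p(0) + X p'` and `b ^ i = x ^ i + x ^ (i + 1) r(x)`.
      obtain ⟨r, hr⟩ : ∃ r : ℂ[X], b.1 k ^ i = x.1 k ^ i + x.1 k ^ (i + 1) * aeval (x.1 k) r := by
        obtain ⟨r, hr⟩ := (sub_dvd_pow_sub_pow ((1 : ℂ[X]) + Polynomial.X * q) 1 i)
        refine ⟨q * r, ?_⟩
        have e : b.1 k = x.1 k * aeval (x.1 k) ((1 : ℂ[X]) + Polynomial.X * q) := by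
          rw [hq]; simp [mul_add, pow_two, mul_assoc]
        have hcomm : Commute (x.1 k) (aeval (x.1 k) ((1 : ℂ[X]) + Polynomial.X * q)) := by
          have := congrArg (aeval (x.1 k)) (mul_comm Polynomial.X ((1 : ℂ[X]) + Polynomial.X * q))
          rwa [map_mul, map_mul, aeval_X] at this
        rw [one_pow, add_sub_cancel_left, sub_eq_iff_eq_add'] at hr
        rw [e, hcomm.mul_pow, ← map_pow, hr]
        simp [mul_add, pow_succ, mul_assoc]
      obtain ⟨s, hs, hs'⟩ := ih (by omega) (divX p - C (p.coeff 0) * r)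
      refine ⟨p.coeff 0 • b ^ i + s, S.add_mem (S.smul_mem (S.pow_mem hc i) _) hs, ?_⟩
      rw [level_add, level_smul, level_pow, hs', hr]
      conv_rhs => rw [← divX_mul_X_add p, mul_comm (divX p)]
      simp only [map_add, map_mul, map_sub, aeval_X, aeval_C, pow_succ, mul_add, mul_sub,
        ← Algebra.smul_def, mul_smul_comm, smul_add, ← Algebra.commutes, mul_assoc]
      abel
  obtain ⟨s, hs, hs'⟩ := key (m - 1) (by omega) (if m = 0 then 0 else 1)
  refine ⟨s, hs, hs'.trans ?_⟩
  rcases Nat.eq_zero_or_pos m with rfl | hm0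
  · have : Subsingleton (X.obj k) := subsingleton_of_zero_eq_one (by simpa using hm.symm)
    exact Subsingleton.elim _ _
  · rw [if_neg hm0.ne', show m - (m - 1) = 1 by omega, pow_one, map_one, mul_one]

/-- `R Δ(u) = σ(Δ(u)) R`. -/
theorem Rhw_mul_comul (u : U h w) :
    Rhw h w * comulHom h w u = ProAlg.flip (comulHom h w u) * Rhw h w := by
  refine eq_of_subalgebra (f := fun u => Rhw h w * comulHom h w u)
    (g := fun u => ProAlg.flip (comulHom h w u) * Rhw h w)
    (continuous_const.mul (comulHom h w).cont)
    (((flipHom _ _).cont.comp (comulHom h w).cont).mul continuous_const)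
    (intertwineSubalgebra h w) (fun g => ?_) (fun _ hx => hx) u
  cases g with
  | N =>
    refine Rhw_intertwine_of h w (twist_mul_comul_N h w) ?_
    rw [map_add, flip_tmul, flip_tmul, add_comm, add_comm (1 ⊠ gen h w N)]
    exact (add_comm (1 ⊠ gen h w N) (gen h w N ⊠ 1)) ▸ (Rh_commute_primitive_N h w).eq.symm
  | E =>
    refine Rhw_intertwine_of h w (d := gen h w E ⊠ 1 + 1 ⊠ gen h w E) ?_ ?_
    · rw [comulHom_E, (commute_primitive_E h w _).eq]
    · rw [map_add, flip_tmul, flip_tmul, add_comm (1 ⊠ gen h w E), (commute_primitive_E h w _).eq]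
  | A =>
    refine Rhw_intertwine_of h w (twist_mul_comul_A h w) ?_
    rw [map_add, flip_tmul, flip_tmul, Rh_mul_A]
  | Ap =>
    refine mem_of_series_mem (c := expm1Coeff (-w)) (by simp [expm1Coeff]) (by simp [expm1Coeff])
      (topNilp_Ap h w) _ (isClosed_intertwineSubalgebra h w) ?_
    refine Rhw_intertwine_of h w (twist_mul_comul_apTilde h w) ?_
    rw [map_add, flip_tmul, flip_tmul, add_comm (1 ⊠ apTilde h w), Rh_mul_primitive_apTilde]

end H4

namespace ProAlg

variable {X : ProAlg}

/-- `leg12` as a continuous homomorphism. -/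
def leg12Hom (X : ProAlg) : (X.tensor X).Lim →A[ℂ] (X.tensor (X.tensor X)).Lim :=
  ⟨leg12, continuous_limMap _ _⟩

/-- `leg13` as a continuous homomorphism. -/
def leg13Hom (X : ProAlg) : (X.tensor X).Lim →A[ℂ] (X.tensor (X.tensor X)).Lim :=
  ⟨leg13, continuous_limMap _ _⟩

/-- `leg23` as a continuous homomorphism. -/
def leg23Hom (X : ProAlg) : (X.tensor X).Lim →A[ℂ] (X.tensor (X.tensor X)).Lim :=
  ⟨leg23, continuous_limMap _ _⟩

theorem leg12_tmul (x y : X.Lim) : leg12Hom X (x ⊠ y) = x ⊠ (y ⊠ 1) := rfl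
theorem leg13_tmul (x y : X.Lim) : leg13Hom X (x ⊠ y) = x ⊠ (1 ⊠ y) := rfl
theorem leg23_tmul (x y : X.Lim) : leg23Hom X (x ⊠ y) = 1 ⊠ (x ⊠ y) := rfl

/-- The exchange `a ⊗ b ⊗ c ↦ b ⊗ a ⊗ c` of the first two factors. -/
def swap12 (X : ProAlg) : (X.tensor (X.tensor X)).Lim →A[ℂ] (X.tensor (X.tensor X)).Lim :=
  ⟨limMap (fun k => (Algebra.TensorProduct.leftComm ℂ (X.obj k) (X.obj k) (X.obj k)).toAlgHom)
    (fun k => by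
      apply Algebra.TensorProduct.ext
      · exact AlgHom.ext fun _ => rfl
      · exact Algebra.TensorProduct.ext' fun _ _ => rfl), continuous_limMap _ _⟩

theorem swap12_tmul (x y z : X.Lim) : swap12 X (x ⊠ (y ⊠ z)) = y ⊠ (x ⊠ z) := rfl

/-- Two continuous homomorphisms on the completed tensor square agree if they agree on pure
tensors. -/
theorem algHom_eq_of_tmul {W : Type*} [TopologicalSpace W] [T2Space W] [Ring W] [Algebra ℂ W]
    (f g : (X.tensor X).Lim →A[ℂ] W) (h : ∀ x y, f (x ⊠ y) = g (x ⊠ y)) (t : (X.tensor X).Lim) :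
    f t = g t :=
  tensor_ext (f := f.toAlgHom.toLinearMap) (g := g.toAlgHom.toLinearMap) f.cont g.cont h t

theorem swap12_leg12 (t : (X.tensor X).Lim) :
    swap12 X (leg12Hom X t) = leg12Hom X (ProAlg.flip t) :=
  algHom_eq_of_tmul ((swap12 X).comp (leg12Hom X)) ((leg12Hom X).comp (H4.flipHom X X))
    (fun _ _ => rfl) t

theorem swap12_leg13 (t : (X.tensor X).Lim) : swap12 X (leg13Hom X t) = leg23Hom X t :=
  algHom_eq_of_tmul ((swap12 X).comp (leg13Hom X)) (leg23Hom X) (fun _ _ => rfl) t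

theorem swap12_leg23 (t : (X.tensor X).Lim) : swap12 X (leg23Hom X t) = leg13Hom X t :=
  algHom_eq_of_tmul ((swap12 X).comp (leg23Hom X)) (leg13Hom X) (fun _ _ => rfl) t

theorem assoc_tmul_eq (t : (X.tensor X).Lim) (y : X.Lim) :
    ProAlg.assoc (t ⊠ y) = leg12Hom X t * ((1 : X.Lim) ⊠ ((1 : X.Lim) ⊠ y)) := by
  have h1 : ∀ t, ProAlg.assoc (t ⊠ (1 : X.Lim)) = leg12Hom X t :=
    algHom_eq_of_tmul (ContinuousAlgHom.comp ⟨ProAlg.assoc, continuous_limMap _ _⟩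
      (inl (X.tensor X) X)) (leg12Hom X) (fun _ _ => rfl)
  rw [← h1]
  change _ = ProAlg.assoc (t ⊠ 1) * ProAlg.assoc (1 ⊠ y)
  rw [← map_mul, tmul_mul_tmul, one_mul, mul_one]

theorem commute_leg12 (t : (X.tensor X).Lim) (z : X.Lim) :
    Commute (leg12Hom X t) ((1 : X.Lim) ⊠ ((1 : X.Lim) ⊠ z)) := by
  change ProAlg.leg12 t * ProAlg.assoc (1 ⊠ z) = ProAlg.assoc (1 ⊠ z) * ProAlg.leg12 t
  have h1 : ProAlg.leg12 t = ProAlg.assoc (t ⊠ (1 : X.Lim)) := by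
    rw [assoc_tmul_eq]
    exact (mul_one _).symm
  rw [h1, ← map_mul, ← map_mul, tmul_mul_tmul, tmul_mul_tmul, one_mul, mul_one, one_mul, mul_one]

theorem commute_leg23 (t : (X.tensor X).Lim) (z : X.Lim) :
    Commute (leg23Hom X t) (z ⊠ ((1 : X.Lim) ⊠ (1 : X.Lim))) :=
  (commute_inl_inr (X := X) (Y := X.tensor X) z t).symm

theorem tmul_eq_leg23 (x : X.Lim) (t : (X.tensor X).Lim) :
    x ⊠ t = leg23Hom X t * (x ⊠ ((1 : X.Lim) ⊠ (1 : X.Lim))) := by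
  change x ⊠ t = (1 ⊠ t) * (x ⊠ 1)
  rw [tmul_mul_tmul, one_mul, mul_one]

theorem commute_leg13 (t : (X.tensor X).Lim) (z : X.Lim) :
    Commute (leg13Hom X t) ((1 : X.Lim) ⊠ (z ⊠ (1 : X.Lim))) := by
  have := (commute_leg23 t z).map (swap12 X)
  rwa [swap12_leg23, swap12_tmul] at this

end ProAlg

namespace H4

open Filter Topology ProAlg Gen

variable {X Y : ProAlg} (h w : ℂ)

/-! ### The coproduct of `R` -/

theorem expo_semiconj_of_isUnit {x x' y : X.Lim} (hy : IsUnit y) (hx : TopNilp x)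
    (h : SemiconjBy y x x') : SemiconjBy y (expo x) (expo x') :=
  expo_semiconj hx (hx.of_semiconj hy h) h

theorem semiconj_comulLeft {u : U h w} {d : U2 h w}
    (hd : twist h w * comulHom h w u = d * twist h w) (y : U h w) :
    SemiconjBy (leg12Hom _ (twist h w)) (comulLeftHom h w (u ⊠ y)) (ProAlg.assoc (d ⊠ y)) := by
  rw [comulLeftHom_tmul, assoc_tmul_eq, assoc_tmul_eq, SemiconjBy, ← mul_assoc, ← map_mul, hd,
    map_mul, mul_assoc, (commute_leg12 _ _).eq, mul_assoc]

theorem semiconj_comulRight {u : U h w} {d : U2 h w}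
    (hd : twist h w * comulHom h w u = d * twist h w) (x : U h w) :
    SemiconjBy (leg23Hom _ (twist h w)) (comulRightHom h w (x ⊠ u)) (x ⊠ d) := by
  rw [comulRightHom_tmul, tmul_eq_leg23, tmul_eq_leg23 x d, SemiconjBy, ← mul_assoc, ← map_mul, hd,
    map_mul, mul_assoc, (commute_leg23 _ _).eq, mul_assoc]

theorem expo_smul_add {x y : X.Lim} (c : ℂ) (hx : TopNilp (c • x)) (hy : TopNilp (c • y))
    (hxy : Commute x y) : expo (c • (x + y)) = expo (c • x) * expo (c • y) := by
  rw [smul_add, expo_add hx hy ((hxy.smul_left c).smul_right c)]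

theorem leg12_twist : leg12Hom _ (twist h w) = expo (w • (gen h w N ⊠ (gen h w Ap ⊠ 1))) := by
  rw [twist, map_expo _ (topNilp_N_Ap h w), map_smul, leg12_tmul]
theorem leg13_twist : leg13Hom _ (twist h w) = expo (w • (gen h w N ⊠ (1 ⊠ gen h w Ap))) := by
  rw [twist, map_expo _ (topNilp_N_Ap h w), map_smul, leg13_tmul]
theorem leg23_twist : leg23Hom _ (twist h w) = expo (w • (1 ⊠ (gen h w N ⊠ gen h w Ap))) := by
  rw [twist, map_expo _ (topNilp_N_Ap h w), map_smul, leg23_tmul]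
theorem leg12_flip_twist : leg12Hom _ (ProAlg.flip (twist h w)) =
    expo (w • (gen h w Ap ⊠ (gen h w N ⊠ 1))) := by
  rw [flip_twist, map_expo _ (topNilp_Ap_N h w), map_smul, leg12_tmul]
theorem leg13_flip_twist : leg13Hom _ (ProAlg.flip (twist h w)) =
    expo (w • (gen h w Ap ⊠ (1 ⊠ gen h w N))) := by
  rw [flip_twist, map_expo _ (topNilp_Ap_N h w), map_smul, leg13_tmul]
theorem leg23_flip_twist : leg23Hom _ (ProAlg.flip (twist h w)) =
    expo (w • (1 ⊠ (gen h w Ap ⊠ gen h w N))) := by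
  rw [flip_twist, map_expo _ (topNilp_Ap_N h w), map_smul, leg23_tmul]

theorem leg12_Rh : leg12Hom _ (Rh h w) = expo ((-2 * h) • (gen h w E ⊠ (gen h w N ⊠ 1))) *
      expo ((2 * h) • ((expE h w h * gen h w A) ⊠ (apTilde h w ⊠ 1))) := by
  rw [Rh, map_mul, map_expo _ (topNilp_E_N h w), map_expo _ (topNilp_A_apTilde h w), map_smul,
      map_smul, leg12_tmul, leg12_tmul]

theorem leg13_Rh : leg13Hom _ (Rh h w) = expo ((-2 * h) • (gen h w E ⊠ (1 ⊠ gen h w N))) *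
      expo ((2 * h) • ((expE h w h * gen h w A) ⊠ (1 ⊠ apTilde h w))) := by
  rw [Rh, map_mul, map_expo _ (topNilp_E_N h w), map_expo _ (topNilp_A_apTilde h w), map_smul,
      map_smul, leg13_tmul, leg13_tmul]

theorem leg23_Rh : leg23Hom _ (Rh h w) = expo ((-2 * h) • (1 ⊠ (gen h w E ⊠ gen h w N))) *
      expo ((2 * h) • (1 ⊠ ((expE h w h * gen h w A) ⊠ apTilde h w))) := by
  rw [Rh, map_mul, map_expo _ (topNilp_E_N h w), map_expo _ (topNilp_A_apTilde h w), map_smul,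
      map_smul, leg23_tmul, leg23_tmul]

theorem topNilp_tmul_tmul_left {x : X.Lim} (hx : TopNilp x) (y z : X.Lim) (c : ℂ) :
    TopNilp (c • (x ⊠ (y ⊠ z))) := (hx.tmul_left _).smul c
theorem topNilp_tmul_tmul_mid {y : X.Lim} (hy : TopNilp y) (x z : X.Lim) (c : ℂ) :
    TopNilp (c • (x ⊠ (y ⊠ z))) := (TopNilp.tmul_right _ (hy.tmul_left _)).smul c
theorem topNilp_tmul_tmul_right {z : X.Lim} (hz : TopNilp z) (x y : X.Lim) (c : ℂ) :
    TopNilp (c • (x ⊠ (y ⊠ z))) := (TopNilp.tmul_right _ (TopNilp.tmul_right _ hz)).smul c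

theorem commute_tmul_tmul {a a' b b' c c' : X.Lim} (ha : Commute a a') (hb : Commute b b')
    (hc : Commute c c') : Commute (a ⊠ (b ⊠ c)) (a' ⊠ (b' ⊠ c')) :=
  commute_tmul ha (commute_tmul hb hc)

theorem commute_leg13_leg23_twist :
    Commute (leg13Hom _ (twist h w)) (leg23Hom _ (twist h w)) := by
  rw [leg23_twist, leg13_twist]
  have hP := topNilp_Ap h w
  refine expo_commute (topNilp_tmul_tmul_right hP _ _ _) (Commute.symm (expo_commute
      (topNilp_tmul_tmul_right hP _ _ _) (((commute_tmul_tmul (Commute.one_left _)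
      (Commute.one_right _) (Commute.refl _)).smul_left _).smul_right _)))

/-- `F₁₂ (Δ ⊗ id)(F) = F₁₃ F₂₃ F₁₂`. -/
theorem comulLeft_twist : leg12Hom _ (twist h w) * comulLeftHom h w (twist h w) =
    leg13Hom _ (twist h w) * leg23Hom _ (twist h w) * leg12Hom _ (twist h w) := by
  have hs := expo_semiconj_of_isUnit ((isUnit_twist h w).map (leg12Hom (tower h w)))
    ((topNilp_N_Ap h w).map (comulLeftHom h w))
    (by rw [map_smul]; exact (semiconj_comulLeft h w (twist_mul_comul_N h w) (gen h w Ap)).smul_right w)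
  rw [← map_expo _ (topNilp_N_Ap h w), add_tmul, map_add, assoc_tmul, assoc_tmul,
    expo_smul_add w (topNilp_tmul_tmul_right (topNilp_Ap h w) _ _ w)
      (topNilp_tmul_tmul_right (topNilp_Ap h w) _ _ w)
      (commute_tmul_tmul (Commute.one_right _) (Commute.one_left _) (Commute.refl _)),
    ← leg13_twist, ← leg23_twist] at hs
  exact hs.eq

/-- `(Δ ⊗ id)(F₂₁) = F₃₁ F₃₂`. -/
theorem comulLeft_flip_twist : comulLeftHom h w (ProAlg.flip (twist h w)) =
    leg13Hom _ (ProAlg.flip (twist h w)) * leg23Hom _ (ProAlg.flip (twist h w)) := by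
  rw [leg13_flip_twist, leg23_flip_twist, flip_twist, map_expo _ (topNilp_Ap_N h w), map_smul,
    comulLeftHom_tmul, comulHom_Ap, add_tmul, map_add, assoc_tmul, assoc_tmul,
    expo_smul_add w (topNilp_tmul_tmul_left (topNilp_Ap h w) _ _ w)
      (topNilp_tmul_tmul_mid (topNilp_Ap h w) _ _ w)
      (commute_tmul_tmul (Commute.one_right _) (Commute.one_left _) (Commute.refl _))]

/-- `(id ⊗ Δ)(F) = F₁₃ F₁₂`. -/
theorem comulRight_twist : comulRightHom h w (twist h w) =
    leg13Hom _ (twist h w) * leg12Hom _ (twist h w) := by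
  rw [leg13_twist, leg12_twist, twist, map_expo _ (topNilp_N_Ap h w), map_smul,
    comulRightHom_tmul, comulHom_Ap, add_comm, tmul_add,
    expo_smul_add w (topNilp_tmul_tmul_right (topNilp_Ap h w) _ _ w)
      (topNilp_tmul_tmul_mid (topNilp_Ap h w) _ _ w)
      (commute_tmul_tmul (Commute.refl _) (Commute.one_left _) (Commute.one_right _))]

/-- `F₂₃ (id ⊗ Δ)(F₂₁) = F₃₁ F₂₁ F₂₃`. -/
theorem comulRight_flip_twist :
    leg23Hom _ (twist h w) * comulRightHom h w (ProAlg.flip (twist h w)) =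
    leg13Hom _ (ProAlg.flip (twist h w)) * leg12Hom _ (ProAlg.flip (twist h w)) *
      leg23Hom _ (twist h w) := by
  have hs := expo_semiconj_of_isUnit ((isUnit_twist h w).map (leg23Hom (tower h w)))
    ((topNilp_Ap_N h w).map (comulRightHom h w))
    (by rw [map_smul]; exact (semiconj_comulRight h w (twist_mul_comul_N h w) (gen h w Ap)).smul_right w)
  rw [← map_expo _ (topNilp_Ap_N h w), add_comm, tmul_add,
    expo_smul_add w (topNilp_tmul_tmul_left (topNilp_Ap h w) _ _ w)
      (topNilp_tmul_tmul_left (topNilp_Ap h w) _ _ w)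
      (commute_tmul_tmul (Commute.refl _) (Commute.one_left _) (Commute.one_right _)),
    ← leg13_flip_twist, ← leg12_flip_twist, ← flip_twist] at hs
  exact hs.eq

theorem twist_mul_comul_E : twist h w * comulHom h w (gen h w E) =
    (gen h w E ⊠ 1 + 1 ⊠ gen h w E) * twist h w := by
  rw [comulHom_E, (commute_primitive_E h w _).eq]

theorem twist_mul_comul_expE_A : twist h w * comulHom h w (expE h w h * gen h w A) =
    ((expE h w h * gen h w A) ⊠ (expE h w h * expE h w h) + 1 ⊠ (expE h w h * gen h w A)) *
      twist h w := by
  have hK : Commute (twist h w) (expE h w h ⊠ expE h w h) := (commute_of_tmul (fun x y =>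
    commute_tmul (commute_expE h w h x) (commute_expE h w h y)) _).symm
  rw [map_mul, comulHom_expE, ← mul_assoc, hK.eq, mul_assoc, twist_mul_comul_A, ← mul_assoc,
    mul_add, tmul_mul_tmul, tmul_mul_tmul, expE_mul_neg]

/-- `F₁₂ (Δ ⊗ id)(Rʰ) = Rʰ₁₃ Rʰ₂₃ F₁₂`. -/
theorem comulLeft_Rh : leg12Hom _ (twist h w) * comulLeftHom h w (Rh h w) =
    leg13Hom _ (Rh h w) * leg23Hom _ (Rh h w) * leg12Hom _ (twist h w) := by
  have hE := topNilp_E h w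
  have hB := topNilp_apTilde h w
  have s1 := expo_semiconj_of_isUnit ((isUnit_twist h w).map (leg12Hom (tower h w)))
    ((topNilp_E_N h w).map (comulLeftHom h w))
    (by
      rw [map_smul]
      exact (semiconj_comulLeft h w (twist_mul_comul_E h w) (gen h w N)).smul_right (-2 * h))
  have s2 := expo_semiconj_of_isUnit ((isUnit_twist h w).map (leg12Hom (tower h w)))
    ((topNilp_A_apTilde h w).map (comulLeftHom h w))
    (by
      rw [map_smul]
      exact (semiconj_comulLeft h w (twist_mul_comul_expE_A h w) (apTilde h w)).smul_right (2 * h))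
  rw [← map_expo _ (topNilp_E_N h w), add_tmul, map_add, assoc_tmul, assoc_tmul,
    expo_smul_add (-2 * h) (topNilp_tmul_tmul_left hE _ _ _) (topNilp_tmul_tmul_mid hE _ _ _)
      (commute_tmul_tmul (Commute.one_right _) (Commute.one_left _) (Commute.refl _))] at s1
  rw [← map_expo _ (topNilp_A_apTilde h w), add_tmul, map_add, assoc_tmul, assoc_tmul,
    expo_smul_add (2 * h) (topNilp_tmul_tmul_right hB _ _ _) (topNilp_tmul_tmul_right hB _ _ _)
      (commute_tmul_tmul (Commute.one_right _) ((commute_expE h w h _).mul_left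
        (commute_expE h w h _)) (Commute.refl _))] at s2
  -- Conjugation by `exp (-2h E₂ N₃)` absorbs the factor `exp (2h E₂)`.
  have s3 : SemiconjBy (expo ((-2 * h) • ((1 : U h w) ⊠ (gen h w E ⊠ gen h w N))))
      ((2 * h) • ((expE h w h * gen h w A) ⊠ ((expE h w h * expE h w h) ⊠ apTilde h w)))
      ((2 * h) • ((expE h w h * gen h w A) ⊠ (1 ⊠ apTilde h w))) := by
    have e := expo_E_N_mul_tmul h w (k := expE h w h * expE h w h) (y := apTilde h w) (a := 1)
      (fun z => (commute_expE h w h z).mul_left (commute_expE h w h z))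
      (by rw [N_mul_apTilde, one_smul])
    rw [expE_mul, expE_mul, mul_one, show -2 * h + (h + h) = 0 by ring, expE_zero] at e
    have e' := congrArg (inr (tower h w) _) e
    rw [map_mul, map_mul, map_expo _ (topNilp_E_N h w), map_smul] at e'
    change expo _ * (1 ⊠ (expE h w (h + h) ⊠ apTilde h w)) =
      (1 ⊠ (1 ⊠ apTilde h w)) * expo _ at e'
    change expo ((-2 * h) • ((1 : U h w) ⊠ (gen h w E ⊠ gen h w N))) * _ =
      _ * expo ((-2 * h) • ((1 : U h w) ⊠ (gen h w E ⊠ gen h w N))) at e'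
    have hc : Commute (expo ((-2 * h) • ((1 : U h w) ⊠ (gen h w E ⊠ gen h w N))))
        ((expE h w h * gen h w A) ⊠ (1 : U2 h w)) :=
      (expo_commute (topNilp_tmul_tmul_mid hE _ _ _)
        ((commute_tmul (Commute.one_right _) (Commute.one_left _)).smul_right _)).symm
    have split : ∀ t : U2 h w, (expE h w h * gen h w A) ⊠ t =
        ((expE h w h * gen h w A) ⊠ (1 : U2 h w)) * ((1 : U h w) ⊠ t) := fun t => by
      rw [tmul_mul_tmul, one_mul, mul_one]
    refine SemiconjBy.smul_right ?_ (2 * h)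
    rw [SemiconjBy, expE_mul, split, split (1 ⊠ apTilde h w), ← mul_assoc, hc.eq, mul_assoc, e',
      mul_assoc]
  have s4 := expo_semiconj (topNilp_tmul_tmul_right hB _ _ _) (topNilp_tmul_tmul_right hB _ _ _) s3
  have eR : comulLeftHom h w (Rh h w) =
      comulLeftHom h w (expo ((-2 * h) • (gen h w E ⊠ gen h w N))) *
      comulLeftHom h w (expo ((2 * h) • ((expE h w h * gen h w A) ⊠ apTilde h w))) := map_mul _ _ _
  rw [eR, leg13_Rh, leg23_Rh, (s1.mul_right s2).eq]
  congr 1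
  rw [mul_assoc, mul_assoc, ← mul_assoc _ (expo _) (expo _), s4.eq, mul_assoc]

/-- `F₂₃ (id ⊗ Δ)(Rʰ) = Rʰ₁₃ Rʰ₁₂ F₂₃`. -/
theorem comulRight_Rh : leg23Hom _ (twist h w) * comulRightHom h w (Rh h w) =
    leg13Hom _ (Rh h w) * leg12Hom _ (Rh h w) * leg23Hom _ (twist h w) := by
  have hE := topNilp_E h w
  have hB := topNilp_apTilde h w
  have s1 := expo_semiconj_of_isUnit ((isUnit_twist h w).map (leg23Hom (tower h w)))
    ((topNilp_E_N h w).map (comulRightHom h w))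
    (by
      rw [map_smul]
      exact (semiconj_comulRight h w (twist_mul_comul_N h w) (gen h w E)).smul_right (-2 * h))
  have s2 := expo_semiconj_of_isUnit ((isUnit_twist h w).map (leg23Hom (tower h w)))
    ((topNilp_A_apTilde h w).map (comulRightHom h w))
    (by
      rw [map_smul]
      exact (semiconj_comulRight h w (twist_mul_comul_apTilde h w)
        (expE h w h * gen h w A)).smul_right (2 * h))
  rw [← map_expo _ (topNilp_E_N h w), add_comm, tmul_add,
    expo_smul_add (-2 * h) (topNilp_tmul_tmul_left hE _ _ _) (topNilp_tmul_tmul_left hE _ _ _)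
      (commute_tmul_tmul (Commute.refl _) (Commute.one_left _) (Commute.one_right _))] at s1
  rw [← map_expo _ (topNilp_A_apTilde h w), add_comm, tmul_add,
    expo_smul_add (2 * h) (topNilp_tmul_tmul_right hB _ _ _) (topNilp_tmul_tmul_mid hB _ _ _)
      (commute_tmul_tmul (Commute.refl _) (Commute.one_left _) (Commute.one_right _))] at s2
  have hc : Commute (expo ((-2 * h) • (gen h w E ⊠ (gen h w N ⊠ (1 : U h w)))))
      (expo ((2 * h) • ((expE h w h * gen h w A) ⊠ ((1 : U h w) ⊠ apTilde h w)))) :=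
    (expo_commute (topNilp_tmul_tmul_left hE _ _ _) ((expo_commute
      (topNilp_tmul_tmul_right hB _ _ _) (((commute_tmul_tmul (commute_E h w _)
      (Commute.one_right _) (Commute.one_left _)).smul_left _).smul_right _)).symm)).symm
  have eR : comulRightHom h w (Rh h w) =
      comulRightHom h w (expo ((-2 * h) • (gen h w E ⊠ gen h w N))) *
      comulRightHom h w (expo ((2 * h) • ((expE h w h * gen h w A) ⊠ apTilde h w))) := map_mul _ _ _
  rw [eR, leg13_Rh, leg12_Rh, (s1.mul_right s2).eq]
  congr 1
  rw [mul_assoc, mul_assoc, ← mul_assoc (expo ((-2 * h) • (gen h w E ⊠ (gen h w N ⊠ 1)))), hc.eq,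
    mul_assoc]

theorem Rhw_commute_primitive_Ap :
    Commute (Rhw h w) (gen h w Ap ⊠ 1 + 1 ⊠ gen h w Ap) := by
  have := Rhw_mul_comul h w (gen h w Ap)
  rw [comulHom_Ap, map_add, flip_tmul, flip_tmul] at this
  rw [Commute, SemiconjBy, this, add_comm]

/-- `(Δ ⊗ id)(R) = R₁₃ R₂₃`. -/
theorem comulLeft_Rhw : comulLeftHom h w (Rhw h w) =
    leg13Hom _ (Rhw h w) * leg23Hom _ (Rhw h w) := by
  have hP := topNilp_Ap h w
  have hR := congrArg (comulLeftHom h w) (flip_twist_mul_Rhw h w)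
  have hR13 := congrArg (leg13Hom (tower h w)) (flip_twist_mul_Rhw h w)
  have hR23 := congrArg (leg23Hom (tower h w)) (flip_twist_mul_Rhw h w)
  rw [map_mul, map_mul, comulLeft_flip_twist] at hR
  rw [map_mul, map_mul] at hR13 hR23
  -- `R₂₃` commutes with `F₁₃ F₁₂ = exp (w N₁ (A⁺₂ + A⁺₃))`.
  have c1 : Commute (leg23Hom _ (Rhw h w)) (leg13Hom _ (twist h w) * leg12Hom _ (twist h w)) := by
    rw [← comulRight_twist, twist, map_expo _ (topNilp_N_Ap h w)]
    refine expo_commute ((topNilp_N_Ap h w).map _) ?_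
    rw [map_smul, comulRightHom_tmul, comulHom_Ap, tmul_eq_leg23]
    exact (((Rhw_commute_primitive_Ap h w).map (leg23Hom _)).mul_right
      (commute_leg23 _ _)).smul_right w
  -- `Rʰ₁₃` commutes with `F₁₂ F₃₂ = exp (w (N₁ + N₃) A⁺₂)`.
  have c2 : Commute (leg13Hom _ (Rh h w))
      (leg12Hom _ (twist h w) * leg23Hom _ (ProAlg.flip (twist h w))) := by
    have e : leg12Hom _ (twist h w) * leg23Hom _ (ProAlg.flip (twist h w)) =
        expo (w • (leg13Hom _ (gen h w N ⊠ 1 + 1 ⊠ gen h w N) * (1 ⊠ (gen h w Ap ⊠ 1)))) := by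
      rw [leg12_twist, leg23_flip_twist, ← expo_smul_add w (topNilp_tmul_tmul_mid hP _ _ _)
        (topNilp_tmul_tmul_mid hP _ _ _) (commute_tmul_tmul (Commute.one_right _) (Commute.refl _)
        (Commute.one_left _)), map_add, leg13_tmul, leg13_tmul, add_mul]
      simp only [tmul_mul_tmul, one_mul, mul_one]
    rw [e]
    refine expo_commute (TopNilp.smul (TopNilp.mul_left (TopNilp.tmul_right _ (hP.tmul_left _))
      (commute_leg13 _ _)) w) ?_
    exact (((Rh_commute_primitive_N h w).symm.map (leg13Hom _)).mul_right
      (commute_leg13 _ _)).smul_right w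
  have c3 : Commute (leg12Hom _ (twist h w)) (leg13Hom _ (twist h w)) := by
    rw [leg12_twist, leg13_twist]
    refine expo_commute (topNilp_tmul_tmul_right hP _ _ _) (Commute.symm (expo_commute
      (topNilp_tmul_tmul_mid hP _ _ _) (((commute_tmul_tmul (Commute.refl _) (Commute.one_left _)
      (Commute.one_right _)).smul_left _).smul_right _)))
  have c4 := commute_leg13_leg23_twist h w
  have c6 : Commute (leg12Hom _ (twist h w)) (leg23Hom _ (ProAlg.flip (twist h w))) := by
    rw [leg12_twist, leg23_flip_twist]
    refine expo_commute (topNilp_tmul_tmul_mid hP _ _ _) (Commute.symm (expo_commute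
      (topNilp_tmul_tmul_mid hP _ _ _) (((commute_tmul_tmul (Commute.one_left _)
      (Commute.refl _) (Commute.one_right _)).smul_left _).smul_right _)))
  have c5 : Commute (leg13Hom _ (ProAlg.flip (twist h w)))
      (leg23Hom _ (ProAlg.flip (twist h w))) := by
    rw [leg13_flip_twist, leg23_flip_twist]
    refine expo_commute (topNilp_tmul_tmul_mid hP _ _ _) (Commute.symm (expo_commute
      (topNilp_tmul_tmul_left hP _ _ _) (((commute_tmul_tmul (Commute.one_left _)
      (Commute.one_right _) (Commute.refl _)).smul_left _).smul_right _)))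
  have hu := (((isUnit_twist h w).map (leg12Hom (tower h w))).mul
    ((isUnit_flip_twist h w).map (leg13Hom (tower h w)))).mul
    ((isUnit_flip_twist h w).map (leg23Hom (tower h w)))
  have hF := comulLeft_twist h w
  have hRh := comulLeft_Rh h w
  refine hu.mul_left_cancel ?_
  generalize leg12Hom (tower h w) (twist h w) = F12 at *
  generalize leg13Hom (tower h w) (twist h w) = F13 at *
  generalize leg23Hom (tower h w) (twist h w) = F23 at *
  generalize leg13Hom (tower h w) (ProAlg.flip (twist h w)) = F31 at *
  generalize leg23Hom (tower h w) (ProAlg.flip (twist h w)) = F32 at *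
  generalize leg13Hom (tower h w) (Rhw h w) = R13 at *
  generalize leg23Hom (tower h w) (Rhw h w) = R23 at *
  generalize leg13Hom (tower h w) (Rh h w) = G13 at *
  generalize leg23Hom (tower h w) (Rh h w) = G23 at *
  calc F12 * F31 * F32 * comulLeftHom h w (Rhw h w)
      = F12 * (F31 * F32 * comulLeftHom h w (Rhw h w)) := by simp only [mul_assoc]
    _ = G13 * G23 * (F12 * comulLeftHom h w (twist h w)) := by
        rw [hR, ← mul_assoc, hRh, mul_assoc]
    _ = G13 * (G23 * F23) * F13 * F12 := by rw [hF, c4.eq]; simp only [mul_assoc]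
    _ = G13 * F32 * (R23 * (F13 * F12)) := by rw [← hR23]; simp only [mul_assoc]
    _ = G13 * F32 * F12 * F13 * R23 := by rw [c1.eq, ← c3.eq]; simp only [mul_assoc]
    _ = G13 * (F12 * F32) * F13 * R23 := by rw [c6.eq]; simp only [mul_assoc]
    _ = F12 * F32 * (G13 * F13) * R23 := by rw [c2.eq]; simp only [mul_assoc]
    _ = F12 * (F31 * F32) * (R13 * R23) := by rw [← hR13, c5.eq]; simp only [mul_assoc]
    _ = F12 * F31 * F32 * (R13 * R23) := by simp only [mul_assoc]

/-- `(id ⊗ Δ)(R) = R₁₃ R₁₂`. -/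
theorem comulRight_Rhw : comulRightHom h w (Rhw h w) =
    leg13Hom _ (Rhw h w) * leg12Hom _ (Rhw h w) := by
  have hP := topNilp_Ap h w
  have hR := congrArg (comulRightHom h w) (flip_twist_mul_Rhw h w)
  have hR13 := congrArg (leg13Hom (tower h w)) (flip_twist_mul_Rhw h w)
  have hR12 := congrArg (leg12Hom (tower h w)) (flip_twist_mul_Rhw h w)
  rw [map_mul, map_mul, comulRight_twist] at hR
  rw [map_mul, map_mul] at hR13 hR12
  -- `R₁₃` commutes with `F₂₁ F₂₃ = exp (w N₂ (A⁺₁ + A⁺₃))`.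
  have c1 : Commute (leg13Hom _ (Rhw h w))
      (leg12Hom _ (ProAlg.flip (twist h w)) * leg23Hom _ (twist h w)) := by
    have e : leg12Hom _ (ProAlg.flip (twist h w)) * leg23Hom _ (twist h w) =
        expo (w • (leg13Hom _ (gen h w Ap ⊠ 1 + 1 ⊠ gen h w Ap) * (1 ⊠ (gen h w N ⊠ 1)))) := by
      rw [leg12_flip_twist, leg23_twist, ← expo_smul_add w (topNilp_tmul_tmul_left hP _ _ _)
        (topNilp_tmul_tmul_right hP _ _ _) (commute_tmul_tmul (Commute.one_right _)
        (Commute.refl _) (Commute.one_left _)), map_add, leg13_tmul, leg13_tmul, add_mul]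
      simp only [tmul_mul_tmul, one_mul, mul_one]
    have hn : TopNilp (gen h w Ap ⊠ (1 : U h w) + (1 : U h w) ⊠ gen h w Ap) :=
      (hP.tmul_left _).add (TopNilp.tmul_right _ hP) (commute_tmul_one_one_tmul _ _)
    rw [e]
    refine expo_commute (TopNilp.smul (TopNilp.mul_right (hn.map _) (commute_leg13 _ _)) w) ?_
    exact (((Rhw_commute_primitive_Ap h w).map (leg13Hom _)).mul_right
      (commute_leg13 _ _)).smul_right w
  -- `Rʰ₁₂` commutes with `F₁₃ F₂₃ = exp (w (N₁ + N₂) A⁺₃)`.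
  have c2 : Commute (leg12Hom _ (Rh h w)) (leg13Hom _ (twist h w) * leg23Hom _ (twist h w)) := by
    have e : leg13Hom _ (twist h w) * leg23Hom _ (twist h w) =
        expo (w • (leg12Hom _ (gen h w N ⊠ 1 + 1 ⊠ gen h w N) * (1 ⊠ (1 ⊠ gen h w Ap)))) := by
      rw [leg13_twist, leg23_twist, ← expo_smul_add w (topNilp_tmul_tmul_right hP _ _ _)
        (topNilp_tmul_tmul_right hP _ _ _) (commute_tmul_tmul (Commute.one_right _)
        (Commute.one_left _) (Commute.refl _)), map_add, leg12_tmul, leg12_tmul, add_mul]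
      simp only [tmul_mul_tmul, one_mul, mul_one]
    rw [e]
    refine expo_commute (TopNilp.smul (TopNilp.mul_left (TopNilp.tmul_right _
      (TopNilp.tmul_right _ hP)) (commute_leg12 _ _)) w) ?_
    exact (((Rh_commute_primitive_N h w).symm.map (leg12Hom _)).mul_right
      (commute_leg12 _ _)).smul_right w
  have c3 : Commute (leg12Hom _ (ProAlg.flip (twist h w))) (leg23Hom _ (twist h w)) := by
    rw [leg12_flip_twist, leg23_twist]
    refine expo_commute (topNilp_tmul_tmul_right hP _ _ _) (Commute.symm (expo_commute
      (topNilp_tmul_tmul_left hP _ _ _) (((commute_tmul_tmul (Commute.one_left _)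
      (Commute.refl _) (Commute.one_right _)).smul_left _).smul_right _)))
  have c4 := commute_leg13_leg23_twist h w
  have hu := (((isUnit_flip_twist h w).map (leg13Hom (tower h w))).mul
    ((isUnit_flip_twist h w).map (leg12Hom (tower h w)))).mul
    ((isUnit_twist h w).map (leg23Hom (tower h w)))
  have hF := comulRight_flip_twist h w
  have hRh := comulRight_Rh h w
  refine hu.mul_left_cancel ?_
  generalize leg12Hom (tower h w) (twist h w) = F12 at *
  generalize leg13Hom (tower h w) (twist h w) = F13 at *
  generalize leg23Hom (tower h w) (twist h w) = F23 at *
  generalize leg12Hom (tower h w) (ProAlg.flip (twist h w)) = F21 at *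
  generalize leg13Hom (tower h w) (ProAlg.flip (twist h w)) = F31 at *
  generalize leg13Hom (tower h w) (Rhw h w) = R13 at *
  generalize leg12Hom (tower h w) (Rhw h w) = R12 at *
  generalize leg13Hom (tower h w) (Rh h w) = G13 at *
  generalize leg12Hom (tower h w) (Rh h w) = G12 at *
  calc F31 * F21 * F23 * comulRightHom h w (Rhw h w)
      = F23 * (comulRightHom h w (ProAlg.flip (twist h w)) * comulRightHom h w (Rhw h w)) := by
        rw [← mul_assoc, hF]
    _ = G13 * G12 * F23 * (F13 * F12) := by rw [hR, ← mul_assoc, hRh]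
    _ = G13 * (G12 * (F13 * F23)) * F12 := by rw [c4.eq]; simp only [mul_assoc]
    _ = G13 * (F13 * F23) * (G12 * F12) := by rw [c2.eq]; simp only [mul_assoc]
    _ = (G13 * F13) * (F21 * F23) * R12 := by rw [← hR12, c3.eq]; simp only [mul_assoc]
    _ = F31 * (R13 * (F21 * F23)) * R12 := by rw [← hR13]; simp only [mul_assoc]
    _ = F31 * F21 * F23 * (R13 * R12) := by rw [c1.eq]; simp only [mul_assoc]

/-- `R₁₂ (Δ ⊗ id)(t) = (σΔ ⊗ id)(t) R₁₂`. -/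
theorem leg12_Rhw_mul_comulLeft (t : U2 h w) :
    leg12Hom _ (Rhw h w) * comulLeftHom h w t =
      swap12 _ (comulLeftHom h w t) * leg12Hom _ (Rhw h w) := by
  refine tensor_ext
    (f := LinearMap.mulLeft ℂ (leg12Hom _ (Rhw h w)) ∘ₗ (comulLeftHom h w).toAlgHom.toLinearMap)
    (g := LinearMap.mulRight ℂ (leg12Hom _ (Rhw h w)) ∘ₗ
      ((swap12 _).comp (comulLeftHom h w)).toAlgHom.toLinearMap)
    (continuous_const.mul (comulLeftHom h w).cont)
    (((swap12 _).comp (comulLeftHom h w)).cont.mul continuous_const) (fun x y => ?_) t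
  change leg12Hom _ (Rhw h w) * comulLeftHom h w (x ⊠ y) =
    swap12 _ (comulLeftHom h w (x ⊠ y)) * leg12Hom _ (Rhw h w)
  rw [comulLeftHom_tmul, assoc_tmul_eq, map_mul, swap12_leg12, swap12_tmul, ← mul_assoc, ← map_mul,
    Rhw_mul_comul, map_mul, mul_assoc, (commute_leg12 _ _).eq, mul_assoc]

theorem satisfiesQYBE_Rhw : SatisfiesQYBE (Rhw h w) := by
  change leg12Hom _ (Rhw h w) * leg13Hom _ (Rhw h w) * leg23Hom _ (Rhw h w) =
    leg23Hom _ (Rhw h w) * leg13Hom _ (Rhw h w) * leg12Hom _ (Rhw h w)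
  rw [mul_assoc, ← comulLeft_Rhw, leg12_Rhw_mul_comulLeft, comulLeft_Rhw, map_mul, swap12_leg13,
    swap12_leg23]

theorem isUniversalRMatrix_Rhw : (hopf h w).IsUniversalRMatrix (Rhw h w) where
  isUnit := isUnit_Rhw h w
  intertwine u := by
    change Rhw h w * comulHom h w u * Ring.inverse (Rhw h w) = ProAlg.flip (comulHom h w u)
    rw [Rhw_mul_comul, mul_assoc, Ring.mul_inverse_cancel _ (isUnit_Rhw h w), mul_one]
  comulLeft := comulLeft_Rhw h w
  comulRight := comulRight_Rhw h w

theorem seriesConverge : SeriesConverge h w where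
  sinhE := (topNilp_E h w).converges _
  expE c := ((topNilp_E h w).smul c).converges _
  expAp c := ((topNilp_Ap h w).smul c).converges _
  apTilde := (topNilp_Ap h w).converges _
  twist := (topNilp_N_Ap h w).converges _
  Rh_left := (topNilp_E_N h w).converges _
  Rh_right := (topNilp_A_apTilde h w).converges _

end H4

end

theorem proposition6 (h w : ℂ) :
    H4.SeriesConverge h w ∧
    IsUnit (H4.twist h w) ∧
    (∃ H : TopHopf (H4.tower h w),
      H4.IsHopfOfU h w H ∧ H.IsUniversalRMatrix (H4.Rhw h w)) ∧
    SatisfiesQYBE (H4.Rhw h w) :=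
  ⟨H4.seriesConverge h w, H4.isUnit_twist h w,
    ⟨H4.hopf h w, H4.isHopfOfU_hopf h w, H4.isUniversalRMatrix_Rhw h w⟩,
    H4.satisfiesQYBE_Rhw h w⟩
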